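/- Let $n\ge 1$ be an integer, let $0\le\rho<1$ and let $m=-(1-\rho)n/2$. Let $BS^{m}_{\rho,\rho}(\mathbb{R}^n)$ be the class of all $\sigma=\sigma(x,\xi,\eta)\in C^\infty(\mathbb{R}^n\times\mathbb{R}^n\times\mathbb{R}^n)$ (complex-valued) such that for all multi-indices $\alpha,\beta,\gamma\in\mathbb{N}_0^n$ there is a constant $C_{\alpha,\beta,\gamma}>0$ with \[ |\partial_x^\alpha\partial_\xi^\beta\partial_\eta^\gamma\sigma(x,\xi,\eta)|\le C_{\alpha,\beta,\gamma}\,(1+|\xi|+|\eta|)^{m+\rho|\alpha|-\rho(|\beta|+|\gamma|)}\qquad\text{for all } x,\xi,\eta\in\mathbb{R}^n . \] For $\sigma\in BS^{m}_{\rho,\rho}(\mathbb{R}^n)$ and Schwartz functions $f,g\in\mathcal{S}(\mathbb{R}^n)$ put \[ T_\sigma(f,g)(x)=\frac{1}{(2\pi)^{2n}}\int_{\mathbb{R}^n\times\mathbb{R}^n}e^{ix\cdot(\xi+\eta)}\sigma(x,\xi,\eta)\widehat f(\xi)\widehat g(\eta)\,d\xi\,d\eta,\qquad \widehat f(\xi)=\int_{\mathbb{R}^n}e^{-iy\cdot\xi}f(y)\,dy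 . \] Then for every $\sigma\in BS^{m}_{\rho,\rho}(\mathbb{R}^n)$ the operator $T_\sigma$ is bounded from $L^2(\mathbb{R}^n)\times L^\infty(\mathbb{R}^n)$ to $L^2(\mathbb{R}^n)$: there is a finite constant $A_\sigma$ such that, for all $f,g\in\mathcal{S}(\mathbb{R}^n)$, the function $T_\sigma(f,g)$ belongs to $L^2(\mathbb{R}^n)$ and \[ \|T_\sigma(f,g)\|_{L^2}\le A_\sigma\,\|f\|_{L^2}\,\|g\|_{L^\infty}. \] -/

import Mathlib

open MeasureTheory
open scoped ContDiff ENNReal NNReal SchwartzMap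

noncomputable section

namespace BilinearPDO

/-- `ℝⁿ` with its Euclidean norm, inner product and Lebesgue measure. -/
abbrev RSpace (n : ℕ) : Type := EuclideanSpace ℝ (Fin n)

/-- The `i`-th standard basis vector of `ℝⁿ`. -/
def stdVec {n : ℕ} (i : Fin n) : RSpace n := EuclideanSpace.single i 1

/-- The first-order derivative of `F` in the direction `v`. -/
def dirDeriv {V : Type*} [NormedAddCommGroup V] [NormedSpace ℝ V]
    (v : V) (F : V → ℂ) : V → ℂ :=
  fun p => fderiv ℝ F p v

/-- `∂^α F = ∂_{e 0}^{α 0} ⋯ ∂_{e (n-1)}^{α (n-1)} F`: the mixed derivative of multi-index `α`,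
where the `i`-th partial derivative is taken in the direction `e i`. -/
def multiDeriv {V : Type*} [NormedAddCommGroup V] [NormedSpace ℝ V] {n : ℕ}
    (e : Fin n → V) (α : Fin n → ℕ) (F : V → ℂ) : V → ℂ :=
  (List.finRange n).foldr (fun i H => (dirDeriv (e i))^[α i] H) F

/-- `∂_x^α` for functions of `(x, ξ, η)`. -/
def derivX {n : ℕ} (α : Fin n → ℕ) (F : RSpace n × RSpace n × RSpace n → ℂ) :
    RSpace n × RSpace n × RSpace n → ℂ :=
  multiDeriv (fun i => (stdVec i, 0, 0)) α F

/-- `∂_ξ^β` for functions of `(x, ξ, η)`. -/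
def derivXi {n : ℕ} (β : Fin n → ℕ) (F : RSpace n × RSpace n × RSpace n → ℂ) :
    RSpace n × RSpace n × RSpace n → ℂ :=
  multiDeriv (fun i => (0, stdVec i, 0)) β F

/-- `∂_η^γ` for functions of `(x, ξ, η)`. -/
def derivEta {n : ℕ} (γ : Fin n → ℕ) (F : RSpace n × RSpace n × RSpace n → ℂ) :
    RSpace n × RSpace n × RSpace n → ℂ :=
  multiDeriv (fun i => (0, 0, stdVec i)) γ F

/-- The bilinear Hörmander symbol class `BS^m_{ρ,δ}(ℝⁿ)`. -/
def BS (n : ℕ) (m ρ δ : ℝ) : Set (RSpace n × RSpace n × RSpace n → ℂ) :=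
  {σ | ContDiff ℝ ∞ σ ∧
    ∀ α β γ : Fin n → ℕ, ∃ C : ℝ, 0 < C ∧ ∀ x ξ η : RSpace n,
      ‖derivX α (derivXi β (derivEta γ σ)) (x, ξ, η)‖ ≤
        C * (1 + ‖ξ‖ + ‖η‖) ^
          (m + δ * ((∑ i, α i : ℕ) : ℝ) - ρ * (((∑ i, β i : ℕ) : ℝ) + ((∑ i, γ i : ℕ) : ℝ)))}

/-- The Fourier transform `f̂(ξ) = ∫ e^{-i y·ξ} f(y) dy`. -/
def fourierHat {n : ℕ} (f : RSpace n → ℂ) (ξ : RSpace n) : ℂ :=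
  ∫ y : RSpace n, Complex.exp (-Complex.I * ((inner ℝ y ξ : ℝ) : ℂ)) * f y

/-- The bilinear pseudo-differential operator
`T_σ(f,g)(x) = (2π)^{-2n} ∫∫ e^{i x·(ξ+η)} σ(x,ξ,η) f̂(ξ) ĝ(η) dξ dη`. -/
def bilinearOp {n : ℕ} (σ : RSpace n × RSpace n × RSpace n → ℂ) (f g : 𝓢(RSpace n, ℂ))
    (x : RSpace n) : ℂ :=
  1 / ((2 * Real.pi : ℝ) : ℂ) ^ (2 * n) *
    ∫ p : RSpace n × RSpace n,
      Complex.exp (Complex.I * ((inner ℝ x (p.1 + p.2) : ℝ) : ℂ)) * σ (x, p.1, p.2) *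
        fourierHat f p.1 * fourierHat g p.2

/-- An operator `T`, defined on pairs of Schwartz functions, is bounded from `L^p × L^q` to `L^r`:
there is a finite `A` with `T(f,g) ∈ L^r` and `‖T(f,g)‖_{L^r} ≤ A ‖f‖_{L^p} ‖g‖_{L^q}` for all
Schwartz functions `f`, `g` (which all belong to every Lebesgue space). -/
def IsBoundedLp {n : ℕ} (T : 𝓢(RSpace n, ℂ) → 𝓢(RSpace n, ℂ) → RSpace n → ℂ)
    (p q r : ℝ≥0∞) : Prop :=
  ∃ A : ℝ≥0, ∀ f g : 𝓢(RSpace n, ℂ),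
    MemLp (T f g) r volume ∧
      eLpNorm (T f g) r volume ≤ (A : ℝ≥0∞) * eLpNorm f p volume * eLpNorm g q volume

end BilinearPDO

end

noncomputable section

namespace BilinearPDO

/-! Pair T_σ(f,g) with a Schwartz function written as φ̂. Up to a constant, the task is to bound ∫
e^{ix·(ξ+η)} σ f̂(ξ) ĝ(η) φ̂(x) by ‖f‖₂ ‖g‖_∞ ‖φ‖₂. Cut σ into pieces on which 1+|ξ|+|η| is
comparable to D = 4^j, and put λ = D^ρ. On such a piece σ = O(D^m), and the derivatives λ⁻¹∂_x,
λ∂_ξ, λ∂_η preserve this bound.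

Localisation. In e^{ix·ξ} f̂(ξ) = ∫ e^{i(x-y)·ξ} f(y) dy, the operator 1 + λ∂_{ξ_k} undoes
multiplication of the integrand by (1 + iλ(x_k - y_k))⁻¹. Integrating by parts in ξ and η, and then
in x, replaces the three transforms by short-time transforms F(x,ξ), G(x,η), H(x,ξ+η) with decaying
windows. Then f and g are seen within 1/λ of x, and φ within λ of ξ+η (`hasDerivAt_exp_mul_stft`,
`triForm_eq_x`, `triFormBounded_zero`).

One scale. Now absolute values suffice. By Plancherel ‖G(x,·)‖₂ ≲ λ^{-n/2} ‖g‖_∞. Since max(|ξ|,|η|)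
is of order D (or D is bounded), λ+|ξ| or λ+|ξ+η| is of order D. Let W(ξ) = ((λ+|ξ|)/D)^{1/4} on |ξ|
≤ 4D. The factor at the large frequency may be multiplied by W at no cost. The other factor occurs
in L¹ of a ball of radius 4D, and Cauchy–Schwarz with W⁻¹ bounds it by D^{n/2} times its W-weighted
L² norm. Thus F and H both carry W (`lintegral_scaleRegion_le`). Integration in x gives D^{n/2}
λ^{-n/2} ‖g‖_∞ E(f̂)^{1/2} E(φ)^{1/2}, where E is an L² energy with multiplier κ_D. The power of D
is exactly D^{-m}, which cancels the size of the amplitude.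

Summation. There is no decay left in j, but Σ_j κ_{4^j}(v) is bounded uniformly in v
(`sum_scaleKernel_le`), because ρ < 1 and W is small at frequencies far below D. Cauchy–Schwarz in j
then sums the pieces. The cutoffs are removed by dominated convergence, and Riesz representation
turns the bound for the form into membership in L². -/

/-! ### Plancherel's identity on L¹ ∩ L². -/

open FourierTransform in
theorem fourierHat_eq_fourier {n : ℕ} (f : RSpace n → ℂ) (ξ : RSpace n) :
    fourierHat f ξ = 𝓕 f ((2 * Real.pi)⁻¹ • ξ) := by
  rw [Real.fourier_eq, fourierHat]
  congr 1 with y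
  rw [Circle.smul_def, Real.fourierChar_apply, smul_eq_mul, inner_smul_right]
  congr 2
  have : (Real.pi : ℂ) ≠ 0 := by exact_mod_cast Real.pi_ne_zero
  push_cast
  field_simp

theorem lintegral_comp_smul_pos {n : ℕ} {c : ℝ} (hc : 0 < c) (F : RSpace n → ℝ≥0∞) :
    ∫⁻ x, F (c • x) = ENNReal.ofReal ((c ^ n)⁻¹) * ∫⁻ x, F x := by
  have h := MeasureTheory.Measure.map_addHaar_smul (volume : Measure (RSpace n)) hc.ne'
  have e := (Homeomorph.smulOfNeZero c hc.ne' : RSpace n ≃ₜ RSpace n).toMeasurableEquiv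
  calc ∫⁻ x, F (c • x) = ∫⁻ x, F x ∂(Measure.map (fun x => c • x) volume) :=
        (lintegral_map_equiv F
          (Homeomorph.smulOfNeZero c hc.ne' : RSpace n ≃ₜ RSpace n).toMeasurableEquiv).symm
    _ = _ := by
        rw [h, lintegral_smul_measure, smul_eq_mul, finrank_euclideanSpace_fin,
          abs_of_pos (by positivity)]

open FourierTransform in
-- Both sides have the same integrals against compactly supported smooth functions: on the left by
-- the duality that defines the transform of a tempered distribution, on the right by the
-- multiplication formula. This makes Plancherel available for the rational windows, which are not
-- Schwartz functions.
theorem fourier_toLp_ae_eq {n : ℕ} {f : RSpace n → ℂ} (h1 : Integrable f) (h2 : MemLp f 2) :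
    (𝓕 (h2.toLp f) : Lp ℂ 2 (volume : Measure (RSpace n))) =ᵐ[volume] 𝓕 f := by
  have hcont : Continuous (𝓕 f) :=
    VectorFourier.fourierIntegral_continuous Real.continuous_fourierChar
      (by exact continuous_inner) h1
  refine ae_eq_of_integral_contDiff_smul_eq
    ((Lp.memLp _).locallyIntegrable (by norm_num)) hcont.locallyIntegrable ?_
  intro g hg hgs
  let gs : 𝓢(RSpace n, ℂ) := HasCompactSupport.toSchwartzMap
    (f := fun x => (g x : ℂ)) (hgs.comp_left (g := fun r : ℝ => (r : ℂ)) (by simp)) (Complex.ofRealCLM.contDiff.comp hg)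
  have hval : ∀ x, gs x = (g x : ℂ) := fun x => rfl
  have key := congrArg (fun T : 𝓢'(RSpace n, ℂ) => T gs)
    (MeasureTheory.Lp.fourier_toTemperedDistribution_eq (h2.toLp f))
  simp only [TemperedDistribution.fourier_apply, Lp.toTemperedDistribution_apply] at key
  have e1 : ∫ x, g x • (𝓕 (h2.toLp f) : Lp ℂ 2 (volume : Measure (RSpace n))) x
      = ∫ x, (𝓕 gs) x • f x := by
    calc _ = ∫ x, gs x • (𝓕 (h2.toLp f) : Lp ℂ 2 (volume : Measure (RSpace n))) x := by
          congr 1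
      _ = _ := key.symm
      _ = _ := by
          refine integral_congr_ae ?_
          filter_upwards [h2.coeFn_toLp] with x hx
          rw [hx]
  rw [e1]
  have := VectorFourier.integral_fourierIntegral_smul_eq_flip (L := innerₗ (RSpace n))
      Real.continuous_fourierChar continuous_inner gs.integrable h1 (μ := volume) (ν := volume)
  simp only [flip_innerₗ] at this
  exact this

open FourierTransform in
theorem lintegral_enorm_sq_fourier {n : ℕ} {f : RSpace n → ℂ} (h1 : Integrable f)
    (h2 : MemLp f 2) : ∫⁻ ξ, ‖𝓕 f ξ‖ₑ ^ 2 = ∫⁻ x, ‖f x‖ₑ ^ 2 := by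
  have h := MeasureTheory.Lp.norm_fourier_eq (h2.toLp f)
  rw [Lp.norm_toLp, Lp.norm_def, eLpNorm_congr_ae (fourier_toLp_ae_eq h1 h2),
    ENNReal.toReal_eq_toReal_iff' (by
      rw [← eLpNorm_congr_ae (fourier_toLp_ae_eq h1 h2)]; exact (Lp.memLp _).2.ne) h2.2.ne] at h
  have key : ∀ u : RSpace n → ℂ, ∫⁻ x, ‖u x‖ₑ ^ 2 = eLpNorm u 2 volume ^ 2 := by
    intro u
    rw [eLpNorm_eq_lintegral_rpow_enorm_toReal (by norm_num) (by norm_num),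
      ← ENNReal.rpow_natCast, ← ENNReal.rpow_mul]
    norm_num
  rw [key, key, h]

/-- Plancherel's identity in the normalisation of `fourierHat`. -/
theorem lintegral_enorm_sq_fourierHat {n : ℕ} {f : RSpace n → ℂ} (h1 : Integrable f)
    (h2 : MemLp f 2) : ∫⁻ ξ, ‖fourierHat f ξ‖ₑ ^ 2 =
      ENNReal.ofReal ((2 * Real.pi) ^ n) * ∫⁻ x, ‖f x‖ₑ ^ 2 := by
  simp_rw [fourierHat_eq_fourier]
  rw [lintegral_comp_smul_pos (c := (2 * Real.pi)⁻¹) (by positivity)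
    (fun ξ => ‖FourierTransform.fourier f ξ‖ₑ ^ 2), lintegral_enorm_sq_fourier h1 h2,
    ← inv_pow, inv_inv]

/-! ### Rational windows and their decay. -/

/-- The product window `∏ₖ (1 + i tₖ)^{-pₖ}`. -/
def window {n : ℕ} (p : Fin n → ℕ) (t : RSpace n) : ℂ :=
  ∏ k, ((1 + Complex.I * (t k : ℂ))⁻¹) ^ p k

/-- The integrable majorant `∏ₖ (1 + tₖ²)⁻¹` of the windows. -/
def majorant {n : ℕ} (t : RSpace n) : ℝ := ∏ k, (1 + t k ^ 2)⁻¹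

theorem norm_sq_one_add_I_mul (t : ℝ) : ‖(1 + Complex.I * (t : ℂ))‖ ^ 2 = 1 + t ^ 2 := by
  rw [← Complex.normSq_eq_norm_sq, Complex.normSq_apply]
  simp
  ring

theorem one_add_I_mul_ne_zero (t : ℝ) : (1 + Complex.I * (t : ℂ)) ≠ 0 := by
  intro h
  have := norm_sq_one_add_I_mul t
  rw [h] at this
  simp at this
  nlinarith [sq_nonneg t]

theorem norm_inv_one_add_I_mul_sq (t : ℝ) : ‖(1 + Complex.I * (t : ℂ))⁻¹‖ ^ 2 = (1 + t ^ 2)⁻¹ := by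
  rw [norm_inv, inv_pow, norm_sq_one_add_I_mul]

theorem norm_inv_one_add_I_mul_le (t : ℝ) : ‖(1 + Complex.I * (t : ℂ))⁻¹‖ ≤ 1 := by
  have h := norm_inv_one_add_I_mul_sq t
  have : (1 + t ^ 2)⁻¹ ≤ 1 := inv_le_one_of_one_le₀ (by nlinarith [sq_nonneg t])
  nlinarith [norm_nonneg (1 + Complex.I * (t : ℂ))⁻¹]

theorem continuous_window {n : ℕ} (p : Fin n → ℕ) : Continuous (window p) := by
  unfold window
  refine continuous_finsetProd _ fun k _ => Continuous.pow (Continuous.inv₀ (by fun_prop) ?_) _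
  exact fun t => one_add_I_mul_ne_zero _

theorem norm_window_le_one {n : ℕ} (p : Fin n → ℕ) (t : RSpace n) : ‖window p t‖ ≤ 1 := by
  unfold window
  rw [norm_prod]
  refine Finset.prod_le_one (fun _ _ => norm_nonneg _) fun k _ => ?_
  rw [norm_pow]
  exact pow_le_one₀ (norm_nonneg _) (norm_inv_one_add_I_mul_le _)

theorem window_zero {n : ℕ} (t : RSpace n) : window (0 : Fin n → ℕ) t = 1 := by
  simp [window]

theorem window_add_single {n : ℕ} (p : Fin n → ℕ) (k : Fin n) (t : RSpace n) :
    window (p + Pi.single k 1) t = window p t * (1 + Complex.I * (t k : ℂ))⁻¹ := by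
  simp only [window, Pi.add_apply, pow_add, Finset.prod_mul_distrib]
  congr 1
  rw [Finset.prod_eq_single k]
  · simp
  · intro j _ hj
    simp [Pi.single_eq_of_ne hj]
  · simp

theorem window_eq_mul {n : ℕ} (p : Fin n → ℕ) (k : Fin n) (t : RSpace n) :
    window p t = (1 + Complex.I * (t k : ℂ)) * window (p + Pi.single k 1) t := by
  rw [window_add_single]
  field_simp [one_add_I_mul_ne_zero (t k)]

theorem norm_window_le_majorant {n : ℕ} {p : Fin n → ℕ} (hp : ∀ k, 2 ≤ p k) (t : RSpace n) :
    ‖window p t‖ ≤ majorant t := by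
  unfold window majorant
  rw [norm_prod]
  refine Finset.prod_le_prod (fun _ _ => norm_nonneg _) fun k _ => ?_
  rw [norm_pow, ← norm_inv_one_add_I_mul_sq]
  exact pow_le_pow_of_le_one (norm_nonneg _) (norm_inv_one_add_I_mul_le _) (hp k)

theorem majorant_pos {n : ℕ} (t : RSpace n) : 0 < majorant t :=
  Finset.prod_pos fun k _ => by positivity

theorem one_add_sum_le_prod_one_add {ι : Type*} (s : Finset ι) {a : ι → ℝ}
    (ha : ∀ i ∈ s, 0 ≤ a i) : 1 + ∑ i ∈ s, a i ≤ ∏ i ∈ s, (1 + a i) := by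
  classical
  induction s using Finset.induction_on with
  | empty => simp
  | insert i s hi ih =>
    have h1 := ih fun j hj => ha j (Finset.mem_insert_of_mem hj)
    have h2 := ha i (Finset.mem_insert_self i s)
    have h3 : 0 ≤ ∑ j ∈ s, a j :=
      Finset.sum_nonneg fun j hj => ha j (Finset.mem_insert_of_mem hj)
    rw [Finset.sum_insert hi, Finset.prod_insert hi]
    nlinarith

theorem one_add_norm_sq_mul_majorant_le {n : ℕ} (t : RSpace n) :
    (1 + ‖t‖ ^ 2) * majorant t ≤ 1 := by
  have h : 1 + ‖t‖ ^ 2 ≤ ∏ k, (1 + t k ^ 2) := by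
    rw [EuclideanSpace.norm_sq_eq]
    simp only [Real.norm_eq_abs, sq_abs]
    exact one_add_sum_le_prod_one_add _ fun k _ => sq_nonneg _
  unfold majorant
  rw [Finset.prod_inv_distrib]
  exact mul_inv_le_one_of_le₀ h (by positivity)

/-- One of the two copies of `majorant` absorbs 1+|t|²; the other is left for integration. -/
theorem norm_window_sq_mul_le {n : ℕ} {p : Fin n → ℕ} (hp : ∀ k, 2 ≤ p k) (t : RSpace n) :
    ‖window p t‖ ^ 2 * (1 + ‖t‖ ^ 2) ≤ majorant t := by
  have h1 := norm_window_le_majorant hp t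
  have h2 := one_add_norm_sq_mul_majorant_le t
  have h3 := majorant_pos t
  calc ‖window p t‖ ^ 2 * (1 + ‖t‖ ^ 2) ≤ majorant t ^ 2 * (1 + ‖t‖ ^ 2) := by gcongr
    _ = majorant t * ((1 + ‖t‖ ^ 2) * majorant t) := by ring
    _ ≤ majorant t * 1 := by gcongr
    _ = _ := mul_one _

theorem integrable_majorant {n : ℕ} : Integrable (majorant (n := n)) := by
  have h : Integrable (fun y : Fin n → ℝ => ∏ k, (1 + y k ^ 2)⁻¹) :=
    Integrable.fintype_prod (f := fun _ (x : ℝ) => (1 + x ^ 2)⁻¹) fun _ => integrable_inv_one_add_sq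
  exact (EuclideanSpace.volume_preserving_symm_measurableEquiv_toLp (Fin n)).integrable_comp_of_integrable h

/-- Differentiation only raises one exponent, so the family of windows is closed under it. This is
the reason for choosing powers of (1+it)⁻¹. -/
theorem hasDerivAt_window {n : ℕ} (p : Fin n → ℕ) (k : Fin n) (t : RSpace n) :
    HasDerivAt (fun s : ℝ => window p (t + s • stdVec k))
      (-Complex.I * p k * window (p + Pi.single k 1) t) 0 := by
  have hsplit : ∀ s : ℝ, window p (t + s • stdVec k) =
      ((1 + Complex.I * ((t k + s : ℝ) : ℂ))⁻¹) ^ p k *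
        ∏ j ∈ Finset.univ.erase k, ((1 + Complex.I * (t j : ℂ))⁻¹) ^ p j := by
    intro s
    unfold window
    rw [← Finset.mul_prod_erase _ _ (Finset.mem_univ k)]
    congr 1
    · simp [stdVec]
    · refine Finset.prod_congr rfl fun j hj => ?_
      have : j ≠ k := Finset.ne_of_mem_erase hj
      simp [stdVec, this]
  simp_rw [hsplit]
  have h0 : HasDerivAt (fun s : ℝ => 1 + Complex.I * ((t k + s : ℝ) : ℂ)) Complex.I 0 := by
    have : HasDerivAt (fun s : ℝ => ((t k + s : ℝ) : ℂ)) 1 0 := by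
      simpa using ((hasDerivAt_id (0 : ℝ)).const_add (t k)).ofReal_comp
    simpa using (this.const_mul Complex.I).const_add 1
  have hne := one_add_I_mul_ne_zero (t k)
  have h1 := ((h0.fun_inv (by simpa using hne)).fun_pow (p k)).mul_const
    (∏ j ∈ Finset.univ.erase k, ((1 + Complex.I * (t j : ℂ))⁻¹) ^ p j)
  refine h1.congr_deriv ?_
  rw [window_add_single]
  unfold window
  rw [← Finset.mul_prod_erase _ _ (Finset.mem_univ k)]
  simp only [add_zero]
  -- The power rule has the truncated exponent `p k - 1`, so exponent zero is treated apart.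
  rcases Nat.eq_zero_or_pos (p k) with h | h
  · simp [h]
  · obtain ⟨m, hm⟩ := Nat.exists_eq_add_of_lt h
    rw [hm]
    simp only [zero_add, Nat.add_sub_cancel, div_eq_mul_inv, ← inv_pow]
    ring

/-! ### Fourier inversion in the present normalisation. -/

/-- The Schwartz function `fourierHat f`. -/
def schwartzHat {n : ℕ} (f : 𝓢(RSpace n, ℂ)) : 𝓢(RSpace n, ℂ) :=
  SchwartzMap.compCLMOfContinuousLinearEquiv ℂ
    (ContinuousLinearEquiv.smulLeft (R₁ := ℝ) (M₁ := RSpace n)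
      (Units.mk0 ((2 * Real.pi)⁻¹) (by positivity))) (FourierTransform.fourier f)

theorem coe_schwartzHat {n : ℕ} (f : 𝓢(RSpace n, ℂ)) (ξ : RSpace n) :
    schwartzHat f ξ = fourierHat f ξ := by
  rw [fourierHat_eq_fourier]
  rfl

theorem fourierHat_inversion {n : ℕ} (f : 𝓢(RSpace n, ℂ)) (y : RSpace n) :
    f y = ((2 * Real.pi : ℝ) : ℂ)⁻¹ ^ n *
      ∫ v, Complex.exp (Complex.I * ((inner ℝ y v : ℝ) : ℂ)) * fourierHat f v := by
  have h : f y = FourierTransform.fourierInv (FourierTransform.fourier f) y := by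
    rw [FourierTransform.fourierInv_fourier_eq]
  have h2 := Measure.integral_comp_smul (volume : Measure (RSpace n))
    (fun v => Complex.exp (2 * Real.pi * Complex.I * ((inner ℝ y v : ℝ) : ℂ)) *
      FourierTransform.fourier f v) ((2 * Real.pi)⁻¹)
  have h3 : f y = ∫ v, Complex.exp (2 * Real.pi * Complex.I * ((inner ℝ y v : ℝ) : ℂ)) *
      FourierTransform.fourier f v := by
    rw [h, SchwartzMap.fourierInv_coe, Real.fourierInv_eq]
    congr 1 with v
    rw [Circle.smul_def, Real.fourierChar_apply, smul_eq_mul, real_inner_comm]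
    congr 2
    push_cast
    ring
  have hpi : (Real.pi : ℂ) ≠ 0 := by exact_mod_cast Real.pi_ne_zero
  have h4 : ∫ v, Complex.exp (Complex.I * ((inner ℝ y v : ℝ) : ℂ)) * fourierHat f v =
      ∫ v : RSpace n, Complex.exp (2 * Real.pi * Complex.I *
        ((inner ℝ y ((2 * Real.pi)⁻¹ • v) : ℝ) : ℂ)) *
        FourierTransform.fourier f ((2 * Real.pi)⁻¹ • v) := by
    congr 1 with v
    rw [fourierHat_eq_fourier, inner_smul_right, SchwartzMap.fourier_coe]
    congr 2
    push_cast
    field_simp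
  rw [h4, h2, ← h3, finrank_euclideanSpace_fin, abs_of_pos (by positivity)]
  rw [Complex.real_smul, ← mul_assoc, inv_pow, inv_pow, inv_inv]
  push_cast
  rw [inv_mul_cancel₀ (pow_ne_zero _ (mul_ne_zero two_ne_zero hpi)), one_mul]

/-! ### Short-time Fourier transforms. -/

variable {n : ℕ}

/-- The short-time Fourier transform of `f` with respect to the dilated window
`t ↦ window p (μ t)`. -/
def stft (p : Fin n → ℕ) (μ : ℝ) (f : RSpace n → ℂ) (x ξ : RSpace n) : ℂ :=
  fourierHat (fun y => window p (μ • (x - y)) * f y) ξ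

theorem norm_exp_I_mul_ofReal' (t : ℝ) : ‖Complex.exp (Complex.I * (t : ℂ))‖ = 1 := by
  rw [mul_comm]; exact Complex.norm_exp_ofReal_mul_I t

theorem norm_exp_neg_I_mul_ofReal (t : ℝ) : ‖Complex.exp (-Complex.I * (t : ℂ))‖ = 1 := by
  have := norm_exp_I_mul_ofReal' (-t)
  simpa using this

theorem continuous_window_comp (p : Fin n → ℕ) (μ : ℝ) (x : RSpace n) :
    Continuous fun y : RSpace n => window p (μ • (x - y)) :=
  (continuous_window p).comp (by fun_prop)

theorem integrable_window_mul (p : Fin n → ℕ) (μ : ℝ) {f : RSpace n → ℂ} (hf : Integrable f)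
    (x : RSpace n) : Integrable fun y => window p (μ • (x - y)) * f y :=
  hf.bdd_mul (c := 1) (continuous_window_comp p μ x).aestronglyMeasurable
    (Filter.Eventually.of_forall fun _ => norm_window_le_one _ _)

theorem memLp_window_mul (p : Fin n → ℕ) (μ : ℝ) {f : RSpace n → ℂ} (hf : MemLp f 2)
    (x : RSpace n) : MemLp (fun y => window p (μ • (x - y)) * f y) 2 := by
  refine hf.of_le ((continuous_window_comp p μ x).aestronglyMeasurable.mul hf.1)
    (Filter.Eventually.of_forall fun y => ?_)
  rw [norm_mul]
  exact mul_le_of_le_one_left (norm_nonneg _) (norm_window_le_one _ _)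

theorem continuous_stft (p : Fin n → ℕ) (μ : ℝ) (f : 𝓢(RSpace n, ℂ)) :
    Continuous fun z : RSpace n × RSpace n => stft p μ f z.1 z.2 := by
  unfold stft fourierHat
  refine continuous_of_dominated (bound := fun y => ‖f y‖) (fun z => ?_) (fun z => ?_)
    f.integrable.norm ?_
  · exact Continuous.aestronglyMeasurable
      (by have := continuous_window_comp p μ z.1; have := f.continuous; fun_prop)
  · refine Filter.Eventually.of_forall fun y => ?_
    rw [norm_mul, norm_mul, norm_exp_neg_I_mul_ofReal, one_mul]
    exact mul_le_of_le_one_left (norm_nonneg _) (norm_window_le_one _ _)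
  · refine Filter.Eventually.of_forall fun y => ?_
    have : Continuous fun z : RSpace n × RSpace n => window p (μ • (z.1 - y)) :=
      (continuous_window p).comp (by fun_prop)
    fun_prop

theorem stft_zero (μ : ℝ) (f : RSpace n → ℂ) (x ξ : RSpace n) :
    stft 0 μ f x ξ = fourierHat f ξ := by
  simp [stft, window_zero]

theorem exp_mul_stft (p : Fin n → ℕ) (μ : ℝ) (f : RSpace n → ℂ) (x ξ : RSpace n) :
    Complex.exp (Complex.I * ((inner ℝ x ξ : ℝ) : ℂ)) * stft p μ f x ξ =
      ∫ y, Complex.exp (Complex.I * ((inner ℝ (x - y) ξ : ℝ) : ℂ)) *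
        (window p (μ • (x - y)) * f y) := by
  unfold stft fourierHat
  rw [← integral_const_mul]
  congr 1 with y
  rw [← mul_assoc, ← Complex.exp_add, inner_sub_left]
  congr 2
  push_cast
  ring

/-- With t = μ(x-y), the derivative along μe_k multiplies the integrand by it_k, and it_k w_{p+e_k}
= w_p - w_{p+e_k}. So the transform with the weaker window is (1 + μ∂_{ξ_k}) of the one with the
stronger window, phase included. -/
theorem hasDerivAt_exp_mul_stft (p : Fin n → ℕ) (k : Fin n) (μ : ℝ) (f : 𝓢(RSpace n, ℂ))
    (x ξ : RSpace n) :
    HasDerivAt (fun s : ℝ => Complex.exp (Complex.I *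
        ((inner ℝ x (ξ + s • (μ • stdVec k)) : ℝ) : ℂ)) *
        stft (p + Pi.single k 1) μ f x (ξ + s • (μ • stdVec k)))
      (Complex.exp (Complex.I * ((inner ℝ x ξ : ℝ) : ℂ)) * stft p μ f x ξ -
        Complex.exp (Complex.I * ((inner ℝ x ξ : ℝ) : ℂ)) *
          stft (p + Pi.single k 1) μ f x ξ) 0 := by
  simp_rw [exp_mul_stft]
  set q := p + Pi.single k 1 with hq
  have hint : ∀ (r : Fin n → ℕ) (ζ : RSpace n), Integrable fun y =>
      Complex.exp (Complex.I * ((inner ℝ (x - y) ζ : ℝ) : ℂ)) *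
        (window r (μ • (x - y)) * f y) := fun r ζ =>
    (integrable_window_mul r μ f.integrable x).bdd_mul (c := 1)
      (Continuous.aestronglyMeasurable (by fun_prop))
      (Filter.Eventually.of_forall fun y => (norm_exp_I_mul_ofReal' _).le)
  rw [← integral_sub (hint p ξ) (hint q ξ)]
  have key := hasDerivAt_integral_of_dominated_loc_of_deriv_le (μ := (volume : Measure (RSpace n)))
    (F := fun (s : ℝ) y => Complex.exp (Complex.I *
        ((inner ℝ (x - y) (ξ + s • (μ • stdVec k)) : ℝ) : ℂ)) * (window q (μ • (x - y)) * f y))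
    (F' := fun (s : ℝ) y => Complex.exp (Complex.I *
        ((inner ℝ (x - y) (ξ + s • (μ • stdVec k)) : ℝ) : ℂ)) *
        (Complex.I * ((μ • (x - y)) k : ℂ)) * (window q (μ • (x - y)) * f y))
    (x₀ := 0) (s := Set.univ) (bound := fun y => ‖f y‖) Filter.univ_mem
    (Filter.Eventually.of_forall fun s => (hint q _).1) (hint q _) ?_ ?_ f.integrable.norm ?_
  · refine key.2.congr_deriv ?_
    congr 1 with y
    rw [window_eq_mul p k]
    simp only [zero_smul, add_zero]
    ring
  · refine Continuous.aestronglyMeasurable ?_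
    have := continuous_window_comp q μ x
    have := f.continuous
    fun_prop
  · refine Filter.Eventually.of_forall fun y s _ => ?_
    rw [norm_mul, norm_mul, norm_exp_I_mul_ofReal', one_mul, ← norm_mul, ← mul_assoc, norm_mul]
    refine mul_le_of_le_one_left (norm_nonneg _) ?_
    -- The extra window factor (1+it_k)⁻¹ absorbs the t_k produced by the exponential, which gives a
    -- majorant independent of s.
    rw [hq, window_add_single, mul_left_comm, norm_mul]
    refine mul_le_one₀ (norm_window_le_one _ _) (norm_nonneg _) ?_
    set t := (μ • (x - y)) k
    have h1 := norm_inv_one_add_I_mul_sq t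
    rw [norm_mul, norm_mul, Complex.norm_I, one_mul, Complex.norm_real, Real.norm_eq_abs]
    refine abs_le_one_iff_mul_self_le_one.2 ?_ |> (le_abs_self _).trans
    calc |t| * ‖(1 + Complex.I * (t : ℂ))⁻¹‖ * (|t| * ‖(1 + Complex.I * (t : ℂ))⁻¹‖)
        = |t| ^ 2 * ‖(1 + Complex.I * (t : ℂ))⁻¹‖ ^ 2 := by ring
      _ ≤ 1 := by
        rw [h1, sq_abs, ← div_eq_mul_inv, div_le_one (by positivity)]
        linarith
  · refine Filter.Eventually.of_forall fun y s _ => ?_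
    refine HasDerivAt.mul_const ?_ _
    have h2 : HasDerivAt (fun s : ℝ => inner ℝ (x - y) (ξ + s • (μ • stdVec k)))
        ((μ • (x - y)) k) s := by
      have e : ∀ s : ℝ, inner ℝ (x - y) (ξ + s • (μ • stdVec k)) =
          inner ℝ (x - y) ξ + s * (μ • (x - y)) k := by
        intro s
        simp [inner_add_right, inner_smul_right, stdVec, EuclideanSpace.inner_single_right]
      simp_rw [e]
      simpa using ((hasDerivAt_id s).mul_const ((μ • (x - y)) k)).const_add (inner ℝ (x - y) ξ)
    exact (h2.ofReal_comp.const_mul Complex.I).cexp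

/-- A step μ⁻¹e_k in x moves the argument of the window by exactly e_k, so no power of μ appears. -/
theorem hasDerivAt_stft (p : Fin n → ℕ) (k : Fin n) {μ : ℝ} (hμ : μ ≠ 0) (f : 𝓢(RSpace n, ℂ))
    (x ξ : RSpace n) :
    HasDerivAt (fun s : ℝ => stft p μ f (x + s • (μ⁻¹ • stdVec k)) ξ)
      (-Complex.I * p k * stft (p + Pi.single k 1) μ f x ξ) 0 := by
  have harg : ∀ (s : ℝ) (y : RSpace n), μ • (x + s • (μ⁻¹ • stdVec k) - y) =
      μ • (x - y) + s • stdVec k := by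
    intro s y
    rw [add_sub_right_comm, smul_add, smul_comm μ s, smul_inv_smul₀ hμ]
  have hint : ∀ (r : Fin n → ℕ) (z : RSpace n), Integrable fun y =>
      Complex.exp (-Complex.I * ((inner ℝ y ξ : ℝ) : ℂ)) *
        (window r (μ • (z - y)) * f y) := fun r z =>
    (integrable_window_mul r μ f.integrable z).bdd_mul (c := 1)
      (Continuous.aestronglyMeasurable (by fun_prop))
      (Filter.Eventually.of_forall fun y => (norm_exp_neg_I_mul_ofReal _).le)
  have key := hasDerivAt_integral_of_dominated_loc_of_deriv_le (μ := (volume : Measure (RSpace n)))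
    (F := fun (s : ℝ) y => Complex.exp (-Complex.I * ((inner ℝ y ξ : ℝ) : ℂ)) *
        (window p (μ • (x + s • (μ⁻¹ • stdVec k) - y)) * f y))
    (F' := fun (s : ℝ) y => Complex.exp (-Complex.I * ((inner ℝ y ξ : ℝ) : ℂ)) *
        ((-Complex.I * p k * window (p + Pi.single k 1) (μ • (x + s • (μ⁻¹ • stdVec k) - y))) *
          f y))
    (x₀ := 0) (s := Set.univ) (bound := fun y => p k * ‖f y‖) Filter.univ_mem
    (Filter.Eventually.of_forall fun s => (hint p _).1) (hint p _) ?_ ?_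
    (f.integrable.norm.const_mul _) ?_
  · refine key.2.congr_deriv ?_
    unfold stft fourierHat
    rw [← integral_const_mul]
    congr 1 with y
    simp only [zero_smul, add_zero]
    ring
  · refine Continuous.aestronglyMeasurable ?_
    have := continuous_window_comp (p + Pi.single k 1) μ (x + (0 : ℝ) • (μ⁻¹ • stdVec k))
    have := f.continuous
    fun_prop
  · refine Filter.Eventually.of_forall fun y s _ => ?_
    rw [norm_mul, norm_mul, norm_exp_neg_I_mul_ofReal, one_mul, norm_mul, norm_mul, norm_neg,
      Complex.norm_I, one_mul, Complex.norm_natCast]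
    refine mul_le_mul_of_nonneg_right ?_ (norm_nonneg _)
    exact mul_le_of_le_one_right (Nat.cast_nonneg _) (norm_window_le_one _ _)
  · refine Filter.Eventually.of_forall fun y s _ => ?_
    refine HasDerivAt.const_mul _ (HasDerivAt.mul_const ?_ _)
    simp_rw [harg]
    have h := hasDerivAt_window p k (μ • (x - y) + s • stdVec k)
    have h2 : HasDerivAt (fun s' : ℝ => s' - s) 1 s := by simpa using (hasDerivAt_id s).sub_const s
    have h3 := HasDerivAt.scomp s (g₁ := fun s' : ℝ =>
      window p (μ • (x - y) + s • stdVec k + s' • stdVec k)) (h := fun s' : ℝ => s' - s)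
      (by simpa using h) h2
    simp only [one_smul] at h3
    refine (h3.congr_of_eventuallyEq (Filter.Eventually.of_forall fun s' => ?_)).congr_deriv
      (by simp)
    simp only [Function.comp]
    rw [add_assoc, ← add_smul]
    simp

/-- The integral of `majorant`. -/
def majorantMass (n : ℕ) : ℝ≥0∞ := ∫⁻ t : RSpace n, ENNReal.ofReal (majorant t)

theorem majorantMass_ne_top : majorantMass n ≠ ⊤ := by
  rw [majorantMass, ← ofReal_integral_eq_lintegral_ofReal integrable_majorant
    (Filter.Eventually.of_forall fun t => (majorant_pos t).le)]
  exact ENNReal.ofReal_ne_top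

theorem lintegral_majorant_smul {μ : ℝ} (hμ : 0 < μ) :
    ∫⁻ t : RSpace n, ENNReal.ofReal (majorant (μ • t)) =
      ENNReal.ofReal ((μ ^ n)⁻¹) * majorantMass n :=
  lintegral_comp_smul_pos hμ fun t => ENNReal.ofReal (majorant t)

theorem enorm_sq_eq_ofReal (z : ℂ) : ‖z‖ₑ ^ 2 = ENNReal.ofReal (‖z‖ ^ 2) := by
  rw [ENNReal.ofReal_pow (norm_nonneg _), ofReal_norm]

theorem two_le_add_single {p : Fin n → ℕ} (hp : ∀ k, 2 ≤ p k) (k j : Fin n) :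
    2 ≤ (p + Pi.single k 1 : Fin n → ℕ) j :=
  (hp j).trans (by simp)

theorem enorm_window_sq_mul_le {p : Fin n → ℕ} (hp : ∀ k, 2 ≤ p k) (t : RSpace n) :
    ‖window p t‖ₑ ^ 2 * ENNReal.ofReal (1 + ‖t‖ ^ 2) ≤ ENNReal.ofReal (majorant t) := by
  rw [enorm_sq_eq_ofReal, ← ENNReal.ofReal_mul (by positivity)]
  exact ENNReal.ofReal_le_ofReal (norm_window_sq_mul_le hp t)

theorem enorm_window_sq_le {p : Fin n → ℕ} (hp : ∀ k, 2 ≤ p k) (t : RSpace n) :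
    ‖window p t‖ₑ ^ 2 ≤ ENNReal.ofReal (majorant t) := by
  refine le_trans ?_ (enorm_window_sq_mul_le hp t)
  refine le_mul_of_one_le_right zero_le ?_
  rw [ENNReal.one_le_ofReal]
  nlinarith [sq_nonneg ‖t‖]

theorem lintegral_enorm_window_sq_mul_le {p : Fin n → ℕ} (hp : ∀ k, 2 ≤ p k) {μ : ℝ}
    (hμ : 0 < μ) :
    ∫⁻ t : RSpace n, ‖window p (μ • t)‖ₑ ^ 2 * ENNReal.ofReal (1 + (μ * ‖t‖) ^ 2) ≤
      ENNReal.ofReal ((μ ^ n)⁻¹) * majorantMass n := by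
  rw [← lintegral_majorant_smul hμ]
  refine lintegral_mono fun t => ?_
  have := enorm_window_sq_mul_le hp (μ • t)
  rwa [norm_smul, Real.norm_of_nonneg hμ.le] at this

theorem lintegral_enorm_window_sq_le {p : Fin n → ℕ} (hp : ∀ k, 2 ≤ p k) {μ : ℝ}
    (hμ : 0 < μ) :
    ∫⁻ t : RSpace n, ‖window p (μ • t)‖ₑ ^ 2 ≤
      ENNReal.ofReal ((μ ^ n)⁻¹) * majorantMass n := by
  rw [← lintegral_majorant_smul hμ]
  exact lintegral_mono fun t => enorm_window_sq_le hp _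

theorem lintegral_enorm_sq_stft (p : Fin n → ℕ) (μ : ℝ) (f : 𝓢(RSpace n, ℂ)) (x : RSpace n) :
    ∫⁻ ξ, ‖stft p μ f x ξ‖ₑ ^ 2 = ENNReal.ofReal ((2 * Real.pi) ^ n) *
      ∫⁻ y, ‖window p (μ • (x - y))‖ₑ ^ 2 * ‖f y‖ₑ ^ 2 := by
  have := lintegral_enorm_sq_fourierHat (integrable_window_mul p μ f.integrable x)
    (memLp_window_mul p μ (f.memLp 2) x)
  simp_rw [enorm_mul, mul_pow (‖window _ _‖ₑ)] at this
  exact this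

/-- Plancherel in ξ at fixed x leaves |f|² against the squared window, whose mass is of order
μ^{-n}. Applied to g, this is where L^∞ enters. -/
theorem lintegral_enorm_sq_stft_le {p : Fin n → ℕ} (hp : ∀ k, 2 ≤ p k) {μ : ℝ} (hμ : 0 < μ)
    (f : 𝓢(RSpace n, ℂ)) (x : RSpace n) :
    ∫⁻ ξ, ‖stft p μ f x ξ‖ₑ ^ 2 ≤ ENNReal.ofReal ((2 * Real.pi) ^ n) *
      (ENNReal.ofReal ((μ ^ n)⁻¹) * majorantMass n * eLpNorm f ⊤ volume ^ 2) := by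
  rw [lintegral_enorm_sq_stft]
  gcongr
  calc ∫⁻ y, ‖window p (μ • (x - y))‖ₑ ^ 2 * ‖f y‖ₑ ^ 2
      ≤ ∫⁻ y, ‖window p (μ • (x - y))‖ₑ ^ 2 * eLpNorm f ⊤ volume ^ 2 := by
        refine lintegral_mono_ae ?_
        filter_upwards [ae_le_eLpNormEssSup (f := f) (μ := volume)] with y hy
        rw [eLpNorm_exponent_top]
        gcongr
    _ = (∫⁻ y, ‖window p (μ • (x - y))‖ₑ ^ 2) * eLpNorm f ⊤ volume ^ 2 := by
        rw [lintegral_mul_const]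
        exact (continuous_window_comp p μ x).measurable.enorm.pow_const 2
    _ = (∫⁻ y : RSpace n, ‖window p (μ • y)‖ₑ ^ 2) * eLpNorm f ⊤ volume ^ 2 := by
        rw [lintegral_sub_left_eq_self (fun y : RSpace n => ‖window p (μ • y)‖ₑ ^ 2) x]
    _ ≤ _ := by
        gcongr
        exact lintegral_enorm_window_sq_le hp hμ

/-! ### Plancherel in the position variable. -/

/-- The Fourier transform of the dilated window. -/
def windowHat (p : Fin n → ℕ) (μ : ℝ) (u : RSpace n) : ℂ :=
  fourierHat (fun t => window p (μ • t)) u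

theorem continuous_window_smul (p : Fin n → ℕ) (μ : ℝ) :
    Continuous fun t : RSpace n => window p (μ • t) :=
  (continuous_window p).comp (by fun_prop)

theorem integrable_window_smul {p : Fin n → ℕ} (hp : ∀ k, 2 ≤ p k) {μ : ℝ} (hμ : 0 < μ) :
    Integrable fun t : RSpace n => window p (μ • t) :=
  ((integrable_comp_smul_iff volume majorant hμ.ne').2 integrable_majorant).mono'
    (continuous_window_smul p μ).aestronglyMeasurable
    (Filter.Eventually.of_forall fun _ => norm_window_le_majorant hp _)

theorem memLp_window_smul {p : Fin n → ℕ} (hp : ∀ k, 2 ≤ p k) {μ : ℝ} (hμ : 0 < μ) :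
    MemLp (fun t : RSpace n => window p (μ • t)) 2 := by
  rw [memLp_two_iff_integrable_sq_norm (continuous_window_smul p μ).aestronglyMeasurable]
  refine (integrable_window_smul hp hμ).norm.mono'
    ((continuous_window_smul p μ).norm.pow 2).aestronglyMeasurable
    (Filter.Eventually.of_forall fun t => ?_)
  have h1 := norm_window_le_one p (μ • t)
  have h2 := norm_nonneg (window p (μ • t))
  rw [Real.norm_of_nonneg (by positivity)]
  nlinarith

theorem continuous_windowHat {p : Fin n → ℕ} (hp : ∀ k, 2 ≤ p k) {μ : ℝ} (hμ : 0 < μ) :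
    Continuous (windowHat p μ) := by
  unfold windowHat
  simp_rw [fourierHat_eq_fourier]
  have : Continuous (FourierTransform.fourier fun t : RSpace n => window p (μ • t)) :=
    VectorFourier.fourierIntegral_continuous Real.continuous_fourierChar
      (by exact continuous_inner) (integrable_window_smul hp hμ)
  exact this.comp (by fun_prop)

theorem norm_fourierHat_le (f : RSpace n → ℂ) (ξ : RSpace n) :
    ‖fourierHat f ξ‖ ≤ ∫ y, ‖f y‖ := by
  refine (norm_integral_le_integral_norm _).trans_eq ?_
  congr 1 with y
  rw [norm_mul, norm_exp_neg_I_mul_ofReal, one_mul]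

/-- Integration by parts: multiplying by u_k differentiates the dilated window, which raises an
exponent and produces μ. -/
theorem coord_mul_windowHat {p : Fin n → ℕ} (hp : ∀ k, 2 ≤ p k) {μ : ℝ} (hμ : 0 < μ)
    (k : Fin n) (u : RSpace n) :
    (u k : ℂ) * windowHat p μ u = -(μ * p k) * windowHat (p + Pi.single k 1) μ u := by
  have hp' := two_le_add_single hp k
  have hbdd : ∀ {w : RSpace n → ℂ}, Integrable w → Integrable fun t =>
      Complex.exp (-Complex.I * ((inner ℝ t u : ℝ) : ℂ)) * w t := fun hw =>
    hw.bdd_mul (c := 1) (Continuous.aestronglyMeasurable (by fun_prop))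
      (Filter.Eventually.of_forall fun y => (norm_exp_neg_I_mul_ofReal _).le)
  have h1 := hbdd (integrable_window_smul hp hμ)
  have h2 := hbdd (integrable_window_smul hp' hμ)
  have key := integral_bilinear_hasLineDerivAt_right_eq_neg_left_of_integrable
    (μ := (volume : Measure (RSpace n))) (B := ContinuousLinearMap.mul ℝ ℂ) (v := stdVec k)
    (f := fun t => Complex.exp (-Complex.I * ((inner ℝ t u : ℝ) : ℂ)))
    (f' := fun t => -Complex.I * u k * Complex.exp (-Complex.I * ((inner ℝ t u : ℝ) : ℂ)))
    (g := fun t => window p (μ • t))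
    (g' := fun t => μ * (-Complex.I * p k * window (p + Pi.single k 1) (μ • t)))
    (by simpa [mul_assoc] using h1.const_mul (-Complex.I * u k))
    (by
      have := h2.const_mul (μ * (-Complex.I * p k))
      refine this.congr (Filter.Eventually.of_forall fun t => ?_)
      simp only [ContinuousLinearMap.mul_apply']
      ring)
    (by simpa using h1) ?_ ?_
  · simp only [ContinuousLinearMap.mul_apply'] at key
    have e1 : ∫ t, Complex.exp (-Complex.I * ((inner ℝ t u : ℝ) : ℂ)) *
        (μ * (-Complex.I * p k * window (p + Pi.single k 1) (μ • t))) =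
        (μ * (-Complex.I * p k)) * windowHat (p + Pi.single k 1) μ u := by
      rw [windowHat, fourierHat, ← integral_const_mul]
      congr 1 with t
      ring
    have e2 : ∫ t, -Complex.I * u k * Complex.exp (-Complex.I * ((inner ℝ t u : ℝ) : ℂ)) *
        window p (μ • t) = (-Complex.I * u k) * windowHat p μ u := by
      rw [windowHat, fourierHat, ← integral_const_mul]
      congr 1 with t
      ring
    rw [e1, e2] at key
    have hI := Complex.I_ne_zero
    refine mul_left_cancel₀ hI ?_
    linear_combination -key
  · intro t _
    unfold HasLineDerivAt
    have h : HasDerivAt (fun s : ℝ => inner ℝ (t + s • stdVec k) u) (u k) 0 := by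
      have e : ∀ s : ℝ, inner ℝ (t + s • stdVec k) u = inner ℝ t u + s * u k := by
        intro s
        simp [inner_add_left, inner_smul_left, stdVec, EuclideanSpace.inner_single_left]
      simp_rw [e]
      simpa using ((hasDerivAt_id (0 : ℝ)).mul_const (u k)).const_add (inner ℝ t u)
    refine ((h.ofReal_comp.const_mul (-Complex.I)).cexp).congr_deriv ?_
    simp only [zero_smul, add_zero]
    ring
  · intro t _
    unfold HasLineDerivAt
    have h := hasDerivAt_window p k (μ • t)
    have h2 : HasDerivAt (fun s : ℝ => μ * s) μ 0 := by
      simpa using (hasDerivAt_id (0 : ℝ)).const_mul μ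
    have h3 := HasDerivAt.scomp (0 : ℝ) (g₁ := fun s' : ℝ =>
      window p (μ • t + s' • stdVec k)) (h := fun s' : ℝ => μ * s') (by simpa using h) h2
    refine (h3.congr_of_eventuallyEq (Filter.Eventually.of_forall fun s' => ?_)).congr_deriv
      (by simp)
    simp only [Function.comp, smul_add, smul_smul]

theorem lintegral_enorm_sq_windowHat_le {p : Fin n → ℕ} (hp : ∀ k, 2 ≤ p k) {μ : ℝ}
    (hμ : 0 < μ) :
    ∫⁻ u, ‖windowHat p μ u‖ₑ ^ 2 ≤ ENNReal.ofReal ((2 * Real.pi) ^ n) *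
      (ENNReal.ofReal ((μ ^ n)⁻¹) * majorantMass n) := by
  have := lintegral_enorm_sq_fourierHat (integrable_window_smul hp hμ) (memLp_window_smul hp hμ)
  unfold windowHat
  rw [this]
  gcongr
  exact lintegral_enorm_window_sq_le hp hμ

/-- The transform of the window is concentrated on |u| ≲ μ: each factor μ⁻¹u_k in the weight is
exchanged for p_k and a window with one more power. -/
theorem lintegral_enorm_sq_windowHat_mul_le {p : Fin n → ℕ} (hp : ∀ k, 2 ≤ p k) {μ : ℝ}
    (hμ : 0 < μ) :
    ∫⁻ u, ‖windowHat p μ u‖ₑ ^ 2 * ENNReal.ofReal (1 + (μ⁻¹ * ‖u‖) ^ 2) ≤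
      (1 + ∑ k, (p k : ℝ≥0∞) ^ 2) * (ENNReal.ofReal ((2 * Real.pi) ^ n) *
        (ENNReal.ofReal ((μ ^ n)⁻¹) * majorantMass n)) := by
  have hp' := two_le_add_single hp
  have hpt : ∀ u, ‖windowHat p μ u‖ₑ ^ 2 * ENNReal.ofReal (1 + (μ⁻¹ * ‖u‖) ^ 2) =
      ‖windowHat p μ u‖ₑ ^ 2 +
        ∑ k, (p k : ℝ≥0∞) ^ 2 * ‖windowHat (p + Pi.single k 1) μ u‖ₑ ^ 2 := by
    intro u
    have hk : ∀ k, μ⁻¹ ^ 2 * u k ^ 2 * ‖windowHat p μ u‖ ^ 2 =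
        (p k : ℝ) ^ 2 * ‖windowHat (p + Pi.single k 1) μ u‖ ^ 2 := by
      intro k
      have h := congrArg (fun z : ℂ => ‖z‖ ^ 2) (coord_mul_windowHat hp hμ k u)
      simp only [norm_mul, norm_neg, mul_pow, Complex.norm_real, Complex.norm_natCast,
        Real.norm_eq_abs, sq_abs] at h
      rw [mul_assoc, h]
      field_simp
    have e : ∀ k, (p k : ℝ≥0∞) ^ 2 * ‖windowHat (p + Pi.single k 1) μ u‖ₑ ^ 2 =
        ENNReal.ofReal ((p k : ℝ) ^ 2 * ‖windowHat (p + Pi.single k 1) μ u‖ ^ 2) := by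
      intro k
      rw [enorm_sq_eq_ofReal, ENNReal.ofReal_mul (by positivity),
        ENNReal.ofReal_pow (p := (p k : ℝ)) (by positivity), ENNReal.ofReal_natCast]
    simp_rw [e, enorm_sq_eq_ofReal]
    rw [← ENNReal.ofReal_mul (by positivity), ← ENNReal.ofReal_sum_of_nonneg
      (fun k _ => by positivity), ← ENNReal.ofReal_add (by positivity)
      (Finset.sum_nonneg fun k _ => by positivity)]
    congr 1
    rw [mul_add, mul_one, mul_pow, EuclideanSpace.norm_sq_eq, Finset.mul_sum, Finset.mul_sum]
    congr 1
    refine Finset.sum_congr rfl fun k _ => ?_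
    rw [← hk, Real.norm_eq_abs, sq_abs]
    ring
  simp_rw [hpt]
  have hm : ∀ k, Measurable fun u => (p k : ℝ≥0∞) ^ 2 * ‖windowHat (p + Pi.single k 1) μ u‖ₑ ^ 2 :=
    fun k => ((continuous_windowHat (hp' k) hμ).measurable.enorm.pow_const 2).const_mul _
  rw [lintegral_add_left ((continuous_windowHat hp hμ).measurable.enorm.pow_const 2),
    lintegral_finsetSum _ (fun k _ => hm k), add_mul, one_mul, Finset.sum_mul]
  refine add_le_add (lintegral_enorm_sq_windowHat_le hp hμ) (Finset.sum_le_sum fun k _ => ?_)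
  rw [lintegral_const_mul _ ((continuous_windowHat (hp' k) hμ).measurable.enorm.pow_const 2)]
  exact mul_le_mul_right (lintegral_enorm_sq_windowHat_le (hp' k) hμ) _

/-- Inserting Fourier inversion for f and substituting y ↦ x-y shows that, as a function of x and up
to a unimodular factor, this is a Fourier transform of f̂ localised near ξ. Plancherel in x
therefore applies. -/
theorem stft_eq_fourierHat {p : Fin n → ℕ} (hp : ∀ k, 2 ≤ p k) {μ : ℝ} (hμ : 0 < μ)
    (f : 𝓢(RSpace n, ℂ)) (x ξ : RSpace n) :
    stft p μ f x ξ = ((2 * Real.pi : ℝ) : ℂ)⁻¹ ^ n *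
      (Complex.exp (-Complex.I * ((inner ℝ x ξ : ℝ) : ℂ)) *
        fourierHat (fun v => schwartzHat f v * windowHat p μ (v - ξ)) (-x)) := by
  set c := ((2 * Real.pi : ℝ) : ℂ)⁻¹ ^ n
  have hinner : ∀ v, ∫ y, Complex.exp (-Complex.I * ((inner ℝ y ξ : ℝ) : ℂ)) *
      (window p (μ • (x - y)) * Complex.exp (Complex.I * ((inner ℝ y v : ℝ) : ℂ))) =
      Complex.exp (-Complex.I * ((inner ℝ x ξ : ℝ) : ℂ)) *
        (Complex.exp (-Complex.I * ((inner ℝ v (-x) : ℝ) : ℂ)) * windowHat p μ (v - ξ)) := by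
    intro v
    rw [windowHat, fourierHat, ← integral_const_mul, ← integral_const_mul,
      ← integral_sub_left_eq_self _ volume x]
    congr 1 with y
    rw [sub_sub_cancel, mul_left_comm, ← Complex.exp_add, mul_comm (window _ _), ← mul_assoc,
      ← mul_assoc, ← Complex.exp_add, ← Complex.exp_add]
    congr 2
    rw [inner_sub_left, inner_sub_left, inner_sub_right, inner_neg_right, real_inner_comm x v]
    push_cast
    ring
  calc stft p μ f x ξ = ∫ y, ∫ v, c * (fourierHat f v *
        (Complex.exp (-Complex.I * ((inner ℝ y ξ : ℝ) : ℂ)) *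
      (window p (μ • (x - y)) * Complex.exp (Complex.I * ((inner ℝ y v : ℝ) : ℂ))))) := by
        rw [stft, fourierHat]
        congr 1 with y
        rw [fourierHat_inversion f y, integral_const_mul, mul_left_comm (window _ _),
          mul_left_comm, ← integral_const_mul, ← integral_const_mul]
        congr 2 with v
        ring
    _ = ∫ v, ∫ y, c * (fourierHat f v *
        (Complex.exp (-Complex.I * ((inner ℝ y ξ : ℝ) : ℂ)) *
      (window p (μ • (x - y)) * Complex.exp (Complex.I * ((inner ℝ y v : ℝ) : ℂ))))) := by
        refine integral_integral_swap ?_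
        have hi : Integrable (Function.uncurry fun y v : RSpace n =>
            window p (μ • (x - y)) * schwartzHat f v) (volume.prod volume) := by
          refine Integrable.mul_prod (f := fun y => window p (μ • (x - y)))
            ?_ (schwartzHat f).integrable
          exact (integrable_window_smul hp hμ).comp_sub_left x
        have := (hi.bdd_mul (c := 1) (f := fun z : RSpace n × RSpace n =>
          Complex.exp (-Complex.I * ((inner ℝ z.1 ξ : ℝ) : ℂ)) *
          Complex.exp (Complex.I * ((inner ℝ z.1 z.2 : ℝ) : ℂ)))
          (Continuous.aestronglyMeasurable (by fun_prop))
          (Filter.Eventually.of_forall fun z => by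
            rw [norm_mul, norm_exp_neg_I_mul_ofReal, norm_exp_I_mul_ofReal', one_mul])).const_mul c
        refine this.congr (Filter.Eventually.of_forall fun z => ?_)
        simp only [Function.uncurry, coe_schwartzHat]
        ring
    _ = _ := by
        rw [fourierHat, ← integral_const_mul, ← integral_const_mul]
        congr 1 with v
        rw [integral_const_mul, integral_const_mul, hinner, coe_schwartzHat]
        ring

theorem lintegral_enorm_sq_stft_left {p : Fin n → ℕ} (hp : ∀ k, 2 ≤ p k) {μ : ℝ} (hμ : 0 < μ)
    (f : 𝓢(RSpace n, ℂ)) (ξ : RSpace n) :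
    ∫⁻ x, ‖stft p μ f x ξ‖ₑ ^ 2 = ENNReal.ofReal (((2 * Real.pi) ^ n)⁻¹) *
      ∫⁻ v, ‖windowHat p μ (v - ξ)‖ₑ ^ 2 * ‖schwartzHat f v‖ₑ ^ 2 := by
  have hcont : Continuous fun v => windowHat p μ (v - ξ) :=
    (continuous_windowHat hp hμ).comp (by fun_prop)
  have h1 : Integrable fun v => schwartzHat f v * windowHat p μ (v - ξ) :=
    (schwartzHat f).integrable.mul_bdd (c := ∫ t : RSpace n, ‖window p (μ • t)‖)
      hcont.aestronglyMeasurable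
      (Filter.Eventually.of_forall fun v => norm_fourierHat_le _ _)
  have h2 : MemLp (fun v => schwartzHat f v * windowHat p μ (v - ξ)) 2 := by
    refine MemLp.of_le_mul (c := ∫ t : RSpace n, ‖window p (μ • t)‖) ((schwartzHat f).memLp 2)
      h1.1 (Filter.Eventually.of_forall fun v => ?_)
    rw [norm_mul, mul_comm]
    exact mul_le_mul_of_nonneg_right (norm_fourierHat_le _ _) (norm_nonneg _)
  have h3 := lintegral_enorm_sq_fourierHat h1 h2
  have h4 : ∀ x, ‖stft p μ f x ξ‖ₑ ^ 2 = ENNReal.ofReal ((((2 * Real.pi) ^ n)⁻¹) ^ 2) *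
      ‖fourierHat (fun v => schwartzHat f v * windowHat p μ (v - ξ)) (-x)‖ₑ ^ 2 := by
    intro x
    rw [stft_eq_fourierHat hp hμ, enorm_sq_eq_ofReal, enorm_sq_eq_ofReal,
      ← ENNReal.ofReal_mul (by positivity), norm_mul, norm_mul, norm_exp_neg_I_mul_ofReal, one_mul,
      mul_pow, norm_pow, norm_inv, Complex.norm_real, Real.norm_of_nonneg (by positivity), inv_pow]
  simp_rw [h4]
  rw [lintegral_const_mul' _ _ ENNReal.ofReal_ne_top, lintegral_neg_eq_self
    (fun x => ‖fourierHat (fun v => schwartzHat f v * windowHat p μ (v - ξ)) x‖ₑ ^ 2), h3,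
    ← mul_assoc]
  congr 1
  · rw [← ENNReal.ofReal_mul (by positivity)]
    congr 1
    field_simp
  · congr 1 with v
    rw [enorm_mul, mul_pow, mul_comm]

/-! ### The trilinear frequency integral at one scale. -/

/-- The `L²` size of a nonnegative function. -/
def l2 {α : Type*} [MeasureSpace α] (f : α → ℝ≥0∞) : ℝ≥0∞ := (∫⁻ x, f x ^ 2) ^ (1 / 2 : ℝ)

theorem l2_sq {α : Type*} [MeasureSpace α] (f : α → ℝ≥0∞) : l2 f ^ 2 = ∫⁻ x, f x ^ 2 := by
  rw [l2, ← ENNReal.rpow_natCast, ← ENNReal.rpow_mul]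
  norm_num

theorem le_of_sq_le_sq_ennreal {a b : ℝ≥0∞} (h : a ^ 2 ≤ b ^ 2) : a ≤ b :=
  (ENNReal.pow_le_pow_left_iff two_ne_zero).1 h

theorem lintegral_mul_le_l2 {α : Type*} [MeasureSpace α] {f g : α → ℝ≥0∞} (hf : Measurable f)
    (hg : Measurable g) : ∫⁻ x, f x * g x ≤ l2 f * l2 g := by
  have := ENNReal.lintegral_mul_le_Lp_mul_Lq (volume : Measure α) Real.HolderConjugate.two_two
    hf.aemeasurable hg.aemeasurable
  simpa [l2] using this

theorem lintegral_trilinear_le_left {a b c : RSpace n → ℝ≥0∞} (ha : Measurable a)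
    (hb : Measurable b) (hc : Measurable c) :
    ∫⁻ ξ, ∫⁻ η, a ξ * (b η * c (ξ + η)) ≤ (∫⁻ ξ, a ξ) * (l2 b * l2 c) := by
  rw [← lintegral_mul_const _ ha]
  refine lintegral_mono fun ξ => ?_
  have hc' : Measurable fun η => c (ξ + η) := hc.comp (measurable_const_add ξ)
  rw [lintegral_const_mul _ (show Measurable fun η => b η * c (ξ + η) from hb.mul hc')]
  gcongr
  refine (lintegral_mul_le_l2 hb hc').trans_eq ?_
  simp only [l2]
  rw [lintegral_add_left_eq_self (fun η => c η ^ 2) ξ]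

/-- Taking ζ = ξ+η as variable in place of η puts the L¹ norm on c; Cauchy–Schwarz in ξ handles the
other two factors. -/
theorem lintegral_trilinear_le_right {a b c : RSpace n → ℝ≥0∞} (ha : Measurable a)
    (hb : Measurable b) (hc : Measurable c) :
    ∫⁻ ξ, ∫⁻ η, a ξ * (b η * c (ξ + η)) ≤ (∫⁻ ζ, c ζ) * (l2 a * l2 b) := by
  have h1 : ∀ ξ, ∫⁻ η, a ξ * (b η * c (ξ + η)) = ∫⁻ ζ, a ξ * (b (ζ - ξ) * c ζ) := by
    intro ξ
    rw [← lintegral_add_left_eq_self (fun ζ => a ξ * (b (ζ - ξ) * c ζ)) ξ]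
    simp
  simp_rw [h1]
  rw [lintegral_lintegral_swap, ← lintegral_mul_const _ hc]
  · refine lintegral_mono fun ζ => ?_
    have hb' : Measurable fun ξ => b (ζ - ξ) := hb.comp (measurable_const_sub ζ)
    calc ∫⁻ ξ, a ξ * (b (ζ - ξ) * c ζ) = ∫⁻ ξ, c ζ * (a ξ * b (ζ - ξ)) := by
          congr 1 with ξ
          ring
      _ = c ζ * ∫⁻ ξ, a ξ * b (ζ - ξ) := lintegral_const_mul _ (ha.mul hb')
      _ ≤ _ := by
          gcongr
          refine (lintegral_mul_le_l2 ha hb').trans_eq ?_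
          simp only [l2]
          rw [lintegral_sub_left_eq_self (fun η => b η ^ 2) ζ]
  · exact ((ha.comp measurable_fst).mul ((hb.comp (measurable_snd.sub measurable_fst)).mul
      (hc.comp measurable_snd))).aemeasurable

/-- The square root of the frequency weight at scale `D`, restricted to `‖ξ‖ ≤ 4D`. -/
def scaleWeight (lam D : ℝ) (ξ : RSpace n) : ℝ≥0∞ :=
  (Metric.closedBall (0 : RSpace n) (4 * D)).indicator
    (fun ξ => ENNReal.ofReal (((lam + ‖ξ‖) / D) ^ (1 / 4 : ℝ))) ξ

theorem measurable_scaleWeight (lam D : ℝ) : Measurable (scaleWeight (n := n) lam D) :=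
  Measurable.indicator (by fun_prop) Metric.isClosed_closedBall.measurableSet

theorem scaleWeight_of_le {lam D : ℝ} {ξ : RSpace n} (h : ‖ξ‖ ≤ 4 * D) :
    scaleWeight lam D ξ = ENNReal.ofReal (((lam + ‖ξ‖) / D) ^ (1 / 4 : ℝ)) :=
  Set.indicator_of_mem (by simpa using h) _

theorem scaleWeight_of_gt {lam D : ℝ} {ξ : RSpace n} (h : 4 * D < ‖ξ‖) :
    scaleWeight lam D ξ = 0 :=
  Set.indicator_of_notMem (by simpa using h) _

/-- The mass of `‖v‖ ^ (-1/2)` on the ball of radius `5`. -/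
def rieszMass (n : ℕ) : ℝ≥0∞ :=
  ∫⁻ v in Metric.ball (0 : RSpace n) 5, ENNReal.ofReal (‖v‖ ^ (-(1 / 2) : ℝ))

theorem rieszMass_ne_top (hn : 1 ≤ n) : rieszMass n ≠ ⊤ := by
  have h : IntegrableOn (fun v : RSpace n => ‖v‖ ^ (-(1 / 2) : ℝ)) (Metric.ball 0 5) volume := by
    -- The exponent 1/2 is less than n because n ≥ 1.
    refine integrableOn_ball_of_norm_le_rpow (C := 1) (α := 1 / 2) (by simpa using hn) ?_ ?_ ?_
    · rw [finrank_euclideanSpace_fin]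
      have : (1 : ℝ) ≤ n := by exact_mod_cast hn
      linarith
    · refine Filter.Eventually.of_forall fun v => ?_
      rw [one_mul, Real.norm_of_nonneg (by positivity)]
    · exact (by fun_prop : Measurable fun v : RSpace n => ‖v‖ ^ (-(1 / 2) : ℝ)).aestronglyMeasurable
  rw [rieszMass, ← ofReal_integral_eq_lintegral_ofReal h
    (Filter.Eventually.of_forall fun v => by positivity)]
  exact ENNReal.ofReal_ne_top

theorem lintegral_inv_scaleWeight_sq_le (hn : 1 ≤ n) {lam D : ℝ} (hl : 0 < lam) (hD : 0 < D) :
    ∫⁻ ξ in Metric.closedBall (0 : RSpace n) (4 * D),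
      ENNReal.ofReal (((lam + ‖ξ‖) / D) ^ (-(1 / 4) : ℝ)) ^ 2 ≤
      ENNReal.ofReal (D ^ n) * rieszMass n := by
  have : Nontrivial (RSpace n) := Module.nontrivial_of_finrank_pos (R := ℝ) (by simpa using Nat.pos_of_ne_zero (by omega))
  have h := lintegral_comp_smul_pos (inv_pos.2 hD) ((Metric.ball (0 : RSpace n) 5).indicator
    fun v => ENNReal.ofReal (‖v‖ ^ (-(1 / 2) : ℝ)))
  rw [lintegral_indicator Metric.isOpen_ball.measurableSet, inv_pow, inv_inv] at h
  rw [rieszMass, ← h, ← lintegral_indicator Metric.isClosed_closedBall.measurableSet]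
  -- At the origin the real power `‖v‖ ^ (-(1 / 2))` has the default value 0 and the pointwise bound
  -- fails, so the comparison is only almost everywhere.
  refine lintegral_mono_ae ?_
  filter_upwards [compl_mem_ae_iff.2 (measure_singleton (0 : RSpace n))] with ξ hξ
  have hξ0 : 0 < ‖ξ‖ := norm_pos_iff.2 hξ
  by_cases hm : ξ ∈ Metric.closedBall (0 : RSpace n) (4 * D)
  · have hm' : D⁻¹ • ξ ∈ Metric.ball (0 : RSpace n) 5 := by
      rw [mem_closedBall_zero_iff] at hm
      rw [mem_ball_zero_iff, norm_smul, Real.norm_of_nonneg (by positivity),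
        inv_mul_lt_iff₀ hD]
      linarith
    rw [Set.indicator_of_mem hm, Set.indicator_of_mem hm', ← ENNReal.ofReal_pow (by positivity)]
    refine ENNReal.ofReal_le_ofReal ?_
    rw [← Real.rpow_natCast, ← Real.rpow_mul (by positivity), norm_smul,
      Real.norm_of_nonneg (by positivity)]
    norm_num
    refine Real.rpow_le_rpow_of_nonpos (by positivity) ?_ (by norm_num)
    rw [inv_mul_eq_div]
    gcongr
    linarith
  · rw [Set.indicator_of_notMem hm]
    exact zero_le

/-- Cauchy–Schwarz against the inverse weight, whose square has integral at most of order D^n over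
the ball. An L¹ norm on the ball thus acquires the weight for the price D^{n/2}. -/
theorem lintegral_ball_le_l2_scaleWeight (hn : 1 ≤ n) {lam D : ℝ} (hl : 0 < lam) (hD : 0 < D)
    {F : RSpace n → ℝ≥0∞} (hF : Measurable F) :
    ∫⁻ ξ in Metric.closedBall (0 : RSpace n) (4 * D), F ξ ≤
      (ENNReal.ofReal (D ^ n) * rieszMass n) ^ (1 / 2 : ℝ) *
        l2 (fun ξ => F ξ * scaleWeight lam D ξ) := by
  set B := Metric.closedBall (0 : RSpace n) (4 * D)
  have hB : MeasurableSet B := Metric.isClosed_closedBall.measurableSet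
  set u : RSpace n → ℝ≥0∞ :=
    B.indicator fun ξ => ENNReal.ofReal (((lam + ‖ξ‖) / D) ^ (-(1 / 4) : ℝ)) with hu
  have hum : Measurable u := Measurable.indicator (by fun_prop) hB
  have h1 : ∫⁻ ξ in B, F ξ = ∫⁻ ξ, u ξ * (F ξ * scaleWeight lam D ξ) := by
    rw [← lintegral_indicator hB]
    congr 1 with ξ
    by_cases hm : ξ ∈ B
    · rw [hu, Set.indicator_of_mem hm, Set.indicator_of_mem hm,
        scaleWeight_of_le (mem_closedBall_zero_iff.1 hm), mul_left_comm,
        ← ENNReal.ofReal_mul (by positivity), ← Real.rpow_add (by positivity)]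
      norm_num
    · rw [hu, Set.indicator_of_notMem hm, Set.indicator_of_notMem hm, zero_mul]
  rw [h1]
  refine (lintegral_mul_le_l2 hum (hF.mul (measurable_scaleWeight _ _))).trans ?_
  refine mul_le_mul_left ?_ _
  rw [l2]
  refine ENNReal.rpow_le_rpow ?_ (by norm_num)
  refine le_trans (le_of_eq ?_) (lintegral_inv_scaleWeight_sq_le hn hl hD)
  rw [← lintegral_indicator hB]
  congr 1 with ξ
  by_cases hm : ξ ∈ B
  · rw [hu, Set.indicator_of_mem hm, Set.indicator_of_mem hm]
  · rw [hu, Set.indicator_of_notMem hm, Set.indicator_of_notMem hm]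
    simp

/-- The frequency region in `(ξ, η)` at scale `D`. -/
def scaleRegion (n : ℕ) (D : ℝ) : Set (RSpace n × RSpace n) :=
  {z | ‖z.1‖ ≤ 2 * D ∧ ‖z.2‖ ≤ 2 * D ∧ D ≤ 4 * (1 + max ‖z.1‖ ‖z.2‖)}

theorem isClosed_scaleRegion (D : ℝ) : IsClosed (scaleRegion n D) := by
  have h1 : Continuous fun z : RSpace n × RSpace n => ‖z.1‖ := by fun_prop
  have h2 : Continuous fun z : RSpace n × RSpace n => ‖z.2‖ := by fun_prop
  exact (isClosed_le h1 continuous_const).inter ((isClosed_le h2 continuous_const).inter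
    (isClosed_le continuous_const (continuous_const.mul (continuous_const.add (h1.max h2)))))

theorem one_le_two_mul_scaleWeight {lam D : ℝ} (hD : 0 < D) {ξ : RSpace n}
    (h1 : ‖ξ‖ ≤ 4 * D) (h2 : D ≤ 8 * (lam + ‖ξ‖)) : 1 ≤ 2 * scaleWeight lam D ξ := by
  rw [scaleWeight_of_le h1]
  -- The ratio is at least 1/8, hence at least 1/16 = (1/2)⁴.
  have h3 : (1 / 2 : ℝ) ≤ ((lam + ‖ξ‖) / D) ^ (1 / 4 : ℝ) := by
    have : (1 / 2 : ℝ) = (1 / 16 : ℝ) ^ (1 / 4 : ℝ) := by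
      rw [show (1 / 16 : ℝ) = (1 / 2) ^ (4 : ℝ) by norm_num, ← Real.rpow_mul (by norm_num)]
      norm_num
    rw [this]
    refine Real.rpow_le_rpow (by norm_num) ?_ (by norm_num)
    rw [le_div_iff₀ hD]
    linarith
  have h4 : (2 : ℝ≥0∞) * ENNReal.ofReal (((lam + ‖ξ‖) / D) ^ (1 / 4 : ℝ)) =
      ENNReal.ofReal (2 * ((lam + ‖ξ‖) / D) ^ (1 / 4 : ℝ)) := by
    rw [ENNReal.ofReal_mul (by norm_num), ENNReal.ofReal_ofNat]
  rw [h4, ENNReal.one_le_ofReal]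
  linarith

/-- If λ+|ξ| and λ+|ξ+η| were both below D/8, then |η| ≤ |ξ|+|ξ+η| would contradict D ≤
4(1+max(|ξ|,|η|)). So the weight is at least 1/2 at ξ or at ξ+η and can be inserted there. It is
never put on η, since g has no L² control. -/
theorem scaleRegion_indicator_le {lam D : ℝ} (hl : 1 ≤ lam) (hD : lam ≤ D)
    (F G H : RSpace n → ℝ≥0∞) (ξ η : RSpace n) :
    (scaleRegion n D).indicator (fun z => F z.1 * (G z.2 * H (z.1 + z.2))) (ξ, η) ≤
      2 * ((F ξ * scaleWeight lam D ξ) *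
        (G η * (Metric.closedBall 0 (4 * D)).indicator H (ξ + η))) +
      2 * ((Metric.closedBall 0 (4 * D)).indicator F ξ *
        (G η * (H (ξ + η) * scaleWeight lam D (ξ + η)))) := by
  have hD0 : 0 < D := by linarith
  by_cases hm : (ξ, η) ∈ scaleRegion n D
  · rw [Set.indicator_of_mem hm]
    obtain ⟨h1, h2, h3⟩ := hm
    simp only at h1 h2 h3 ⊢
    have h4 : ‖ξ‖ ≤ 4 * D := by linarith
    have h5 : ‖ξ + η‖ ≤ 4 * D := (norm_add_le _ _).trans (by linarith)
    have h6 : ‖η‖ ≤ ‖ξ + η‖ + ‖ξ‖ := by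
      have := norm_sub_le (ξ + η) ξ
      rwa [add_sub_cancel_left] at this
    have h7 : D ≤ 8 * (lam + ‖ξ‖) ∨ D ≤ 8 * (lam + ‖ξ + η‖) := by
      by_contra hcon
      push Not at hcon
      have := norm_nonneg ξ
      have := norm_nonneg (ξ + η)
      rcases max_cases ‖ξ‖ ‖η‖ with ⟨h, _⟩ | ⟨h, _⟩ <;> rw [h] at h3 <;> linarith
    rw [Set.indicator_of_mem (mem_closedBall_zero_iff.2 h4),
      Set.indicator_of_mem (mem_closedBall_zero_iff.2 h5)]
    rcases h7 with h | h
    · refine le_trans ?_ le_self_add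
      calc F ξ * (G η * H (ξ + η)) ≤ F ξ * (G η * H (ξ + η)) * (2 * scaleWeight lam D ξ) :=
            le_mul_of_one_le_right zero_le (one_le_two_mul_scaleWeight hD0 h4 h)
        _ = _ := by ring
    · refine le_trans ?_ le_add_self
      calc F ξ * (G η * H (ξ + η)) ≤ F ξ * (G η * H (ξ + η)) * (2 * scaleWeight lam D (ξ + η)) :=
            le_mul_of_one_le_right zero_le (one_le_two_mul_scaleWeight hD0 h5 h)
        _ = _ := by ring
  · rw [Set.indicator_of_notMem hm]
    exact zero_le

theorem lintegral_le_of_trilinear_bound {Φ : RSpace n → RSpace n → ℝ≥0∞}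
    {a b c a' c' : RSpace n → ℝ≥0∞} (ha : Measurable a) (hb : Measurable b) (hc : Measurable c)
    (ha' : Measurable a') (hc' : Measurable c')
    (h : ∀ ξ η, Φ ξ η ≤ 2 * (a ξ * (b η * c (ξ + η))) + 2 * (a' ξ * (b η * c' (ξ + η)))) :
    ∫⁻ ξ, ∫⁻ η, Φ ξ η ≤
      2 * ((∫⁻ ζ, c ζ) * (l2 a * l2 b)) + 2 * ((∫⁻ ξ, a' ξ) * (l2 b * l2 c')) := by
  have hm1 : Measurable fun z : RSpace n × RSpace n => a z.1 * (b z.2 * c (z.1 + z.2)) :=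
    (ha.comp measurable_fst).mul
      ((hb.comp measurable_snd).mul (hc.comp (measurable_fst.add measurable_snd)))
  have hm2 : Measurable fun z : RSpace n × RSpace n => a' z.1 * (b z.2 * c' (z.1 + z.2)) :=
    (ha'.comp measurable_fst).mul
      ((hb.comp measurable_snd).mul (hc'.comp (measurable_fst.add measurable_snd)))
  have hs1 : ∀ ξ, Measurable fun η => a ξ * (b η * c (ξ + η)) :=
    fun ξ => hm1.comp measurable_prodMk_left
  have hs2 : ∀ ξ, Measurable fun η => a' ξ * (b η * c' (ξ + η)) :=
    fun ξ => hm2.comp measurable_prodMk_left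
  have hi1 : Measurable fun ξ => ∫⁻ η, a ξ * (b η * c (ξ + η)) := hm1.lintegral_prod_right'
  have hi2 : Measurable fun ξ => ∫⁻ η, a' ξ * (b η * c' (ξ + η)) := hm2.lintegral_prod_right'
  calc _ ≤ ∫⁻ ξ, ∫⁻ η, (2 * (a ξ * (b η * c (ξ + η))) + 2 * (a' ξ * (b η * c' (ξ + η)))) :=
        lintegral_mono fun ξ => lintegral_mono fun η => h ξ η
    _ = ∫⁻ ξ, (2 * (∫⁻ η, a ξ * (b η * c (ξ + η))) + 2 * ∫⁻ η, a' ξ * (b η * c' (ξ + η))) := by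
      refine lintegral_congr fun ξ => ?_
      rw [lintegral_add_left ((hs1 ξ).const_mul 2), lintegral_const_mul _ (hs1 ξ),
        lintegral_const_mul _ (hs2 ξ)]
    _ = 2 * (∫⁻ ξ, ∫⁻ η, a ξ * (b η * c (ξ + η))) +
        2 * ∫⁻ ξ, ∫⁻ η, a' ξ * (b η * c' (ξ + η)) := by
      rw [lintegral_add_left (hi1.const_mul 2), lintegral_const_mul _ hi1,
        lintegral_const_mul _ hi2]
    _ ≤ _ := add_le_add (mul_le_mul_right (lintegral_trilinear_le_right ha hb hc) _)
        (mul_le_mul_right (lintegral_trilinear_le_left ha' hb hc') _)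

/-- In each term of the splitting, the factor without weight stands in L¹ of the ball and regains
the weight by Cauchy–Schwarz, so the two terms have the same bound. -/
theorem lintegral_scaleRegion_le (hn : 1 ≤ n) {lam D : ℝ} (hl : 1 ≤ lam) (hD : lam ≤ D)
    {F G H : RSpace n → ℝ≥0∞} (hF : Measurable F) (hG : Measurable G) (hH : Measurable H) :
    ∫⁻ ξ, ∫⁻ η, (scaleRegion n D).indicator (fun z => F z.1 * (G z.2 * H (z.1 + z.2))) (ξ, η) ≤
      4 * (ENNReal.ofReal (D ^ n) * rieszMass n) ^ (1 / 2 : ℝ) *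
        (l2 (fun ξ => F ξ * scaleWeight lam D ξ) * l2 G *
          l2 (fun ξ => H ξ * scaleWeight lam D ξ)) := by
  have hl0 : 0 < lam := by linarith
  have hD0 : 0 < D := by linarith
  have hB : MeasurableSet (Metric.closedBall (0 : RSpace n) (4 * D)) :=
    Metric.isClosed_closedBall.measurableSet
  have hW : Measurable (scaleWeight (n := n) lam D) := measurable_scaleWeight _ _
  refine (lintegral_le_of_trilinear_bound (a := fun ξ => F ξ * scaleWeight lam D ξ)
    (c' := fun ξ => H ξ * scaleWeight lam D ξ) (hF.mul hW) hG (hH.indicator hB) (hF.indicator hB)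
    (hH.mul hW) (scaleRegion_indicator_le hl hD F G H)).trans ?_
  rw [lintegral_indicator hB, lintegral_indicator hB]
  refine (add_le_add
    (mul_le_mul_right (mul_le_mul_left (lintegral_ball_le_l2_scaleWeight hn hl0 hD0 hH) _) _)
    (mul_le_mul_right (mul_le_mul_left (lintegral_ball_le_l2_scaleWeight hn hl0 hD0 hF) _) _)
    ).trans_eq ?_
  ring

theorem sqrt_add_le {a b : ℝ} (ha : 0 ≤ a) (hb : 0 ≤ b) : √(a + b) ≤ √a + √b := by
  rw [Real.sqrt_le_left (by positivity)]
  nlinarith [Real.sq_sqrt ha, Real.sq_sqrt hb, mul_nonneg (Real.sqrt_nonneg a) (Real.sqrt_nonneg b)]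

/-! ### Weighted energies of the short-time transforms. -/

/-- The frequency multiplier that records how far `‖v‖` is from `D`. -/
def scaleKernel (lam D : ℝ) (v : RSpace n) : ℝ :=
  √(lam / D) + √(‖v‖ / D) / ((1 + √(‖v‖ / D)) * (2 + √(‖v‖ / D)))

theorem scaleKernel_nonneg (lam D : ℝ) (v : RSpace n) : 0 ≤ scaleKernel lam D v := by
  unfold scaleKernel
  positivity

/-- Moving from ξ to v changes the weight through (λ+|v-ξ|)/D only, which the first term of
`scaleKernel` and the polynomial factor pay for. If v is far outside the ball, v-ξ alone dominates
ξ, so the second term of the kernel may decay for large |v|. -/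
theorem scaleWeight_sq_le {lam D : ℝ} (hl : 0 < lam) (hD : lam ≤ D) (ξ v : RSpace n) :
    scaleWeight lam D ξ ^ 2 ≤
      ENNReal.ofReal (30 * scaleKernel lam D v) *
        ENNReal.ofReal (1 + (lam⁻¹ * ‖v - ξ‖) ^ 2) := by
  have hD0 : 0 < D := by linarith
  rcases lt_or_ge (4 * D) ‖ξ‖ with h | h
  · rw [scaleWeight_of_gt h]
    simp
  rw [scaleWeight_of_le h, ← ENNReal.ofReal_pow (by positivity),
    ← ENNReal.ofReal_mul (by have := scaleKernel_nonneg lam D v; positivity)]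
  refine ENNReal.ofReal_le_ofReal ?_
  rw [← Real.rpow_natCast, ← Real.rpow_mul (by positivity)]
  norm_num
  rw [← Real.sqrt_eq_rpow]
  set u := ‖v - ξ‖
  have hu : 0 ≤ u := norm_nonneg _
  set s := √(‖v‖ / D) with hs
  have hs0 : 0 ≤ s := Real.sqrt_nonneg _
  set a := lam⁻¹ * u with ha
  have ha0 : 0 ≤ a := by positivity
  have h1 : √((lam + u) / D) ≤ √(lam / D) * (2 * (1 + a ^ 2)) := by
    have : (lam + u) / D = lam / D * (1 + a) := by
      rw [ha]
      field_simp
    rw [this, Real.sqrt_mul (by positivity)]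
    gcongr
    rw [Real.sqrt_le_left (by positivity)]
    nlinarith [sq_nonneg (a - 1), sq_nonneg a]
  have h2 : √((lam + ‖ξ‖) / D) ≤ √(lam / D) * (2 * (1 + a ^ 2)) +
      30 * (s / ((1 + s) * (2 + s))) := by
    -- For |v| ≤ 16D one has s ≤ 4 and (1+s)(2+s) ≤ 30, whence the constant 30. For |v| > 16D, |v-ξ|
    -- ≥ 12D ≥ |ξ|.
    rcases le_or_gt ‖v‖ (16 * D) with hv | hv
    · have hs4 : s ≤ 4 := by
        rw [hs, Real.sqrt_le_left (by norm_num), div_le_iff₀ hD0]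
        linarith
      have h3 : s ≤ 30 * (s / ((1 + s) * (2 + s))) := by
        rw [mul_div_assoc', le_div_iff₀ (by positivity)]
        nlinarith [mul_nonneg hs0 hs0]
      have h4 : ‖ξ‖ ≤ u + ‖v‖ := by
        have := norm_sub_le v (v - ξ)
        rw [sub_sub_cancel] at this
        linarith
      have h5 : √((lam + ‖ξ‖) / D) ≤ √((lam + u) / D) + s := by
        refine le_trans (Real.sqrt_le_sqrt ?_) (sqrt_add_le (by positivity) (by positivity))
        rw [← add_div]
        exact div_le_div_of_nonneg_right (by linarith) hD0.le
      linarith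
    · have h4 : ‖v‖ ≤ u + ‖ξ‖ := by
        have := norm_add_le (v - ξ) ξ
        rwa [sub_add_cancel] at this
      have h5 : √((lam + ‖ξ‖) / D) ≤ √((lam + u) / D) := by
        refine Real.sqrt_le_sqrt (div_le_div_of_nonneg_right ?_ hD0.le)
        linarith
      have h6 : 0 ≤ 30 * (s / ((1 + s) * (2 + s))) := by positivity
      linarith
  refine h2.trans ?_
  unfold scaleKernel
  rw [← hs]
  have h7 : 0 ≤ s / ((1 + s) * (2 + s)) := by positivity
  have h8 : 0 ≤ √(lam / D) := Real.sqrt_nonneg _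
  nlinarith [mul_nonneg h7 (sq_nonneg a), mul_nonneg h8 (sq_nonneg a)]

/-- The squared `L²` norm of `Φ` against the frequency multiplier `scaleKernel`. -/
def kernelEnergy (lam D : ℝ) (Φ : RSpace n → ℂ) : ℝ≥0∞ :=
  ∫⁻ v, ENNReal.ofReal (scaleKernel lam D v) * ‖Φ v‖ₑ ^ 2

/-- After Fubini, `scaleWeight_sq_le` separates the variables v and v-ξ. -/
theorem lintegral_scaleWeight_conv_le {lam D : ℝ} (hl : 0 < lam) (hD : lam ≤ D)
    {K Φ : RSpace n → ℝ≥0∞} (hK : Measurable K) (hΦ : Measurable Φ) :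
    ∫⁻ ξ, scaleWeight lam D ξ ^ 2 * ∫⁻ v, K (v - ξ) * Φ v ≤
      (30 * ∫⁻ u, K u * ENNReal.ofReal (1 + (lam⁻¹ * ‖u‖) ^ 2)) *
        ∫⁻ v, ENNReal.ofReal (scaleKernel lam D v) * Φ v := by
  have hW : Measurable (scaleWeight (n := n) lam D) := measurable_scaleWeight _ _
  have hm : Measurable fun z : RSpace n × RSpace n => K (z.2 - z.1) * Φ z.2 :=
    (hK.comp (measurable_snd.sub measurable_fst)).mul (hΦ.comp measurable_snd)
  have hm2 : Measurable fun z : RSpace n × RSpace n =>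
      scaleWeight lam D z.1 ^ 2 * (K (z.2 - z.1) * Φ z.2) :=
    ((hW.comp measurable_fst).pow_const 2).mul hm
  have hκ : Measurable fun v : RSpace n => ENNReal.ofReal (scaleKernel lam D v) := by
    unfold scaleKernel
    fun_prop
  have hK' : Measurable fun u : RSpace n => K u * ENNReal.ofReal (1 + (lam⁻¹ * ‖u‖) ^ 2) :=
    hK.mul (by fun_prop)
  calc ∫⁻ ξ, scaleWeight lam D ξ ^ 2 * ∫⁻ v, K (v - ξ) * Φ v
      = ∫⁻ ξ, ∫⁻ v, scaleWeight lam D ξ ^ 2 * (K (v - ξ) * Φ v) := by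
        refine lintegral_congr fun ξ => ?_
        have hmξ : Measurable fun v => K (v - ξ) * Φ v := hm.comp measurable_prodMk_left
        rw [lintegral_const_mul _ hmξ]
    _ = ∫⁻ v, ∫⁻ ξ, scaleWeight lam D ξ ^ 2 * (K (v - ξ) * Φ v) :=
        lintegral_lintegral_swap hm2.aemeasurable
    _ ≤ ∫⁻ v, (30 * ∫⁻ u, K u * ENNReal.ofReal (1 + (lam⁻¹ * ‖u‖) ^ 2)) *
          (ENNReal.ofReal (scaleKernel lam D v) * Φ v) := by
        refine lintegral_mono fun v => ?_
        calc ∫⁻ ξ, scaleWeight lam D ξ ^ 2 * (K (v - ξ) * Φ v)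
            ≤ ∫⁻ ξ, (ENNReal.ofReal (30 * scaleKernel lam D v) * Φ v) *
                (K (v - ξ) * ENNReal.ofReal (1 + (lam⁻¹ * ‖v - ξ‖) ^ 2)) := by
              refine lintegral_mono fun ξ => ?_
              refine (mul_le_mul_left (scaleWeight_sq_le hl hD ξ v) _).trans_eq ?_
              ring
          _ = (ENNReal.ofReal (30 * scaleKernel lam D v) * Φ v) *
                ∫⁻ ξ, K (v - ξ) * ENNReal.ofReal (1 + (lam⁻¹ * ‖v - ξ‖) ^ 2) :=
              lintegral_const_mul _ (hK'.comp (measurable_const_sub v))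
          _ = (ENNReal.ofReal (30 * scaleKernel lam D v) * Φ v) *
                ∫⁻ u, K u * ENNReal.ofReal (1 + (lam⁻¹ * ‖u‖) ^ 2) := by
              rw [lintegral_sub_left_eq_self
                (fun u => K u * ENNReal.ofReal (1 + (lam⁻¹ * ‖u‖) ^ 2)) v]
          _ = _ := by
              rw [ENNReal.ofReal_mul (by norm_num), ENNReal.ofReal_ofNat]
              ring
    _ = _ := lintegral_const_mul _ (hκ.mul hΦ)

/-- Plancherel in x at fixed ξ spreads f̂ over distances of order λ, through a kernel of mass
λ^{-n}; the weight in ξ becomes the multiplier in v. -/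
theorem lintegral_stft_scaleWeight_le {p : Fin n → ℕ} (hp : ∀ k, 2 ≤ p k) {lam D : ℝ}
    (hl : 0 < lam) (hD : lam ≤ D) (f : 𝓢(RSpace n, ℂ)) :
    ∫⁻ x, ∫⁻ ξ, (‖stft p lam f x ξ‖ₑ * scaleWeight lam D ξ) ^ 2 ≤
      (30 * (1 + ∑ k, (p k : ℝ≥0∞) ^ 2) * majorantMass n) * ENNReal.ofReal ((lam ^ n)⁻¹) *
        kernelEnergy lam D (schwartzHat f) := by
  have hW : Measurable (scaleWeight (n := n) lam D) := measurable_scaleWeight _ _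
  have hs := (continuous_stft p lam f).measurable.enorm
  have hm : Measurable fun z : RSpace n × RSpace n =>
      (‖stft p lam f z.1 z.2‖ₑ * scaleWeight lam D z.2) ^ 2 :=
    (hs.mul (hW.comp measurable_snd)).pow_const 2
  rw [lintegral_lintegral_swap hm.aemeasurable]
  calc ∫⁻ ξ, ∫⁻ x, (‖stft p lam f x ξ‖ₑ * scaleWeight lam D ξ) ^ 2
      = ∫⁻ ξ, ENNReal.ofReal (((2 * Real.pi) ^ n)⁻¹) * (scaleWeight lam D ξ ^ 2 *
          ∫⁻ v, ‖windowHat p lam (v - ξ)‖ₑ ^ 2 * ‖schwartzHat f v‖ₑ ^ 2) := by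
        refine lintegral_congr fun ξ => ?_
        simp_rw [mul_pow (‖stft _ _ _ _ _‖ₑ)]
        have hsξ : Measurable fun x => ‖stft p lam f x ξ‖ₑ ^ 2 :=
          (hs.comp measurable_prodMk_right).pow_const 2
        rw [lintegral_mul_const _ hsξ,
          lintegral_enorm_sq_stft_left hp hl]
        ring
    _ = ENNReal.ofReal (((2 * Real.pi) ^ n)⁻¹) * ∫⁻ ξ, (scaleWeight lam D ξ ^ 2 *
          ∫⁻ v, ‖windowHat p lam (v - ξ)‖ₑ ^ 2 * ‖schwartzHat f v‖ₑ ^ 2) :=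
        lintegral_const_mul' _ _ ENNReal.ofReal_ne_top
    _ ≤ ENNReal.ofReal (((2 * Real.pi) ^ n)⁻¹) * ((30 *
          ((1 + ∑ k, (p k : ℝ≥0∞) ^ 2) * (ENNReal.ofReal ((2 * Real.pi) ^ n) *
            (ENNReal.ofReal ((lam ^ n)⁻¹) * majorantMass n)))) *
          kernelEnergy lam D (schwartzHat f)) := by
        refine mul_le_mul_right ((lintegral_scaleWeight_conv_le hl hD
          (K := fun u => ‖windowHat p lam u‖ₑ ^ 2) (Φ := fun v => ‖schwartzHat f v‖ₑ ^ 2)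
          ((continuous_windowHat hp hl).measurable.enorm.pow_const 2)
          ((schwartzHat f).continuous.measurable.enorm.pow_const 2)).trans ?_) _
        exact mul_le_mul_left
          (mul_le_mul_right (lintegral_enorm_sq_windowHat_mul_le hp hl) _) _
    _ = (ENNReal.ofReal (((2 * Real.pi) ^ n)⁻¹) * ENNReal.ofReal ((2 * Real.pi) ^ n)) *
          ((30 * (1 + ∑ k, (p k : ℝ≥0∞) ^ 2) * majorantMass n) * ENNReal.ofReal ((lam ^ n)⁻¹) *
        kernelEnergy lam D (schwartzHat f)) := by ring
    _ = _ := by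
        rw [← ENNReal.ofReal_mul (by positivity), inv_mul_cancel₀ (by positivity),
          ENNReal.ofReal_one, one_mul]

/-- Here φ is itself a function of frequency, so Plancherel in x leaves the window, of width λ and
squared mass λ^n, rather than its transform. -/
theorem lintegral_stft_scaleWeight_swap_le {r : Fin n → ℕ} (hr : ∀ k, 2 ≤ r k) {lam D : ℝ}
    (hl : 0 < lam) (hD : lam ≤ D) (φ : 𝓢(RSpace n, ℂ)) :
    ∫⁻ x, ∫⁻ ζ, (‖stft r lam⁻¹ φ ζ x‖ₑ * scaleWeight lam D ζ) ^ 2 ≤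
      (30 * ENNReal.ofReal ((2 * Real.pi) ^ n) * majorantMass n) * ENNReal.ofReal (lam ^ n) *
        kernelEnergy lam D φ := by
  have hW : Measurable (scaleWeight (n := n) lam D) := measurable_scaleWeight _ _
  have hs := (continuous_stft r lam⁻¹ φ).measurable.enorm
  have hm : Measurable fun z : RSpace n × RSpace n =>
      (‖stft r lam⁻¹ φ z.2 z.1‖ₑ * scaleWeight lam D z.2) ^ 2 :=
    ((hs.comp measurable_swap).mul (hW.comp measurable_snd)).pow_const 2
  rw [lintegral_lintegral_swap hm.aemeasurable]
  have hK : ∫⁻ u : RSpace n, ‖window r (lam⁻¹ • -u)‖ₑ ^ 2 *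
      ENNReal.ofReal (1 + (lam⁻¹ * ‖u‖) ^ 2) ≤ ENNReal.ofReal (lam ^ n) * majorantMass n := by
    have h := lintegral_enorm_window_sq_mul_le hr (inv_pos.2 hl)
    rw [inv_pow, inv_inv, ← lintegral_neg_eq_self] at h
    simpa only [norm_neg] using h
  calc ∫⁻ ζ, ∫⁻ x, (‖stft r lam⁻¹ φ ζ x‖ₑ * scaleWeight lam D ζ) ^ 2
      = ∫⁻ ζ, ENNReal.ofReal ((2 * Real.pi) ^ n) * (scaleWeight lam D ζ ^ 2 *
          ∫⁻ v, ‖window r (lam⁻¹ • -(v - ζ))‖ₑ ^ 2 * ‖φ v‖ₑ ^ 2) := by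
        refine lintegral_congr fun ζ => ?_
        simp_rw [mul_pow (‖stft _ _ _ _ _‖ₑ)]
        have hsζ : Measurable fun x => ‖stft r lam⁻¹ φ ζ x‖ₑ ^ 2 :=
          (hs.comp measurable_prodMk_left).pow_const 2
        rw [lintegral_mul_const _ hsζ,
          lintegral_enorm_sq_stft]
        simp_rw [neg_sub]
        ring
    _ = ENNReal.ofReal ((2 * Real.pi) ^ n) * ∫⁻ ζ, (scaleWeight lam D ζ ^ 2 *
          ∫⁻ v, ‖window r (lam⁻¹ • -(v - ζ))‖ₑ ^ 2 * ‖φ v‖ₑ ^ 2) :=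
        lintegral_const_mul' _ _ ENNReal.ofReal_ne_top
    _ ≤ ENNReal.ofReal ((2 * Real.pi) ^ n) * ((30 *
          (ENNReal.ofReal (lam ^ n) * majorantMass n)) * kernelEnergy lam D φ) := by
        refine mul_le_mul_right ((lintegral_scaleWeight_conv_le hl hD
          (K := fun u => ‖window r (lam⁻¹ • -u)‖ₑ ^ 2) (Φ := fun v => ‖φ v‖ₑ ^ 2)
          (((continuous_window r).comp (by fun_prop)).measurable.enorm.pow_const 2)
          (φ.continuous.measurable.enorm.pow_const 2)).trans ?_) _
        exact mul_le_mul_left (mul_le_mul_right hK _) _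
    _ = _ := by ring

/-! ### The trilinear estimate for decaying windows. -/

theorem measurable_l2_prod {F : RSpace n → RSpace n → ℝ≥0∞}
    (hF : Measurable (Function.uncurry F)) : Measurable fun x => l2 (F x) :=
  ((hF.pow_const 2).lintegral_prod_right').pow_const _

theorem measurable_of_measurable_left {F : RSpace n → RSpace n → ℝ≥0∞}
    (hF : Measurable fun z : RSpace n × RSpace n => F z.1 z.2) (x : RSpace n) :
    Measurable fun ξ => F x ξ :=
  hF.comp measurable_prodMk_left

theorem measurable_of_measurable_right {F : RSpace n → RSpace n → ℝ≥0∞}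
    (hF : Measurable fun z : RSpace n × RSpace n => F z.1 z.2) (x : RSpace n) :
    Measurable fun ξ => F ξ x :=
  hF.comp measurable_prodMk_right

theorem rpow_half_sq (a : ℝ≥0∞) : (a ^ (1 / 2 : ℝ)) ^ 2 = a := by
  rw [← ENNReal.rpow_natCast, ← ENNReal.rpow_mul]
  norm_num

theorem lintegral_sq_le_of_le_l2 {T : RSpace n → ℝ≥0∞} {F H : RSpace n → RSpace n → ℝ≥0∞}
    (hF : Measurable (Function.uncurry F)) (hH : Measurable (Function.uncurry H)) (c : ℝ≥0∞)
    (h : ∀ x, T x ≤ c * (l2 (F x) * l2 (H x))) :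
    (∫⁻ x, T x) ^ 2 ≤ c ^ 2 * ((∫⁻ x, ∫⁻ ξ, F x ξ ^ 2) * ∫⁻ x, ∫⁻ ζ, H x ζ ^ 2) := by
  have hF2 := measurable_l2_prod hF
  have hH2 := measurable_l2_prod hH
  have h1 : ∫⁻ x, T x ≤ c * (l2 (fun x => l2 (F x)) * l2 (fun x => l2 (H x))) := by
    refine (lintegral_mono h).trans ?_
    have hm : Measurable fun x => l2 (F x) * l2 (H x) := hF2.mul hH2
    rw [lintegral_const_mul _ hm]
    exact mul_le_mul_right (lintegral_mul_le_l2 hF2 hH2) _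
  refine (pow_le_pow_left₀ zero_le h1 2).trans_eq ?_
  rw [mul_pow, mul_pow, l2_sq, l2_sq]
  simp_rw [l2_sq]

/-- The constant in the trilinear estimate at a single scale. -/
def trilinearConst (n : ℕ) (p : Fin n → ℕ) : ℝ≥0∞ :=
  16 * rieszMass n * (ENNReal.ofReal ((2 * Real.pi) ^ n) * majorantMass n) *
    (30 * (1 + ∑ k, (p k : ℝ≥0∞) ^ 2) * majorantMass n) *
    (30 * ENNReal.ofReal ((2 * Real.pi) ^ n) * majorantMass n)

theorem trilinearConst_ne_top (hn : 1 ≤ n) (p : Fin n → ℕ) : trilinearConst n p ≠ ⊤ := by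
  have h1 := rieszMass_ne_top hn
  have h2 := majorantMass_ne_top (n := n)
  have h3 : (1 + ∑ k, (p k : ℝ≥0∞) ^ 2) ≠ ⊤ := by
    refine ENNReal.add_ne_top.2 ⟨by simp, ENNReal.sum_ne_top.2 fun k _ => ?_⟩
    exact ENNReal.pow_ne_top (ENNReal.natCast_ne_top _)
  unfold trilinearConst
  refine ENNReal.mul_ne_top (ENNReal.mul_ne_top (ENNReal.mul_ne_top ?_ ?_) ?_) ?_ <;>
    refine ENNReal.mul_ne_top ?_ ?_ <;>
    first | assumption | exact ENNReal.ofReal_ne_top | exact ENNReal.ofNat_ne_top |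
      exact ENNReal.mul_ne_top (by simp) (by first | assumption | exact ENNReal.ofReal_ne_top)

set_option maxHeartbeats 1000000 in
-- Cauchy–Schwarz in x after the frequency estimate. In the squared bound, D^n comes from the ball
-- and λ^{-n} from g, while the λ^{-n} of f cancels the λ^n of φ.
theorem lintegral_stft_trilinear_le (hn : 1 ≤ n) {p q r : Fin n → ℕ} (hp : ∀ k, 2 ≤ p k)
    (hq : ∀ k, 2 ≤ q k) (hr : ∀ k, 2 ≤ r k) {lam D : ℝ} (hl : 1 ≤ lam) (hD : lam ≤ D)
    (f g φ : 𝓢(RSpace n, ℂ)) :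
    (∫⁻ x, ∫⁻ ξ, ∫⁻ η, (scaleRegion n D).indicator (fun z => ‖stft p lam f x z.1‖ₑ *
      (‖stft q lam g x z.2‖ₑ * ‖stft r lam⁻¹ φ (z.1 + z.2) x‖ₑ)) (ξ, η)) ^ 2 ≤
      trilinearConst n p * ENNReal.ofReal (D ^ n * (lam ^ n)⁻¹) * eLpNorm g ⊤ volume ^ 2 *
        (kernelEnergy lam D (schwartzHat f) * kernelEnergy lam D φ) := by
  have hl0 : 0 < lam := by linarith
  have hW : Measurable (scaleWeight (n := n) lam D) := measurable_scaleWeight _ _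
  have hsf := (continuous_stft p lam f).measurable.enorm
  have hsg := (continuous_stft q lam g).measurable.enorm
  have hsφ := (continuous_stft r lam⁻¹ φ).measurable.enorm
  have hF : Measurable (Function.uncurry fun x ξ : RSpace n =>
      ‖stft p lam f x ξ‖ₑ * scaleWeight lam D ξ) := hsf.mul (hW.comp measurable_snd)
  have hH : Measurable (Function.uncurry fun x ζ : RSpace n =>
      ‖stft r lam⁻¹ φ ζ x‖ₑ * scaleWeight lam D ζ) :=
    (hsφ.comp measurable_swap).mul (hW.comp measurable_snd)
  have hFb := lintegral_stft_scaleWeight_le hp hl0 hD f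
  have hHb := lintegral_stft_scaleWeight_swap_le hr hl0 hD φ
  obtain ⟨a, ha⟩ : ∃ a, a = ENNReal.ofReal (D ^ n) * rieszMass n := ⟨_, rfl⟩
  obtain ⟨b, hb⟩ : ∃ b, b = ENNReal.ofReal ((2 * Real.pi) ^ n) *
    (ENNReal.ofReal ((lam ^ n)⁻¹) * majorantMass n * eLpNorm g ⊤ volume ^ 2) := ⟨_, rfl⟩
  have hG : ∀ x, l2 (fun η => ‖stft q lam g x η‖ₑ) ≤ b ^ (1 / 2 : ℝ) := fun x => by
    rw [hb]
    exact ENNReal.rpow_le_rpow (lintegral_enorm_sq_stft_le hq hl0 g x) (by norm_num)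
  have hpt : ∀ x, (∫⁻ ξ, ∫⁻ η, (scaleRegion n D).indicator (fun z => ‖stft p lam f x z.1‖ₑ *
      (‖stft q lam g x z.2‖ₑ * ‖stft r lam⁻¹ φ (z.1 + z.2) x‖ₑ)) (ξ, η)) ≤
      4 * a ^ (1 / 2 : ℝ) * b ^ (1 / 2 : ℝ) *
        (l2 (fun ξ => ‖stft p lam f x ξ‖ₑ * scaleWeight lam D ξ) *
          l2 (fun ζ => ‖stft r lam⁻¹ φ ζ x‖ₑ * scaleWeight lam D ζ)) := fun x => by
    have h1 : Measurable fun ξ => ‖stft p lam f x ξ‖ₑ :=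
      measurable_of_measurable_left (F := fun x ξ => ‖stft p lam f x ξ‖ₑ) hsf x
    have h2 : Measurable fun η => ‖stft q lam g x η‖ₑ :=
      measurable_of_measurable_left (F := fun x η => ‖stft q lam g x η‖ₑ) hsg x
    have h3 : Measurable fun ζ => ‖stft r lam⁻¹ φ ζ x‖ₑ :=
      measurable_of_measurable_right (F := fun ζ x => ‖stft r lam⁻¹ φ ζ x‖ₑ) hsφ x
    have h := lintegral_scaleRegion_le hn hl hD h1 h2 h3
    rw [← ha] at h
    refine h.trans ((mul_le_mul_right (mul_le_mul_left (mul_le_mul_right (hG x) _) _) _).trans_eq ?_)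
    ring
  have h1 := lintegral_sq_le_of_le_l2 hF hH _ hpt
  refine h1.trans ((mul_le_mul_right (mul_le_mul' hFb hHb) _).trans_eq ?_)
  rw [mul_pow, mul_pow, rpow_half_sq, rpow_half_sq, ha, hb,
    ENNReal.ofReal_mul (pow_nonneg (by linarith) n)]
  have hinv : ENNReal.ofReal ((lam ^ n)⁻¹) * ENNReal.ofReal (lam ^ n) = 1 := by
    rw [← ENNReal.ofReal_mul (by positivity), inv_mul_cancel₀ (by positivity), ENNReal.ofReal_one]
  have h16 : (4 : ℝ≥0∞) ^ 2 = 16 := by norm_num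
  rw [h16, trilinearConst]
  generalize ENNReal.ofReal (D ^ n) = d
  generalize ENNReal.ofReal ((2 * Real.pi) ^ n) = t
  generalize ENNReal.ofReal ((lam ^ n)⁻¹) = l at *
  generalize ENNReal.ofReal (lam ^ n) = l' at *
  generalize eLpNorm g ⊤ volume = e
  generalize kernelEnergy lam D (schwartzHat f) = k1
  generalize kernelEnergy lam D φ = k2
  generalize (1 + ∑ k, (p k : ℝ≥0∞) ^ 2) = w
  calc _ = (l * l') * (16 * rieszMass n * (t * majorantMass n) * (30 * w * majorantMass n) *
        (30 * t * majorantMass n) * (d * l) * e ^ 2 * (k1 * k2)) := by ring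
    _ = _ := by rw [hinv, one_mul]

/-! ### Scaled derivative bounds and amplitudes. -/

/-- The coordinate directions of `(x, ξ, η)`-space, dilated so that a symbol of type `(ρ, ρ)` has
bounded derivatives along them at the scale `lam`. -/
def frame (lam : ℝ) : Fin n ⊕ Fin n ⊕ Fin n → RSpace n × RSpace n × RSpace n :=
  Sum.elim (fun k => (lam⁻¹ • stdVec k, 0, 0))
    (Sum.elim (fun k => (0, lam • stdVec k, 0)) fun k => (0, 0, lam • stdVec k))

/-- All derivatives of `F` of order at most `N` along `frame lam` are bounded by `M` on `S`. -/
def DerivBound (lam : ℝ) (S : Set (RSpace n × RSpace n × RSpace n)) :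
    ℕ → (RSpace n × RSpace n × RSpace n → ℂ) → ℝ → Prop
  | 0, F, M => ∀ z ∈ S, ‖F z‖ ≤ M
  | N + 1, F, M => (∀ z ∈ S, ‖F z‖ ≤ M) ∧ ∀ i, DerivBound lam S N (dirDeriv (frame lam i) F) M

section

variable {lam : ℝ} {S : Set (RSpace n × RSpace n × RSpace n)}
  {F G : RSpace n × RSpace n × RSpace n → ℂ} {M M' : ℝ} {N N' : ℕ}

theorem DerivBound.bound (h : DerivBound lam S N F M) : ∀ z ∈ S, ‖F z‖ ≤ M := by
  cases N with
  | zero => exact h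
  | succ N => exact h.1

theorem DerivBound.mono_right (h : DerivBound lam S N F M) (hM : M ≤ M') :
    DerivBound lam S N F M' := by
  induction N generalizing F with
  | zero => exact fun z hz => (h z hz).trans hM
  | succ N ih => exact ⟨fun z hz => (h.1 z hz).trans hM, fun i => ih (h.2 i)⟩

theorem DerivBound.mono_order (h : DerivBound lam S N' F M) (hN : N ≤ N') :
    DerivBound lam S N F M := by
  induction N generalizing F N' with
  | zero => exact h.bound
  | succ N ih =>
    obtain ⟨K, rfl⟩ : ∃ K, N' = K + 1 := ⟨N' - 1, by omega⟩
    exact ⟨h.1, fun i => ih (h.2 i) (by omega)⟩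

theorem contDiff_dirDeriv {V : Type*} [NormedAddCommGroup V] [NormedSpace ℝ V] {F : V → ℂ}
    (hF : ContDiff ℝ ∞ F) (v : V) : ContDiff ℝ ∞ (dirDeriv v F) :=
  (hF.fderiv_right (m := ∞) (by simp)).clm_apply contDiff_const

theorem dirDeriv_add {V : Type*} [NormedAddCommGroup V] [NormedSpace ℝ V] {F G : V → ℂ}
    (hF : ContDiff ℝ ∞ F) (hG : ContDiff ℝ ∞ G) (v : V) :
    dirDeriv v (fun z => F z + G z) = fun z => dirDeriv v F z + dirDeriv v G z := by
  funext z
  simp only [dirDeriv]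
  rw [fderiv_fun_add ((hF.differentiable (by simp)) z) ((hG.differentiable (by simp)) z)]
  rfl

theorem dirDeriv_const_mul {V : Type*} [NormedAddCommGroup V] [NormedSpace ℝ V] {F : V → ℂ}
    (hF : ContDiff ℝ ∞ F) (c : ℂ) (v : V) :
    dirDeriv v (fun z => c * F z) = fun z => c * dirDeriv v F z := by
  funext z
  simp only [dirDeriv]
  rw [fderiv_const_mul ((hF.differentiable (by simp)) z)]
  rfl

theorem dirDeriv_mul {V : Type*} [NormedAddCommGroup V] [NormedSpace ℝ V] {F G : V → ℂ}
    (hF : ContDiff ℝ ∞ F) (hG : ContDiff ℝ ∞ G) (v : V) :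
    dirDeriv v (fun z => F z * G z) = fun z => dirDeriv v F z * G z + F z * dirDeriv v G z := by
  funext z
  simp only [dirDeriv]
  rw [fderiv_fun_mul ((hF.differentiable (by simp)) z) ((hG.differentiable (by simp)) z)]
  simp only [_root_.add_apply, _root_.smul_apply, smul_eq_mul]
  ring

theorem DerivBound.add (hF : ContDiff ℝ ∞ F) (hG : ContDiff ℝ ∞ G)
    (h : DerivBound lam S N F M) (h' : DerivBound lam S N G M') :
    DerivBound lam S N (fun z => F z + G z) (M + M') := by
  induction N generalizing F G with
  | zero => exact fun z hz => (norm_add_le _ _).trans (add_le_add (h z hz) (h' z hz))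
  | succ N ih =>
    refine ⟨fun z hz => (norm_add_le _ _).trans (add_le_add (h.1 z hz) (h'.1 z hz)), fun i => ?_⟩
    rw [dirDeriv_add hF hG]
    exact ih (contDiff_dirDeriv hF _) (contDiff_dirDeriv hG _) (h.2 i) (h'.2 i)

theorem DerivBound.const_mul (hF : ContDiff ℝ ∞ F) (h : DerivBound lam S N F M) (c : ℂ) :
    DerivBound lam S N (fun z => c * F z) (‖c‖ * M) := by
  induction N generalizing F with
  | zero =>
    intro z hz
    rw [norm_mul]
    exact mul_le_mul_of_nonneg_left (h z hz) (norm_nonneg _)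
  | succ N ih =>
    refine ⟨fun z hz => ?_, fun i => ?_⟩
    · rw [norm_mul]
      exact mul_le_mul_of_nonneg_left (h.1 z hz) (norm_nonneg _)
    · rw [dirDeriv_const_mul hF]
      exact ih (contDiff_dirDeriv hF _) (h.2 i)

theorem DerivBound.mul (hF : ContDiff ℝ ∞ F) (hG : ContDiff ℝ ∞ G) (hM : 0 ≤ M) (hM' : 0 ≤ M')
    (h : DerivBound lam S N F M) (h' : DerivBound lam S N G M') :
    DerivBound lam S N (fun z => F z * G z) (2 ^ N * (M * M')) := by
  have hb : ∀ N, (∀ z ∈ S, ‖F z‖ ≤ M) → (∀ z ∈ S, ‖G z‖ ≤ M') → ∀ z ∈ S,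
      ‖F z * G z‖ ≤ 2 ^ N * (M * M') := by
    intro N h h' z hz
    rw [norm_mul]
    refine (mul_le_mul (h z hz) (h' z hz) (norm_nonneg _) hM).trans ?_
    exact le_mul_of_one_le_left (by positivity) (one_le_pow₀ (by norm_num))
  induction N generalizing F G with
  | zero => exact hb 0 h h'
  | succ N ih =>
    refine ⟨hb _ h.1 h'.1, fun i => ?_⟩
    -- The two Leibniz terms account for one factor 2 per derivative.
    rw [dirDeriv_mul hF hG, pow_succ, mul_comm _ (2 : ℝ), mul_assoc, two_mul]
    have hF' := contDiff_dirDeriv hF (frame lam i)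
    have hG' := contDiff_dirDeriv hG (frame lam i)
    have hb' : ∀ {F G : RSpace n × RSpace n × RSpace n → ℂ} (N : ℕ), (∀ z ∈ S, ‖F z‖ ≤ M) →
        (∀ z ∈ S, ‖G z‖ ≤ M') → ∀ z ∈ S, ‖F z * G z‖ ≤ 2 ^ N * (M * M') := by
      intro F G N h h' z hz
      rw [norm_mul]
      refine (mul_le_mul (h z hz) (h' z hz) (norm_nonneg _) hM).trans ?_
      exact le_mul_of_one_le_left (by positivity) (one_le_pow₀ (by norm_num))
    exact DerivBound.add (hF'.mul hG) (hF.mul hG')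
      (ih hF' hG (h.2 i) (h'.mono_order (Nat.le_succ N)) (fun N => hb' N))
      (ih hF hG' (h.mono_order (Nat.le_succ N)) (h'.2 i) (fun N => hb' N))

end

/-- Smooth compactly supported amplitudes at the scale `(lam, D)`. -/
structure Amplitude (lam D : ℝ) (N : ℕ) (M : ℝ) (b : RSpace n × RSpace n × RSpace n → ℂ) :
    Prop where
  contDiff : ContDiff ℝ ∞ b
  hasCompactSupport : HasCompactSupport b
  eq_zero : ∀ z, z.2 ∉ scaleRegion n D → b z = 0
  derivBound : DerivBound lam {z | z.2 ∈ scaleRegion n D} N b M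

theorem Amplitude.mono {lam D M : ℝ} {N N' : ℕ} {b : RSpace n × RSpace n × RSpace n → ℂ}
    (h : Amplitude lam D N' M b) (hN : N ≤ N') : Amplitude lam D N M b :=
  ⟨h.1, h.2, h.3, h.4.mono_order hN⟩

/-- Integration by parts applies 1-∂ to the amplitude, at the price of one order and a factor 2. The
support condition survives because the region is closed: off it, b vanishes on a neighbourhood. -/
theorem Amplitude.sub_dirDeriv {lam D M : ℝ} {N : ℕ} {b : RSpace n × RSpace n × RSpace n → ℂ}
    (h : Amplitude lam D (N + 1) M b) (i : Fin n ⊕ Fin n ⊕ Fin n) :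
    Amplitude lam D N (2 * M) (fun z => b z - dirDeriv (frame lam i) b z) := by
  have hd := contDiff_dirDeriv h.contDiff (frame lam i)
  refine ⟨h.contDiff.sub hd, ?_, fun z hz => ?_, ?_⟩
  · exact h.hasCompactSupport.sub (h.hasCompactSupport.fderiv_apply ℝ (frame lam i))
  · have hcl : IsClosed {z : RSpace n × RSpace n × RSpace n | z.2 ∈ scaleRegion n D} :=
      (isClosed_scaleRegion D).preimage continuous_snd
    have hev : b =ᶠ[nhds z] fun _ => 0 := by
      filter_upwards [hcl.isOpen_compl.mem_nhds hz] with w hw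
      exact h.eq_zero w hw
    simp only [dirDeriv]
    rw [h.eq_zero z hz, hev.fderiv_eq]
    simp
  · have h1 := (h.derivBound.mono_order (Nat.le_succ N)).add h.contDiff
      (contDiff_const.mul hd) ((h.derivBound.2 i).const_mul hd (-1))
    simpa [← sub_eq_add_neg, two_mul] using h1

/-! ### Integration by parts in the trilinear form. -/

/-- The kernel of the localised trilinear form. -/
def triKernel (p q r : Fin n → ℕ) (lam : ℝ) (f g φ : RSpace n → ℂ)
    (z : RSpace n × RSpace n × RSpace n) : ℂ :=
  (Complex.exp (Complex.I * ((inner ℝ z.1 z.2.1 : ℝ) : ℂ)) * stft p lam f z.1 z.2.1) *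
    (Complex.exp (Complex.I * ((inner ℝ z.1 z.2.2 : ℝ) : ℂ)) * stft q lam g z.1 z.2.2) *
      stft r lam⁻¹ φ (z.2.1 + z.2.2) z.1

/-- The localised trilinear form with amplitude `b`. -/
def triForm (p q r : Fin n → ℕ) (lam : ℝ) (f g φ : RSpace n → ℂ)
    (b : RSpace n × RSpace n × RSpace n → ℂ) : ℂ :=
  ∫ z, b z * triKernel p q r lam f g φ z

theorem continuous_triKernel (p q r : Fin n → ℕ) (lam : ℝ) (f g φ : 𝓢(RSpace n, ℂ)) :
    Continuous (triKernel p q r lam f g φ) := by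
  have e1 : Continuous fun z : RSpace n × RSpace n × RSpace n => (z.1, z.2.1) := by fun_prop
  have e2 : Continuous fun z : RSpace n × RSpace n × RSpace n => (z.1, z.2.2) := by fun_prop
  have e3 : Continuous fun z : RSpace n × RSpace n × RSpace n => (z.2.1 + z.2.2, z.1) := by
    fun_prop
  have h1 := (continuous_stft p lam f).comp e1
  have h2 := (continuous_stft q lam g).comp e2
  have h3 := (continuous_stft r lam⁻¹ φ).comp e3
  simp only [Function.comp_def] at h1 h2 h3
  unfold triKernel
  fun_prop

theorem integrable_mul_of_hasCompactSupport {b Φ : RSpace n × RSpace n × RSpace n → ℂ}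
    (hb : Continuous b) (hbs : HasCompactSupport b) (hΦ : Continuous Φ) :
    Integrable fun z => b z * Φ z :=
  (hb.mul hΦ).integrable_of_hasCompactSupport hbs.mul_right

theorem integral_mul_hasLineDerivAt {b Φ Φ' : RSpace n × RSpace n × RSpace n → ℂ}
    {v : RSpace n × RSpace n × RSpace n} (hb : ContDiff ℝ ∞ b) (hbs : HasCompactSupport b)
    (hΦ : Continuous Φ) (hΦ' : Continuous Φ') (h : ∀ z, HasLineDerivAt ℝ Φ (Φ' z) z v) :
    ∫ z, b z * Φ' z = -∫ z, dirDeriv v b z * Φ z := by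
  have h2 : ((volume : Measure (RSpace n)).prod (volume : Measure (RSpace n))).IsAddHaarMeasure :=
    Measure.prod.instIsAddHaarMeasure _ _
  have : ((volume : Measure (RSpace n)).prod ((volume : Measure (RSpace n)).prod
    (volume : Measure (RSpace n)))).IsAddHaarMeasure :=
    Measure.prod.instIsAddHaarMeasure _ _
  have : (volume : Measure (RSpace n × RSpace n × RSpace n)).IsAddHaarMeasure := this
  have hd := (contDiff_dirDeriv hb v).continuous
  have key := integral_bilinear_hasLineDerivAt_right_eq_neg_left_of_integrable
    (μ := (volume : Measure (RSpace n × RSpace n × RSpace n))) (B := ContinuousLinearMap.mul ℝ ℂ)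
    (v := v) (f := b) (f' := dirDeriv v b) (g := Φ) (g' := Φ')
    (integrable_mul_of_hasCompactSupport hd (hbs.fderiv_apply ℝ v) hΦ)
    (integrable_mul_of_hasCompactSupport hb.continuous hbs hΦ')
    (integrable_mul_of_hasCompactSupport hb.continuous hbs hΦ)
    (fun z _ => ((hb.differentiable (by simp)) z).hasFDerivAt.hasLineDerivAt v) (fun z _ => h z)
  simpa using key

/-- With r = 0 the third factor is φ̂(x), so a ξ-derivative meets only the factor of f. -/
theorem hasLineDerivAt_triKernel_xi (p q : Fin n → ℕ) (k : Fin n) (lam : ℝ)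
    (f g φ : 𝓢(RSpace n, ℂ)) (z : RSpace n × RSpace n × RSpace n) :
    HasLineDerivAt ℝ (triKernel (p + Pi.single k 1) q 0 lam f g φ)
      (triKernel p q 0 lam f g φ z - triKernel (p + Pi.single k 1) q 0 lam f g φ z) z
      (frame lam (Sum.inr (Sum.inl k))) := by
  unfold HasLineDerivAt
  have h := ((hasDerivAt_exp_mul_stft p k lam f z.1 z.2.1).mul_const
    (Complex.exp (Complex.I * ((inner ℝ z.1 z.2.2 : ℝ) : ℂ)) * stft q lam g z.1 z.2.2)).mul_const
      (fourierHat φ z.1)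
  refine (h.congr_of_eventuallyEq (Filter.Eventually.of_forall fun s => ?_)).congr_deriv ?_
  · simp [triKernel, frame, stft_zero]
  · simp only [triKernel, stft_zero]
    ring

theorem hasLineDerivAt_triKernel_eta (p q : Fin n → ℕ) (k : Fin n) (lam : ℝ)
    (f g φ : 𝓢(RSpace n, ℂ)) (z : RSpace n × RSpace n × RSpace n) :
    HasLineDerivAt ℝ (triKernel p (q + Pi.single k 1) 0 lam f g φ)
      (triKernel p q 0 lam f g φ z - triKernel p (q + Pi.single k 1) 0 lam f g φ z) z
      (frame lam (Sum.inr (Sum.inr k))) := by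
  unfold HasLineDerivAt
  have h := ((hasDerivAt_exp_mul_stft q k lam g z.1 z.2.2).const_mul
    (Complex.exp (Complex.I * ((inner ℝ z.1 z.2.1 : ℝ) : ℂ)) * stft p lam f z.1 z.2.1)).mul_const
      (fourierHat φ z.1)
  refine (h.congr_of_eventuallyEq (Filter.Eventually.of_forall fun s => ?_)).congr_deriv ?_
  · simp [triKernel, frame, stft_zero]
  · simp only [triKernel, stft_zero]
    ring

/-- The whole phase is attached to the factor of φ, the grouping suited to differentiation in x. -/
theorem triKernel_eq (p q r : Fin n → ℕ) (lam : ℝ) (f g φ : RSpace n → ℂ)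
    (z : RSpace n × RSpace n × RSpace n) :
    triKernel p q r lam f g φ z = stft p lam f z.1 z.2.1 * stft q lam g z.1 z.2.2 *
      (Complex.exp (Complex.I * ((inner ℝ (z.2.1 + z.2.2) z.1 : ℝ) : ℂ)) *
        stft r lam⁻¹ φ (z.2.1 + z.2.2) z.1) := by
  rw [inner_add_left, real_inner_comm z.1, real_inner_comm z.1, Complex.ofReal_add, mul_add,
    Complex.exp_add, triKernel]
  ring

/-- The phase and φ reproduce the one-factor identity with scale λ⁻¹; the last two terms come from
x-derivatives of the windows of f and g. -/
theorem hasLineDerivAt_triKernel_x (p q r : Fin n → ℕ) (k : Fin n) {lam : ℝ} (hl : lam ≠ 0)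
    (f g φ : 𝓢(RSpace n, ℂ)) (z : RSpace n × RSpace n × RSpace n) :
    HasLineDerivAt ℝ (triKernel p q (r + Pi.single k 1) lam f g φ)
      (triKernel p q r lam f g φ z - triKernel p q (r + Pi.single k 1) lam f g φ z
        - Complex.I * p k * triKernel (p + Pi.single k 1) q (r + Pi.single k 1) lam f g φ z
        - Complex.I * q k * triKernel p (q + Pi.single k 1) (r + Pi.single k 1) lam f g φ z) z
      (frame lam (Sum.inl k)) := by
  unfold HasLineDerivAt
  have h := ((hasDerivAt_stft p k hl f z.1 z.2.1).fun_mul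
    (hasDerivAt_stft q k hl g z.1 z.2.2)).fun_mul
      (hasDerivAt_exp_mul_stft r k lam⁻¹ φ (z.2.1 + z.2.2) z.1)
  refine (h.congr_of_eventuallyEq (Filter.Eventually.of_forall fun s => ?_)).congr_deriv ?_
  · simp [triKernel_eq, frame]
  · simp only [triKernel_eq, zero_smul, add_zero]
    ring

section

variable {lam D M : ℝ} {N : ℕ} {b : RSpace n × RSpace n × RSpace n → ℂ}

/-- The kernel is 1+∂ of the kernel with the stronger window, and the adjoint 1-∂ falls on the
amplitude. -/
theorem triForm_eq_xi (p q : Fin n → ℕ) (k : Fin n) (f g φ : 𝓢(RSpace n, ℂ))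
    (hb : ContDiff ℝ ∞ b) (hbs : HasCompactSupport b) :
    triForm p q 0 lam f g φ b = triForm (p + Pi.single k 1) q 0 lam f g φ
      (fun z => b z - dirDeriv (frame lam (Sum.inr (Sum.inl k))) b z) := by
  set v := frame (n := n) lam (Sum.inr (Sum.inl k))
  have hc1 := continuous_triKernel p q 0 lam f g φ
  have hc2 := continuous_triKernel (p + Pi.single k 1) q 0 lam f g φ
  have key := integral_mul_hasLineDerivAt hb hbs hc2 (hc1.sub hc2)
    (hasLineDerivAt_triKernel_xi p q k lam f g φ)
  have i1 := integrable_mul_of_hasCompactSupport hb.continuous hbs hc1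
  have i2 := integrable_mul_of_hasCompactSupport hb.continuous hbs hc2
  have i3 := integrable_mul_of_hasCompactSupport (contDiff_dirDeriv hb v).continuous
    (hbs.fderiv_apply ℝ v) hc2
  simp only [Pi.sub_apply, mul_sub] at key
  rw [integral_sub i1 i2] at key
  unfold triForm
  beta_reduce
  simp_rw [sub_mul]
  rw [integral_sub i2 i3]
  linear_combination key

theorem triForm_eq_eta (p q : Fin n → ℕ) (k : Fin n) (f g φ : 𝓢(RSpace n, ℂ))
    (hb : ContDiff ℝ ∞ b) (hbs : HasCompactSupport b) :
    triForm p q 0 lam f g φ b = triForm p (q + Pi.single k 1) 0 lam f g φ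
      (fun z => b z - dirDeriv (frame lam (Sum.inr (Sum.inr k))) b z) := by
  set v := frame (n := n) lam (Sum.inr (Sum.inr k))
  have hc1 := continuous_triKernel p q 0 lam f g φ
  have hc2 := continuous_triKernel p (q + Pi.single k 1) 0 lam f g φ
  have key := integral_mul_hasLineDerivAt hb hbs hc2 (hc1.sub hc2)
    (hasLineDerivAt_triKernel_eta p q k lam f g φ)
  have i1 := integrable_mul_of_hasCompactSupport hb.continuous hbs hc1
  have i2 := integrable_mul_of_hasCompactSupport hb.continuous hbs hc2
  have i3 := integrable_mul_of_hasCompactSupport (contDiff_dirDeriv hb v).continuous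
    (hbs.fderiv_apply ℝ v) hc2
  simp only [Pi.sub_apply, mul_sub] at key
  rw [integral_sub i1 i2] at key
  unfold triForm
  beta_reduce
  simp_rw [sub_mul]
  rw [integral_sub i2 i3]
  linear_combination key

theorem triForm_eq_x (p q r : Fin n → ℕ) (k : Fin n) (hl : lam ≠ 0) (f g φ : 𝓢(RSpace n, ℂ))
    (hb : ContDiff ℝ ∞ b) (hbs : HasCompactSupport b) :
    triForm p q r lam f g φ b = triForm p q (r + Pi.single k 1) lam f g φ
      (fun z => b z - dirDeriv (frame lam (Sum.inl k)) b z) +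
      Complex.I * p k * triForm (p + Pi.single k 1) q (r + Pi.single k 1) lam f g φ b +
      Complex.I * q k * triForm p (q + Pi.single k 1) (r + Pi.single k 1) lam f g φ b := by
  set v := frame (n := n) lam (Sum.inl k)
  have hc1 := continuous_triKernel p q r lam f g φ
  have hc2 := continuous_triKernel p q (r + Pi.single k 1) lam f g φ
  have hc3 := continuous_triKernel (p + Pi.single k 1) q (r + Pi.single k 1) lam f g φ
  have hc4 := continuous_triKernel p (q + Pi.single k 1) (r + Pi.single k 1) lam f g φ
  have key := integral_mul_hasLineDerivAt hb hbs hc2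
    (((hc1.sub hc2).sub (continuous_const.mul hc3)).sub (continuous_const.mul hc4))
    (hasLineDerivAt_triKernel_x p q r k hl f g φ)
  have i1 := integrable_mul_of_hasCompactSupport hb.continuous hbs hc1
  have i2 := integrable_mul_of_hasCompactSupport hb.continuous hbs hc2
  have i3 := (integrable_mul_of_hasCompactSupport hb.continuous hbs hc3).const_mul
    (Complex.I * p k)
  have i4 := (integrable_mul_of_hasCompactSupport hb.continuous hbs hc4).const_mul
    (Complex.I * q k)
  have i5 := integrable_mul_of_hasCompactSupport (contDiff_dirDeriv hb v).continuous
    (hbs.fderiv_apply ℝ v) hc2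
  simp only [Pi.sub_apply, Pi.mul_apply, mul_sub, mul_left_comm (b _)] at key
  have i12 : Integrable fun z => b z * triKernel p q r lam f g φ z -
      b z * triKernel p q (r + Pi.single k 1) lam f g φ z := i1.sub i2
  have i123 : Integrable fun z => b z * triKernel p q r lam f g φ z -
      b z * triKernel p q (r + Pi.single k 1) lam f g φ z - Complex.I * p k *
        (b z * triKernel (p + Pi.single k 1) q (r + Pi.single k 1) lam f g φ z) := i12.sub i3
  rw [integral_sub i123 i4, integral_sub i12 i3, integral_sub i1 i2,
    integral_const_mul, integral_const_mul] at key
  unfold triForm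
  beta_reduce
  simp_rw [sub_mul]
  rw [integral_sub i2 i5]
  linear_combination key

end

/-! ### The single-scale estimate for the original form. -/

/-- The quantity that controls the trilinear forms at scale `(lam, D)`. -/
def scaleBound (lam D : ℝ) (f g φ : 𝓢(RSpace n, ℂ)) : ℝ≥0∞ :=
  (ENNReal.ofReal (D ^ n * (lam ^ n)⁻¹) * eLpNorm g ⊤ volume ^ 2 *
    (kernelEnergy lam D (schwartzHat f) * kernelEnergy lam D φ)) ^ (1 / 2 : ℝ)

/-- Once every window decays, oscillation is no longer needed and absolute values are taken. -/
theorem enorm_triForm_le_of_two_le (hn : 1 ≤ n) {p q r : Fin n → ℕ} (hp : ∀ k, 2 ≤ p k)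
    (hq : ∀ k, 2 ≤ q k) (hr : ∀ k, 2 ≤ r k) {lam D M : ℝ} (hl : 1 ≤ lam) (hD : lam ≤ D)
    (f g φ : 𝓢(RSpace n, ℂ)) {b : RSpace n × RSpace n × RSpace n → ℂ}
    (hb : Amplitude lam D 0 M b) :
    ‖triForm p q r lam f g φ b‖ₑ ≤
      trilinearConst n p ^ (1 / 2 : ℝ) * ENNReal.ofReal M * scaleBound lam D f g φ := by
  have hS : MeasurableSet (scaleRegion n D) := (isClosed_scaleRegion D).measurableSet
  have hsf := (continuous_stft p lam f).measurable.enorm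
  have hsg := (continuous_stft q lam g).measurable.enorm
  have hsφ := (continuous_stft r lam⁻¹ φ).measurable.enorm
  have e1 : Measurable fun z : RSpace n × RSpace n × RSpace n => (z.1, z.2.1) := by fun_prop
  have e2 : Measurable fun z : RSpace n × RSpace n × RSpace n => (z.1, z.2.2) := by fun_prop
  have e3 : Measurable fun z : RSpace n × RSpace n × RSpace n => (z.2.1 + z.2.2, z.1) := by
    fun_prop
  obtain ⟨Φ, hΦ⟩ : ∃ Φ : RSpace n × RSpace n × RSpace n → ℝ≥0∞, Φ = fun z =>
    (scaleRegion n D).indicator (fun w => ‖stft p lam f z.1 w.1‖ₑ *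
      (‖stft q lam g z.1 w.2‖ₑ * ‖stft r lam⁻¹ φ (w.1 + w.2) z.1‖ₑ)) z.2 := ⟨_, rfl⟩
  have hΦm : Measurable Φ := by
    have h1 := hsf.comp e1
    have h2 := hsg.comp e2
    have h3 := hsφ.comp e3
    simp only [Function.comp_def] at h1 h2 h3
    have h4 := (h1.mul (h2.mul h3)).indicator (measurable_snd hS)
    rw [hΦ]
    exact h4
  have hint : ∫⁻ z, Φ z = ∫⁻ x, ∫⁻ ξ, ∫⁻ η, Φ (x, ξ, η) := by
    rw [Measure.volume_eq_prod, lintegral_prod _ hΦm.aemeasurable]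
    refine lintegral_congr fun x => ?_
    have hx := hΦm.comp (measurable_prodMk_left (x := x))
    simp only [Function.comp_def] at hx
    rw [Measure.volume_eq_prod, lintegral_prod _ hx.aemeasurable]
  have hmain := lintegral_stft_trilinear_le hn hp hq hr hl hD f g φ
  have h1 : ∫⁻ z, Φ z ≤ trilinearConst n p ^ (1 / 2 : ℝ) * scaleBound lam D f g φ := by
    refine le_of_sq_le_sq_ennreal ?_
    rw [hint, hΦ, mul_pow, scaleBound, rpow_half_sq, rpow_half_sq]
    refine hmain.trans_eq ?_
    ring
  calc ‖triForm p q r lam f g φ b‖ₑ ≤ ∫⁻ z, ‖b z * triKernel p q r lam f g φ z‖ₑ :=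
        enorm_integral_le_lintegral_enorm _
    _ ≤ ∫⁻ z, ENNReal.ofReal M * Φ z := by
        refine lintegral_mono fun z => ?_
        rw [hΦ]
        by_cases hz : z.2 ∈ scaleRegion n D
        · simp only
          rw [Set.indicator_of_mem hz, enorm_mul]
          refine mul_le_mul' ?_ (le_of_eq ?_)
          · rw [← ofReal_norm]
            exact ENNReal.ofReal_le_ofReal (hb.derivBound.bound z hz)
          · unfold triKernel
            simp only [enorm_mul]
            rw [← enorm_norm (Complex.exp _), norm_exp_I_mul_ofReal',
              ← enorm_norm (Complex.exp _), norm_exp_I_mul_ofReal', enorm_one, one_mul, one_mul,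
              mul_assoc]
        · rw [hb.eq_zero z hz]
          simp
    _ = ENNReal.ofReal M * ∫⁻ z, Φ z := lintegral_const_mul _ hΦm
    _ ≤ ENNReal.ofReal M * (trilinearConst n p ^ (1 / 2 : ℝ) * scaleBound lam D f g φ) :=
        mul_le_mul_right h1 _
    _ = _ := by ring

/-- The trilinear form with windows `p`, `q`, `r` satisfies the single-scale estimate, uniformly in
the scale. -/
def TriFormBounded (p q r : Fin n → ℕ) : Prop :=
  ∃ (N : ℕ) (C : ℝ≥0), ∀ (lam D M : ℝ) (f g φ : 𝓢(RSpace n, ℂ))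
    (b : RSpace n × RSpace n × RSpace n → ℂ), 1 ≤ lam → lam ≤ D → Amplitude lam D N M b →
      ‖triForm p q r lam f g φ b‖ₑ ≤ C * ENNReal.ofReal M * scaleBound lam D f g φ

/-- Induction on the deficiency Σ(2-p_k), with truncated subtraction: raising a coordinate below 2
lowers it, and it vanishes exactly when all coordinates are at least 2. -/
theorem multiindex_induction {P : (Fin n → ℕ) → Prop} (h2 : ∀ p, (∀ k, 2 ≤ p k) → P p)
    (hstep : ∀ p k, P (p + Pi.single k 1) → P p) (p : Fin n → ℕ) : P p := by
  induction h : ∑ k, (2 - p k) using Nat.strong_induction_on generalizing p with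
  | _ d ih =>
    by_cases hp : ∀ k, 2 ≤ p k
    · exact h2 p hp
    · push Not at hp
      obtain ⟨k, hk⟩ := hp
      refine hstep p k (ih _ ?_ _ rfl)
      rw [← h]
      refine Finset.sum_lt_sum (fun j _ => ?_) ⟨k, Finset.mem_univ k, ?_⟩
      · simp only [Pi.add_apply]
        omega
      · simp only [Pi.add_apply, Pi.single_eq_same]
        omega

theorem ofReal_two_mul (M : ℝ) : ENNReal.ofReal (2 * M) = 2 * ENNReal.ofReal M := by
  rw [ENNReal.ofReal_mul (by norm_num), ENNReal.ofReal_ofNat]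

/-- The error terms of integration by parts in x raise p or q, so the induction on r quantifies over
both; their lower bounds persist. -/
theorem triFormBounded_x (hn : 1 ≤ n) (r p q : Fin n → ℕ) (hp : ∀ k, 2 ≤ p k)
    (hq : ∀ k, 2 ≤ q k) : TriFormBounded p q r := by
  revert p q
  refine multiindex_induction (P := fun r => ∀ p q : Fin n → ℕ, (∀ k, 2 ≤ p k) →
    (∀ k, 2 ≤ q k) → TriFormBounded p q r) (fun r hr p q hp hq => ?_)
    (fun r k ih p q hp hq => ?_) r
  · have hC : trilinearConst n p ^ (1 / 2 : ℝ) ≠ ⊤ :=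
      ENNReal.rpow_ne_top_of_nonneg (by norm_num) (trilinearConst_ne_top hn p)
    refine ⟨0, (trilinearConst n p ^ (1 / 2 : ℝ)).toNNReal, fun lam D M f g φ b hl hD hb => ?_⟩
    rw [ENNReal.coe_toNNReal hC]
    exact enorm_triForm_le_of_two_le hn hp hq hr hl hD f g φ hb
  · obtain ⟨N1, C1, h1⟩ := ih p q hp hq
    obtain ⟨N2, C2, h2⟩ := ih _ q (two_le_add_single hp k) hq
    obtain ⟨N3, C3, h3⟩ := ih p _ hp (two_le_add_single hq k)
    -- The extra order is the derivative spent on the first term, and 2 * C1 reflects its doubled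
    -- amplitude bound.
    refine ⟨N1 + N2 + N3 + 1, 2 * C1 + p k * C2 + q k * C3, fun lam D M f g φ b hl hD hb => ?_⟩
    have e1 := h1 lam D (2 * M) f g φ _ hl hD
      ((hb.mono (N := N1 + 1) (by omega)).sub_dirDeriv (Sum.inl k))
    have e2 := h2 lam D M f g φ b hl hD (hb.mono (by omega))
    have e3 := h3 lam D M f g φ b hl hD (hb.mono (by omega))
    rw [triForm_eq_x p q r k (by linarith : lam ≠ 0) f g φ hb.contDiff hb.hasCompactSupport]
    refine (enorm_add_le _ _).trans ((add_le_add (enorm_add_le _ _) le_rfl).trans ?_)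
    rw [enorm_mul, enorm_mul, enorm_mul, enorm_mul]
    have hI : ‖Complex.I‖ₑ = 1 := by rw [← enorm_norm, Complex.norm_I, enorm_one]
    have hN : ∀ m : ℕ, ‖(m : ℂ)‖ₑ = m := fun m => by
      rw [← ofReal_norm, Complex.norm_natCast, ENNReal.ofReal_natCast]
    rw [hI, hN, hN, one_mul, one_mul]
    refine (add_le_add (add_le_add e1 (mul_le_mul_right e2 _)) (mul_le_mul_right e3 _)).trans_eq ?_
    rw [ofReal_two_mul]
    push_cast
    ring

/-- The windows on f and g are created while r = 0, before φ acquires a window: afterwards the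
factor of φ would depend on ξ+η and the ξ- and η-identities would have error terms. -/
theorem triFormBounded_zero (hn : 1 ≤ n) : TriFormBounded (0 : Fin n → ℕ) 0 0 := by
  refine multiindex_induction (P := fun q => TriFormBounded 0 q 0) (fun q hq => ?_)
    (fun q k ih => ?_) 0
  · refine multiindex_induction (P := fun p => TriFormBounded p q 0)
      (fun p hp => triFormBounded_x hn 0 p q hp hq) (fun p k ih => ?_) 0
    obtain ⟨N, C, h⟩ := ih
    refine ⟨N + 1, 2 * C, fun lam D M f g φ b hl hD hb => ?_⟩
    rw [triForm_eq_xi p q k f g φ hb.contDiff hb.hasCompactSupport]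
    refine (h lam D (2 * M) f g φ _ hl hD (hb.sub_dirDeriv _)).trans_eq ?_
    rw [ofReal_two_mul]
    push_cast
    ring
  · obtain ⟨N, C, h⟩ := ih
    refine ⟨N + 1, 2 * C, fun lam D M f g φ b hl hD hb => ?_⟩
    rw [triForm_eq_eta 0 q k f g φ hb.contDiff hb.hasCompactSupport]
    refine (h lam D (2 * M) f g φ _ hl hD (hb.sub_dirDeriv _)).trans_eq ?_
    rw [ofReal_two_mul]
    push_cast
    ring

/-! ### Mixed derivatives and bounds for symbols in BS^m_{ρ,ρ}. -/

section

variable {V : Type*} [NormedAddCommGroup V] [NormedSpace ℝ V] {F : V → ℂ}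

theorem dirDeriv_smul (c : ℝ) (v : V) (F : V → ℂ) :
    dirDeriv (c • v) F = fun z => (c : ℂ) * dirDeriv v F z := by
  funext z
  simp [dirDeriv]

theorem dirDeriv_comm (hF : ContDiff ℝ ∞ F) (u v : V) :
    dirDeriv u (dirDeriv v F) = dirDeriv v (dirDeriv u F) := by
  funext z
  have hd : DifferentiableAt ℝ (fderiv ℝ F) z :=
    ((hF.fderiv_right (m := ∞) (by simp)).differentiable (by simp)) z
  have hs : IsSymmSndFDerivAt ℝ F z := hF.contDiffAt.isSymmSndFDerivAt
    (by simpa using WithTop.coe_le_coe.2 (le_top (a := (2 : ℕ∞))))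
  have key : ∀ u v : V, dirDeriv u (dirDeriv v F) z = fderiv ℝ (fderiv ℝ F) z u v := by
    intro u v
    change fderiv ℝ (fun y => fderiv ℝ F y v) z u = _
    rw [fderiv_clm_apply hd (differentiableAt_const v)]
    simp
  rw [key, key]
  exact hs u v

theorem contDiff_iterate_dirDeriv (hF : ContDiff ℝ ∞ F) (v : V) (m : ℕ) :
    ContDiff ℝ ∞ ((dirDeriv v)^[m] F) := by
  induction m with
  | zero => exact hF
  | succ m ih =>
    rw [Function.iterate_succ_apply']
    exact contDiff_dirDeriv ih v

theorem dirDeriv_iterate_comm (hF : ContDiff ℝ ∞ F) (u v : V) (m : ℕ) :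
    dirDeriv u ((dirDeriv v)^[m] F) = (dirDeriv v)^[m] (dirDeriv u F) := by
  induction m with
  | zero => rfl
  | succ m ih =>
    rw [Function.iterate_succ_apply', Function.iterate_succ_apply',
      dirDeriv_comm (contDiff_iterate_dirDeriv hF v m), ih]

theorem contDiff_foldr_dirDeriv (hF : ContDiff ℝ ∞ F) (e : Fin n → V) (α : Fin n → ℕ)
    (l : List (Fin n)) : ContDiff ℝ ∞ (l.foldr (fun i H => (dirDeriv (e i))^[α i] H) F) := by
  induction l with
  | nil => exact hF
  | cons i l ih => exact contDiff_iterate_dirDeriv ih _ _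

theorem dirDeriv_foldr_comm (hF : ContDiff ℝ ∞ F) (e : Fin n → V) (α : Fin n → ℕ) (u : V)
    (l : List (Fin n)) :
    dirDeriv u (l.foldr (fun i H => (dirDeriv (e i))^[α i] H) F) =
      l.foldr (fun i H => (dirDeriv (e i))^[α i] H) (dirDeriv u F) := by
  induction l with
  | nil => rfl
  | cons i l ih =>
    simp only [List.foldr_cons]
    rw [dirDeriv_iterate_comm (contDiff_foldr_dirDeriv hF e α l), ih]

theorem foldr_dirDeriv_add_single_of_notMem (e : Fin n → V) (α : Fin n → ℕ) (k : Fin n)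
    (F : V → ℂ) (l : List (Fin n)) (hk : k ∉ l) :
    l.foldr (fun i H => (dirDeriv (e i))^[(α + Pi.single k 1 : Fin n → ℕ) i] H) F =
      l.foldr (fun i H => (dirDeriv (e i))^[α i] H) F := by
  induction l with
  | nil => rfl
  | cons i l ih =>
    simp only [List.mem_cons, not_or] at hk
    simp only [List.foldr_cons]
    rw [ih hk.2, Pi.add_apply, Pi.single_eq_of_ne (Ne.symm hk.1), add_zero]

theorem dirDeriv_foldr_eq_add_single (hF : ContDiff ℝ ∞ F) (e : Fin n → V) (α : Fin n → ℕ)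
    (k : Fin n) (l : List (Fin n)) (hl : l.Nodup) (hk : k ∈ l) :
    dirDeriv (e k) (l.foldr (fun i H => (dirDeriv (e i))^[α i] H) F) =
      l.foldr (fun i H => (dirDeriv (e i))^[(α + Pi.single k 1 : Fin n → ℕ) i] H) F := by
  induction l with
  | nil => simp at hk
  | cons i l ih =>
    rw [List.nodup_cons] at hl
    simp only [List.foldr_cons]
    by_cases hik : i = k
    · subst hik
      rw [foldr_dirDeriv_add_single_of_notMem e α i F l hl.1, Pi.add_apply, Pi.single_eq_same,
        Function.iterate_succ_apply']
    · have hkl : k ∈ l := by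
        rcases List.mem_cons.1 hk with h | h
        · exact absurd h.symm hik
        · exact h
      rw [dirDeriv_iterate_comm (contDiff_foldr_dirDeriv hF e α l), ih hl.2 hkl, Pi.add_apply,
        Pi.single_eq_of_ne hik, add_zero]

theorem contDiff_multiDeriv (hF : ContDiff ℝ ∞ F) (e : Fin n → V) (α : Fin n → ℕ) :
    ContDiff ℝ ∞ (multiDeriv e α F) :=
  contDiff_foldr_dirDeriv hF e α _

theorem dirDeriv_multiDeriv_comm (hF : ContDiff ℝ ∞ F) (e : Fin n → V) (α : Fin n → ℕ) (u : V) :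
    dirDeriv u (multiDeriv e α F) = multiDeriv e α (dirDeriv u F) :=
  dirDeriv_foldr_comm hF e α u _

theorem dirDeriv_multiDeriv_self (hF : ContDiff ℝ ∞ F) (e : Fin n → V) (α : Fin n → ℕ)
    (k : Fin n) : dirDeriv (e k) (multiDeriv e α F) = multiDeriv e (α + Pi.single k 1) F :=
  dirDeriv_foldr_eq_add_single hF e α k _ (List.nodup_finRange n) (List.mem_finRange k)

end

/-- The mixed derivative `∂_x^α ∂_ξ^β ∂_η^γ σ`. -/
def mixedDeriv (α β γ : Fin n → ℕ) (σ : RSpace n × RSpace n × RSpace n → ℂ) :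
    RSpace n × RSpace n × RSpace n → ℂ :=
  derivX α (derivXi β (derivEta γ σ))

section

variable {σ : RSpace n × RSpace n × RSpace n → ℂ}

theorem contDiff_mixedDeriv (hσ : ContDiff ℝ ∞ σ) (α β γ : Fin n → ℕ) :
    ContDiff ℝ ∞ (mixedDeriv α β γ σ) :=
  contDiff_multiDeriv (contDiff_multiDeriv (contDiff_multiDeriv hσ _ _) _ _) _ _

theorem dirDeriv_x_mixedDeriv (hσ : ContDiff ℝ ∞ σ) (α β γ : Fin n → ℕ) (k : Fin n) :
    dirDeriv (stdVec k, 0, 0) (mixedDeriv α β γ σ) = mixedDeriv (α + Pi.single k 1) β γ σ :=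
  dirDeriv_multiDeriv_self (contDiff_multiDeriv (contDiff_multiDeriv hσ _ _) _ _)
    (fun i => (stdVec i, 0, 0)) α k

theorem dirDeriv_xi_mixedDeriv (hσ : ContDiff ℝ ∞ σ) (α β γ : Fin n → ℕ) (k : Fin n) :
    dirDeriv (0, stdVec k, 0) (mixedDeriv α β γ σ) = mixedDeriv α (β + Pi.single k 1) γ σ := by
  have h1 : ContDiff ℝ ∞ (derivEta γ σ) := contDiff_multiDeriv hσ _ _
  have h2 : ContDiff ℝ ∞ (derivXi β (derivEta γ σ)) := contDiff_multiDeriv h1 _ _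
  exact (dirDeriv_multiDeriv_comm h2 _ _ _).trans (congrArg (derivX α)
    (dirDeriv_multiDeriv_self h1 (fun i => (0, stdVec i, 0)) β k))

theorem dirDeriv_eta_mixedDeriv (hσ : ContDiff ℝ ∞ σ) (α β γ : Fin n → ℕ) (k : Fin n) :
    dirDeriv (0, 0, stdVec k) (mixedDeriv α β γ σ) = mixedDeriv α β (γ + Pi.single k 1) σ := by
  have h1 : ContDiff ℝ ∞ (derivEta γ σ) := contDiff_multiDeriv hσ _ _
  have h2 : ContDiff ℝ ∞ (derivXi β (derivEta γ σ)) := contDiff_multiDeriv h1 _ _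
  exact (dirDeriv_multiDeriv_comm h2 _ _ _).trans (congrArg (derivX α)
    ((dirDeriv_multiDeriv_comm h1 _ _ _).trans (congrArg (derivXi β)
      (dirDeriv_multiDeriv_self hσ (fun i => (0, 0, stdVec i)) γ k))))

end

theorem frame_x (lam : ℝ) (k : Fin n) :
    frame lam (Sum.inl k) = lam⁻¹ • ((stdVec k, 0, 0) : RSpace n × RSpace n × RSpace n) := by
  simp [frame]

theorem frame_xi (lam : ℝ) (k : Fin n) :
    frame lam (Sum.inr (Sum.inl k)) =
      lam • ((0, stdVec k, 0) : RSpace n × RSpace n × RSpace n) := by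
  simp [frame]

theorem frame_eta (lam : ℝ) (k : Fin n) :
    frame lam (Sum.inr (Sum.inr k)) =
      lam • ((0, 0, stdVec k) : RSpace n × RSpace n × RSpace n) := by
  simp [frame]

/-- The total order of a multi-index. -/
def order (α : Fin n → ℕ) : ℝ := ((∑ i, α i : ℕ) : ℝ)

theorem order_add_single (α : Fin n → ℕ) (k : Fin n) :
    order (α + Pi.single k 1) = order α + 1 := by
  simp [order, Finset.sum_add_distrib]

theorem rpow_comparable_le {A D : ℝ} (hD : 0 < D) (h1 : D ≤ 5 * A) (h2 : A ≤ 5 * D) (e : ℝ) :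
    A ^ e ≤ 5 ^ |e| * D ^ e := by
  have hA : 0 < A := by linarith
  have h : A ^ e = (A / D) ^ e * D ^ e := by
    rw [← Real.mul_rpow (by positivity) hD.le, div_mul_cancel₀ _ hD.ne']
  rw [h]
  gcongr
  rcases le_total 0 e with he | he
  · rw [abs_of_nonneg he]
    exact Real.rpow_le_rpow (by positivity) ((div_le_iff₀ hD).2 h2) he
  · rw [abs_of_nonpos he, Real.rpow_neg (by norm_num), ← Real.inv_rpow (by norm_num)]
    refine Real.rpow_le_rpow_of_nonpos (by norm_num) ?_ he
    rw [le_div_iff₀ hD]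
    linarith

/-- The part of phase space where `1 + ‖ξ‖ + ‖η‖` is comparable to `D`. -/
def comparableRegion (n : ℕ) (D : ℝ) : Set (RSpace n × RSpace n × RSpace n) :=
  {z | D ≤ 5 * (1 + ‖z.2.1‖ + ‖z.2.2‖) ∧ 1 + ‖z.2.1‖ + ‖z.2.2‖ ≤ 5 * D}

/-- The prefactor brings each mixed derivative to size D^m. A frame derivative contributes D^{±ρ},
precisely what turns the prefactor into that of the next multi-index, so the induction closes. -/
theorem exists_derivBound_mixedDeriv {m ρ : ℝ} {σ : RSpace n × RSpace n × RSpace n → ℂ}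
    (hσ : σ ∈ BS n m ρ ρ) (N : ℕ) (α β γ : Fin n → ℕ) :
    ∃ C : ℝ, 0 ≤ C ∧ ∀ D : ℝ, 1 ≤ D → DerivBound (D ^ ρ) (comparableRegion n D) N
      (fun z => ((D ^ (ρ * (order β + order γ - order α)) : ℝ) : ℂ) * mixedDeriv α β γ σ z)
      (C * D ^ m) := by
  obtain ⟨hsm, hbd⟩ := hσ
  have hzero : ∀ α β γ : Fin n → ℕ, ∃ C : ℝ, 0 ≤ C ∧ ∀ D : ℝ, 1 ≤ D →
      ∀ z ∈ comparableRegion n D,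
      ‖((D ^ (ρ * (order β + order γ - order α)) : ℝ) : ℂ) * mixedDeriv α β γ σ z‖ ≤
        C * D ^ m := by
    intro α β γ
    obtain ⟨C, hC, h⟩ := hbd α β γ
    set e : ℝ := m + ρ * order α - ρ * (order β + order γ) with he
    refine ⟨C * 5 ^ |e|, by positivity, fun D hD z hz => ?_⟩
    have hD0 : 0 < D := by linarith
    rw [norm_mul, Complex.norm_real, Real.norm_of_nonneg (by positivity)]
    calc D ^ (ρ * (order β + order γ - order α)) * ‖mixedDeriv α β γ σ z‖
        ≤ D ^ (ρ * (order β + order γ - order α)) * (C * (5 ^ |e| * D ^ e)) := by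
          gcongr
          refine (h z.1 z.2.1 z.2.2).trans ?_
          gcongr
          exact rpow_comparable_le hD0 hz.1 hz.2 e
      _ = C * 5 ^ |e| * (D ^ (ρ * (order β + order γ - order α)) * D ^ e) := by ring
      _ = _ := by
          rw [← Real.rpow_add hD0, he]
          congr 2
          ring
  induction N generalizing α β γ with
  | zero => exact hzero α β γ
  | succ N ih =>
    obtain ⟨C0, hC0, h0⟩ := hzero α β γ
    choose C1 hC1 h1 using fun k => ih (α + Pi.single k 1) β γ
    choose C2 hC2 h2 using fun k => ih α (β + Pi.single k 1) γ
    choose C3 hC3 h3 using fun k => ih α β (γ + Pi.single k 1)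
    have hs1 := Finset.sum_nonneg fun k (_ : k ∈ Finset.univ) => hC1 k
    have hs2 := Finset.sum_nonneg fun k (_ : k ∈ Finset.univ) => hC2 k
    have hs3 := Finset.sum_nonneg fun k (_ : k ∈ Finset.univ) => hC3 k
    refine ⟨C0 + ∑ k, C1 k + ∑ k, C2 k + ∑ k, C3 k, by positivity, fun D hD => ?_⟩
    have hD0 : 0 < D := by linarith
    have hDm : 0 ≤ D ^ m := by positivity
    have hd := contDiff_mixedDeriv hsm α β γ
    refine ⟨fun z hz => (h0 D hD z hz).trans ?_, fun i => ?_⟩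
    · gcongr
      linarith
    · rw [dirDeriv_const_mul hd]
      rcases i with k | k | k
      · have hle := Finset.single_le_sum (fun k (_ : k ∈ Finset.univ) => hC1 k) (Finset.mem_univ k)
        refine DerivBound.mono_right (M := C1 k * D ^ m) ?_ (by gcongr; linarith)
        convert! h1 k D hD using 2 with z
        rw [frame_x, dirDeriv_smul, dirDeriv_x_mixedDeriv hsm, order_add_single, ← mul_assoc,
          ← Complex.ofReal_mul, ← Real.rpow_neg hD0.le, ← Real.rpow_add hD0]
        congr 3
        ring
      · have hle := Finset.single_le_sum (fun k (_ : k ∈ Finset.univ) => hC2 k) (Finset.mem_univ k)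
        refine DerivBound.mono_right (M := C2 k * D ^ m) ?_ (by gcongr; linarith)
        convert! h2 k D hD using 2 with z
        rw [frame_xi, dirDeriv_smul, dirDeriv_xi_mixedDeriv hsm, order_add_single, ← mul_assoc,
          ← Complex.ofReal_mul, ← Real.rpow_add hD0]
        congr 3
        ring
      · have hle := Finset.single_le_sum (fun k (_ : k ∈ Finset.univ) => hC3 k) (Finset.mem_univ k)
        refine DerivBound.mono_right (M := C3 k * D ^ m) ?_ (by gcongr; linarith)
        convert! h3 k D hD using 2 with z
        rw [frame_eta, dirDeriv_smul, dirDeriv_eta_mixedDeriv hsm, order_add_single, ← mul_assoc,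
          ← Complex.ofReal_mul, ← Real.rpow_add hD0]
        congr 3
        ring

theorem mixedDeriv_zero (σ : RSpace n × RSpace n × RSpace n → ℂ) : mixedDeriv 0 0 0 σ = σ := by
  have h0 : ∀ (e : Fin n → RSpace n × RSpace n × RSpace n)
      (F : RSpace n × RSpace n × RSpace n → ℂ), multiDeriv e 0 F = F := by
    intro e F
    unfold multiDeriv
    generalize List.finRange n = l
    induction l with
    | nil => rfl
    | cons i l ih => simp
  simp only [mixedDeriv, derivX, derivXi, derivEta, h0]

theorem exists_derivBound_symbol {m ρ : ℝ} {σ : RSpace n × RSpace n × RSpace n → ℂ}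
    (hσ : σ ∈ BS n m ρ ρ) (N : ℕ) :
    ∃ C : ℝ, 0 ≤ C ∧ ∀ D : ℝ, 1 ≤ D →
      DerivBound (D ^ ρ) (comparableRegion n D) N σ (C * D ^ m) := by
  obtain ⟨C, hC, h⟩ := exists_derivBound_mixedDeriv hσ N 0 0 0
  refine ⟨C, hC, fun D hD => ?_⟩
  convert! h D hD using 2 with z
  rw [mixedDeriv_zero]
  simp [order]

theorem DerivBound.mono_set {lam M : ℝ} {S T : Set (RSpace n × RSpace n × RSpace n)} {N : ℕ}
    {F : RSpace n × RSpace n × RSpace n → ℂ} (h : DerivBound lam T N F M) (hST : S ⊆ T) :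
    DerivBound lam S N F M := by
  induction N generalizing F with
  | zero => exact fun z hz => h z (hST hz)
  | succ N ih => exact ⟨fun z hz => h.1 z (hST hz), fun i => ih (h.2 i)⟩

/-! ### Dyadic decomposition of the symbol. -/

/-- The anisotropic dilation `(x, ξ, η) ↦ (s x, t ξ, t η)`. -/
def dilation (n : ℕ) (s t : ℝ) :
    (RSpace n × RSpace n × RSpace n) →L[ℝ] (RSpace n × RSpace n × RSpace n) :=
  (s • ContinuousLinearMap.fst ℝ (RSpace n) (RSpace n × RSpace n)).prod
    (t • ContinuousLinearMap.snd ℝ (RSpace n) (RSpace n × RSpace n))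

theorem dilation_apply (s t : ℝ) (z : RSpace n × RSpace n × RSpace n) :
    dilation n s t z = (s • z.1, t • z.2) := rfl

theorem exists_dilation_frame (s t lam : ℝ) (hs : |lam⁻¹ * s| ≤ 4) (ht : |lam * t| ≤ 4)
    (i : Fin n ⊕ Fin n ⊕ Fin n) :
    ∃ c : ℝ, |c| ≤ 4 ∧ dilation n s t (frame lam i) = c • frame 1 i := by
  rcases i with k | k | k
  · exact ⟨_, hs, by simp [dilation_apply, frame, smul_smul, mul_comm]⟩
  · exact ⟨_, ht, by simp [dilation_apply, frame, smul_smul, mul_comm]⟩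
  · exact ⟨_, ht, by simp [dilation_apply, frame, smul_smul, mul_comm]⟩

/-- By the chain rule a frame derivative becomes a multiple, by at most 4, of a unit-frame
derivative of Θ, so the bound does not depend on the dilation. -/
theorem exists_derivBound_comp_dilation (N : ℕ) (Θ : RSpace n × RSpace n × RSpace n → ℂ)
    (hΘ : ContDiff ℝ ∞ Θ) (hΘs : HasCompactSupport Θ) :
    ∃ C : ℝ, 0 ≤ C ∧ ∀ lam s t : ℝ, |lam⁻¹ * s| ≤ 4 → |lam * t| ≤ 4 →
      DerivBound lam Set.univ N (fun z => Θ (dilation n s t z)) C := by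
  induction N generalizing Θ with
  | zero =>
    obtain ⟨C, hC⟩ := hΘs.exists_bound_of_continuous hΘ.continuous
    exact ⟨C, (norm_nonneg _).trans (hC 0), fun lam s t _ _ z _ => hC _⟩
  | succ N ih =>
    obtain ⟨C, hC⟩ := hΘs.exists_bound_of_continuous hΘ.continuous
    have hC0 : 0 ≤ C := (norm_nonneg _).trans (hC 0)
    choose K hK hKb using fun i => ih (dirDeriv (frame 1 i) Θ) (contDiff_dirDeriv hΘ _)
      (hΘs.fderiv_apply ℝ _)
    have hsum := Finset.sum_nonneg fun i (_ : i ∈ Finset.univ) => hK i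
    refine ⟨C + 4 * ∑ i, K i, by positivity, fun lam s t hs ht => ⟨fun z _ => (hC _).trans ?_,
      fun i => ?_⟩⟩
    · linarith
    · obtain ⟨c, hc, hcf⟩ := exists_dilation_frame s t lam hs ht i
      have hd : dirDeriv (frame lam i) (fun z => Θ (dilation n s t z)) =
          fun z => (c : ℂ) * dirDeriv (frame 1 i) Θ (dilation n s t z) := by
        funext z
        change fderiv ℝ (Θ ∘ dilation n s t) z (frame lam i) = _
        rw [fderiv_comp z ((hΘ.differentiable (by simp)) _) (dilation n s t).differentiableAt,
          ContinuousLinearMap.fderiv, ContinuousLinearMap.comp_apply, hcf]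
        simp [dirDeriv]
      rw [hd]
      have hle := Finset.single_le_sum (fun i (_ : i ∈ Finset.univ) => hK i) (Finset.mem_univ i)
      refine ((hKb i lam s t hs ht).const_mul
        ((contDiff_dirDeriv hΘ _).comp (dilation n s t).contDiff) c).mono_right ?_
      rw [Complex.norm_real, Real.norm_eq_abs]
      have := mul_le_mul hc hle (hK i) (by norm_num)
      linarith

/-- A smooth cut-off function, equal to `1` on the unit ball and supported in the ball of
radius `2`. -/
def bump (V : Type*) [NormedAddCommGroup V] [NormedSpace ℝ V] [HasContDiffBump V] :
    ContDiffBump (0 : V) := ⟨1, 2, one_pos, one_lt_two⟩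

/-- The cut-off of phase space to `‖x‖ ≤ 2`, `‖(ξ, η)‖ ≤ 2`. -/
def cutoff (n : ℕ) (z : RSpace n × RSpace n × RSpace n) : ℂ :=
  ((bump (RSpace n) z.1 * bump (RSpace n × RSpace n) z.2 : ℝ) : ℂ)

theorem contDiff_cutoff : ContDiff ℝ ∞ (cutoff n) :=
  Complex.ofRealCLM.contDiff.comp
    (((bump (RSpace n)).contDiff.comp contDiff_fst).mul
      ((bump (RSpace n × RSpace n)).contDiff.comp contDiff_snd))

theorem cutoff_eq_zero_left {z : RSpace n × RSpace n × RSpace n} (h : 2 ≤ ‖z.1‖) :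
    cutoff n z = 0 := by
  have : bump (RSpace n) z.1 = 0 := (bump (RSpace n)).zero_of_le_dist (by simpa [bump] using h)
  simp [cutoff, this]

theorem cutoff_eq_zero_right {z : RSpace n × RSpace n × RSpace n} (h : 2 ≤ ‖z.2‖) :
    cutoff n z = 0 := by
  have : bump (RSpace n × RSpace n) z.2 = 0 :=
    (bump (RSpace n × RSpace n)).zero_of_le_dist (by rw [dist_zero_right]; exact h)
  simp [cutoff, this]

theorem bump_eq_one {V : Type*} [NormedAddCommGroup V] [NormedSpace ℝ V] [HasContDiffBump V]
    {v : V} (h : ‖v‖ ≤ 1) : bump V v = 1 :=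
  (bump V).one_of_mem_closedBall (mem_closedBall_zero_iff.2 h)

theorem norm_cutoff_le (z : RSpace n × RSpace n × RSpace n) : ‖cutoff n z‖ ≤ 1 := by
  rw [cutoff, Complex.norm_real, norm_mul, Real.norm_of_nonneg (ContDiffBump.nonneg _),
    Real.norm_of_nonneg (ContDiffBump.nonneg _)]
  exact mul_le_one₀ (ContDiffBump.le_one _) (ContDiffBump.nonneg _) (ContDiffBump.le_one _)

theorem hasCompactSupport_cutoff_dilation {s t : ℝ} (hs : 0 < s) (ht : 0 < t) :
    HasCompactSupport fun z => cutoff n (dilation n s t z) := by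
  refine HasCompactSupport.intro ((isCompact_closedBall (0 : RSpace n) (2 / s)).prod
    (isCompact_closedBall (0 : RSpace n × RSpace n) (2 / t))) fun z hz => ?_
  rw [Set.mem_prod, mem_closedBall_zero_iff, mem_closedBall_zero_iff, not_and_or, not_le,
    not_le, div_lt_iff₀ hs, div_lt_iff₀ ht] at hz
  rcases hz with h | h
  · refine cutoff_eq_zero_left ?_
    rw [dilation_apply, norm_smul, Real.norm_of_nonneg hs.le]
    linarith
  · refine cutoff_eq_zero_right ?_
    rw [dilation_apply, norm_smul, Real.norm_of_nonneg ht.le]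
    linarith

/-- The `j`-th piece of the dyadic decomposition of `σ` in `(ξ, η)`, localised in `x`. -/
def dyadicPiece (σ : RSpace n × RSpace n × RSpace n → ℂ) (s : ℝ) :
    ℕ → RSpace n × RSpace n × RSpace n → ℂ
  | 0, z => σ z * cutoff n (dilation n s 1 z)
  | j + 1, z => σ z * (cutoff n (dilation n s (4 ^ (j + 1))⁻¹ z) -
      cutoff n (dilation n s (4 ^ j)⁻¹ z))

theorem sum_dyadicPiece (σ : RSpace n × RSpace n × RSpace n → ℂ) (s : ℝ) (J : ℕ)
    (z : RSpace n × RSpace n × RSpace n) :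
    ∑ j ∈ Finset.range (J + 1), dyadicPiece σ s j z =
      σ z * cutoff n (dilation n s (4 ^ J)⁻¹ z) := by
  induction J with
  | zero => simp [dyadicPiece]
  | succ J ih =>
    rw [Finset.sum_range_succ, ih, dyadicPiece]
    ring

theorem scaleRegion_subset_comparableRegion {D : ℝ} (hD : 1 ≤ D) :
    {z : RSpace n × RSpace n × RSpace n | z.2 ∈ scaleRegion n D} ⊆ comparableRegion n D := by
  rintro z ⟨h1, h2, h3⟩
  have := norm_nonneg z.2.1
  have := norm_nonneg z.2.2
  have := max_le_add_of_nonneg (norm_nonneg z.2.1) (norm_nonneg z.2.2)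
  constructor <;> linarith

/-- The norm on pairs is the maximum, so the cutoffs test max(|ξ|,|η|). Beyond 2·4^j both vanish;
below 4^{j-1} both equal 1 and cancel. The summand 1 in `scaleRegion` covers j = 0, which has no
inner cutoff. -/
theorem dyadicPiece_eq_zero (σ : RSpace n × RSpace n × RSpace n → ℂ) {s : ℝ} (j : ℕ)
    {z : RSpace n × RSpace n × RSpace n} (hz : z.2 ∉ scaleRegion n (4 ^ j)) :
    dyadicPiece σ s j z = 0 := by
  have hn : ∀ t : ℝ, 0 < t → 2 * t ≤ ‖z.2‖ → cutoff n (dilation n s t⁻¹ z) = 0 := by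
    intro t ht h
    refine cutoff_eq_zero_right ?_
    rw [dilation_apply, norm_smul, Real.norm_of_nonneg (by positivity), inv_mul_eq_div,
      le_div_iff₀ ht]
    exact h
  have hm : ‖z.2‖ = max ‖z.2.1‖ ‖z.2.2‖ := rfl
  by_cases hle : ‖z.2‖ ≤ 2 * 4 ^ j
  · have h3 : 4 * (1 + ‖z.2‖) < 4 ^ j := by
      by_contra h
      push Not at h
      exact hz ⟨(le_max_left _ _).trans hle, (le_max_right _ _).trans hle, by rwa [← hm]⟩
    cases j with
    | zero =>
      have := norm_nonneg z.2
      norm_num at h3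
      linarith
    | succ j =>
      rw [dyadicPiece, cutoff, cutoff, dilation_apply, dilation_apply]
      have hb : ∀ t : ℝ, ‖z.2‖ ≤ t → 0 < t → bump (RSpace n × RSpace n) (t⁻¹ • z.2) = 1 := by
        intro t h ht
        refine bump_eq_one ?_
        rw [norm_smul, Real.norm_of_nonneg (by positivity), inv_mul_eq_div, div_le_one ht]
        exact h
      rw [hb _ (by rw [pow_succ] at h3 ⊢; have := norm_nonneg z.2; linarith) (by positivity),
        hb _ (by rw [pow_succ] at h3; linarith) (by positivity)]
      simp
  · push Not at hle
    cases j with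
    | zero =>
      have := hn 1 one_pos (by simpa using hle.le)
      rw [inv_one] at this
      rw [dyadicPiece, this, mul_zero]
    | succ j =>
      rw [dyadicPiece, hn _ (by positivity) hle.le, hn _ (by positivity), sub_zero, mul_zero]
      rw [pow_succ] at hle
      have : (0 : ℝ) < 4 ^ j := by positivity
      linarith

theorem exists_amplitude_dyadicPiece {m ρ : ℝ} (hρ0 : 0 ≤ ρ) (hρ1 : ρ ≤ 1)
    {σ : RSpace n × RSpace n × RSpace n → ℂ} (hσ : σ ∈ BS n m ρ ρ) (N : ℕ) :
    ∃ C : ℝ, 0 ≤ C ∧ ∀ s : ℝ, 0 < s → s ≤ 1 → ∀ j : ℕ,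
      Amplitude (((4 : ℝ) ^ j) ^ ρ) (4 ^ j) N (C * ((4 : ℝ) ^ j) ^ m) (dyadicPiece σ s j) := by
  obtain ⟨C, hC, h⟩ := exists_derivBound_symbol hσ N
  obtain ⟨K, hK, hK'⟩ := exists_derivBound_comp_dilation N (cutoff n) contDiff_cutoff
    (by simpa [dilation_apply] using
      hasCompactSupport_cutoff_dilation (n := n) one_pos one_pos)
  have hcut : ∀ s t, ContDiff ℝ ∞ fun z => cutoff n (dilation n s t z) := fun s t =>
    contDiff_cutoff.comp (dilation n s t).contDiff
  refine ⟨2 ^ N * (C * (2 * K)), by positivity, fun s hs hs1 j => ?_⟩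
  have hD : (1 : ℝ) ≤ 4 ^ j := one_le_pow₀ (by norm_num)
  have hD0 : (0 : ℝ) < 4 ^ j := by positivity
  have hlam : 1 ≤ ((4 : ℝ) ^ j) ^ ρ := Real.one_le_rpow hD hρ0
  have hlamD : ((4 : ℝ) ^ j) ^ ρ ≤ 4 ^ j := by
    simpa using Real.rpow_le_rpow_of_exponent_le hD hρ1
  set lam := ((4 : ℝ) ^ j) ^ ρ
  have hb1 : |lam⁻¹ * s| ≤ 4 := by
    rw [abs_of_nonneg (by positivity), inv_mul_eq_div, div_le_iff₀ (by positivity)]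
    linarith
  have hb2 : ∀ t : ℝ, 0 ≤ t → 4 ^ j * t ≤ 4 → |lam * t| ≤ 4 := by
    intro t ht h
    rw [abs_of_nonneg (by positivity)]
    exact (mul_le_mul_of_nonneg_right hlamD ht).trans h
  have main : ∀ Θ : RSpace n × RSpace n × RSpace n → ℂ, ContDiff ℝ ∞ Θ → HasCompactSupport Θ →
      DerivBound lam Set.univ N Θ (2 * K) →
      (∀ z, dyadicPiece σ s j z = σ z * Θ z) →
      Amplitude lam (4 ^ j) N (2 ^ N * (C * (2 * K)) * ((4 : ℝ) ^ j) ^ m) (dyadicPiece σ s j) := by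
    intro Θ hΘ hΘs hΘb heq
    have hfun : dyadicPiece σ s j = fun z => σ z * Θ z := funext heq
    refine ⟨hfun ▸ hσ.1.mul hΘ, hfun ▸ hΘs.mul_left, fun z hz => dyadicPiece_eq_zero σ j hz, ?_⟩
    rw [hfun]
    have := ((h _ hD).mono_set (scaleRegion_subset_comparableRegion hD)).mul hσ.1 hΘ
      (by positivity) (by positivity) (hΘb.mono_set (Set.subset_univ _))
    refine this.mono_right (le_of_eq ?_)
    ring
  cases j with
  | zero =>
    refine main (fun z => cutoff n (dilation n s 1 z)) (hcut _ _)
      (hasCompactSupport_cutoff_dilation hs one_pos) ?_ fun z => rfl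
    exact (hK' lam s 1 hb1 (hb2 1 zero_le_one (by norm_num))).mono_right (by linarith)
  | succ j =>
    have hp : (0 : ℝ) < 4 ^ j := by positivity
    refine main (fun z => cutoff n (dilation n s (4 ^ (j + 1))⁻¹ z) -
      cutoff n (dilation n s (4 ^ j)⁻¹ z)) ((hcut _ _).sub (hcut _ _))
      ((hasCompactSupport_cutoff_dilation hs (by positivity)).sub
        (hasCompactSupport_cutoff_dilation hs (by positivity))) ?_ fun z => rfl
    have h1 := hK' lam s (4 ^ (j + 1))⁻¹ hb1 (hb2 _ (by positivity)
      (by rw [mul_inv_cancel₀ hD0.ne']; norm_num))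
    -- The inner cutoff has scale 4^j while D = 4^{j+1}; the quotient 4 is the bound allowed for
    -- dilations.
    have h2 := hK' lam s (4 ^ j)⁻¹ hb1 (hb2 _ (by positivity)
      (by rw [pow_succ, mul_right_comm, mul_inv_cancel₀ hp.ne', one_mul]))
    have := h1.add (hcut _ _) (contDiff_const.mul (hcut _ _)) (h2.const_mul (hcut _ _) (-1))
    simpa [← sub_eq_add_neg, two_mul] using this

/-! ### Summation over the scales. -/

theorem sqrt_div_half (a : ℝ) (j : ℕ) : √(a / 4 ^ j) = √a / 2 ^ j := by
  rw [Real.sqrt_div' _ (by positivity), show (4 : ℝ) ^ j = (2 ^ j) ^ 2 by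
    rw [← pow_mul, mul_comm, pow_mul]; norm_num, Real.sqrt_sq (by positivity)]

/-- The terms √(λ/D) form a geometric series of ratio 4^{(ρ-1)/2} < 1. With s = √(|v|/4^j), which
halves at each scale, s/((1+s)(2+s)) = s/(1+s) - (s/2)/(1+s/2) telescopes to a total of at most 1.
-/
theorem sum_scaleKernel_le {ρ : ℝ} (hρ1 : ρ < 1) :
    ∃ K : ℝ≥0, ∀ (J : ℕ) (v : RSpace n),
      ∑ j ∈ Finset.range J, scaleKernel (((4 : ℝ) ^ j) ^ ρ) (4 ^ j) v ≤ K := by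
  set r : ℝ := √((4 : ℝ) ^ ρ / 4) with hr
  have hr0 : 0 ≤ r := Real.sqrt_nonneg _
  have hr1 : r < 1 := by
    rw [hr, Real.sqrt_lt' one_pos, one_pow, div_lt_one (by norm_num)]
    simpa using Real.rpow_lt_rpow_of_exponent_lt (x := 4) (by norm_num) hρ1
  refine ⟨Real.toNNReal ((1 - r)⁻¹ + 1), fun J v => ?_⟩
  have h1 : 0 ≤ (1 - r)⁻¹ := inv_nonneg.2 (by linarith)
  rw [Real.coe_toNNReal _ (by linarith)]
  simp only [scaleKernel, Finset.sum_add_distrib]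
  gcongr
  · calc ∑ j ∈ Finset.range J, √(((4 : ℝ) ^ j) ^ ρ / 4 ^ j) = ∑ j ∈ Finset.range J, r ^ j := by
          refine Finset.sum_congr rfl fun j _ => ?_
          rw [← Real.rpow_pow_comm (by norm_num), ← div_pow,
            Real.sqrt_eq_iff_mul_self_eq (by positivity) (by positivity), ← mul_pow,
            Real.mul_self_sqrt (by positivity)]
      _ ≤ ∑' j, r ^ j := (summable_geometric_of_lt_one hr0 hr1).sum_le_tsum _
          fun j _ => by positivity
      _ = (1 - r)⁻¹ := tsum_geometric_of_lt_one hr0 hr1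
  · set c : ℝ := √‖v‖
    have hc : 0 ≤ c := Real.sqrt_nonneg _
    have hstep : ∀ j : ℕ, √(‖v‖ / 4 ^ j) / ((1 + √(‖v‖ / 4 ^ j)) * (2 + √(‖v‖ / 4 ^ j))) =
        c / 2 ^ j / (1 + c / 2 ^ j) - c / 2 ^ (j + 1) / (1 + c / 2 ^ (j + 1)) := by
      intro j
      rw [sqrt_div_half]
      change c / 2 ^ j / _ = _
      have h : c / 2 ^ (j + 1) = c / 2 ^ j / 2 := by rw [pow_succ]; field_simp
      rw [h]
      have : 0 ≤ c / 2 ^ j := by positivity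
      generalize c / 2 ^ j = t at this
      field_simp
      ring
    rw [Finset.sum_congr rfl fun j _ => hstep j,
      Finset.sum_range_sub' (fun j => c / 2 ^ j / (1 + c / 2 ^ j))]
    have h2 : c / 2 ^ 0 / (1 + c / 2 ^ 0) ≤ 1 := div_le_one_of_le₀ (by linarith) (by positivity)
    have h3 : 0 ≤ c / 2 ^ J / (1 + c / 2 ^ J) := by positivity
    linarith

theorem eLpNorm_two_eq (f : RSpace n → ℂ) :
    eLpNorm f 2 volume = (∫⁻ x, ‖f x‖ₑ ^ 2) ^ (1 / 2 : ℝ) := by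
  rw [eLpNorm_eq_lintegral_rpow_enorm_toReal (by norm_num) (by norm_num)]
  simp

theorem sum_kernelEnergy_le {ρ : ℝ} (hρ1 : ρ < 1) :
    ∃ K : ℝ≥0, ∀ (J : ℕ) (Φ : 𝓢(RSpace n, ℂ)),
      ∑ j ∈ Finset.range J, kernelEnergy (((4 : ℝ) ^ j) ^ ρ) (4 ^ j) Φ ≤
        K * eLpNorm Φ 2 volume ^ 2 := by
  obtain ⟨K, hK⟩ := sum_scaleKernel_le (n := n) hρ1
  refine ⟨K, fun J Φ => ?_⟩
  have hm : Measurable fun v : RSpace n => ‖Φ v‖ₑ ^ 2 :=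
    Φ.continuous.measurable.enorm.pow_const 2
  have hk : ∀ j : ℕ, Measurable fun v : RSpace n =>
      ENNReal.ofReal (scaleKernel (((4 : ℝ) ^ j) ^ ρ) (4 ^ j) v) * ‖Φ v‖ₑ ^ 2 := by
    intro j
    refine Measurable.mul ?_ hm
    unfold scaleKernel
    fun_prop
  simp only [kernelEnergy]
  rw [← lintegral_finsetSum _ fun j _ => hk j, eLpNorm_two_eq, rpow_half_sq,
    ← lintegral_const_mul _ hm]
  refine lintegral_mono fun v => ?_
  rw [← Finset.sum_mul, ← ENNReal.ofReal_sum_of_nonneg fun j _ => scaleKernel_nonneg _ _ _]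
  refine mul_le_mul_left ?_ _
  rw [← ENNReal.ofReal_coe_nnreal]
  exact ENNReal.ofReal_le_ofReal (hK J v)

theorem sum_rpow_half_mul_le (J : ℕ) (a b : ℕ → ℝ≥0∞) :
    ∑ j ∈ Finset.range J, (a j * b j) ^ (1 / 2 : ℝ) ≤
      (∑ j ∈ Finset.range J, a j) ^ (1 / 2 : ℝ) * (∑ j ∈ Finset.range J, b j) ^ (1 / 2 : ℝ) := by
  have h := ENNReal.inner_le_Lp_mul_Lq (Finset.range J) (fun j => a j ^ (1 / 2 : ℝ))
    (fun j => b j ^ (1 / 2 : ℝ)) Real.HolderConjugate.two_two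
  simp only [← ENNReal.rpow_mul] at h
  norm_num at h
  simpa [ENNReal.mul_rpow_of_nonneg] using h

theorem eLpNorm_fourierHat (f : 𝓢(RSpace n, ℂ)) : eLpNorm (fourierHat f) 2 volume =
    ENNReal.ofReal ((2 * Real.pi) ^ n) ^ (1 / 2 : ℝ) * eLpNorm f 2 volume := by
  rw [eLpNorm_two_eq, eLpNorm_two_eq, lintegral_enorm_sq_fourierHat f.integrable (f.memLp 2),
    ENNReal.mul_rpow_of_nonneg _ _ (by norm_num)]

/-- Without windows λ disappears, so pieces estimated with different λ are parts of one form. -/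
theorem triForm_zero (lam : ℝ) (f g φ : RSpace n → ℂ)
    (b : RSpace n × RSpace n × RSpace n → ℂ) :
    triForm 0 0 0 lam f g φ b = triForm 0 0 0 1 f g φ b := by
  simp only [triForm, triKernel, stft_zero]

/-- The critical order: (D/λ)^{n/2} = D^{(1-ρ)n/2} = D^{-m}. -/
theorem rpow_scale_eq_one {m ρ D : ℝ} (hm : m = -(1 - ρ) * (n : ℝ) / 2) (hD : 0 < D) :
    ENNReal.ofReal (D ^ m) * ENNReal.ofReal (D ^ n * ((D ^ ρ) ^ n)⁻¹) ^ (1 / 2 : ℝ) = 1 := by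
  rw [ENNReal.ofReal_rpow_of_nonneg (by positivity) (by norm_num),
    ← ENNReal.ofReal_mul (by positivity), ← Real.rpow_natCast D n, ← Real.rpow_natCast _ n,
    ← Real.rpow_mul hD.le, ← Real.rpow_neg hD.le, ← Real.rpow_add hD, ← Real.rpow_mul hD.le,
    ← Real.rpow_add hD, hm]
  ring_nf
  simp

theorem scaleBound_le (lam D : ℝ) (f g φ : 𝓢(RSpace n, ℂ)) :
    scaleBound lam D f g φ = ENNReal.ofReal (D ^ n * (lam ^ n)⁻¹) ^ (1 / 2 : ℝ) *
      eLpNorm g ⊤ volume * (kernelEnergy lam D (schwartzHat f) * kernelEnergy lam D φ) ^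
        (1 / 2 : ℝ) := by
  rw [scaleBound, ENNReal.mul_rpow_of_nonneg _ _ (by norm_num),
    ENNReal.mul_rpow_of_nonneg _ _ (by norm_num), ← ENNReal.rpow_natCast _ 2, ← ENNReal.rpow_mul]
  norm_num

/-- Every scale contributes with the same constant, so the sum relies on Cauchy–Schwarz in j and the
summability of both energies. Uniformity in s and J is what allows the cutoffs to be removed. -/
theorem exists_enorm_triForm_cutoff_le (hn : 1 ≤ n) {m ρ : ℝ} (hρ0 : 0 ≤ ρ) (hρ1 : ρ < 1)
    (hm : m = -(1 - ρ) * (n : ℝ) / 2) {σ : RSpace n × RSpace n × RSpace n → ℂ}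
    (hσ : σ ∈ BS n m ρ ρ) :
    ∃ C : ℝ≥0, ∀ (s : ℝ) (J : ℕ) (f g φ : 𝓢(RSpace n, ℂ)), 0 < s → s ≤ 1 →
      ‖triForm 0 0 0 1 f g φ (fun z => σ z * cutoff n (dilation n s (4 ^ J)⁻¹ z))‖ₑ ≤
        C * (eLpNorm f 2 volume * eLpNorm g ⊤ volume * eLpNorm φ 2 volume) := by
  obtain ⟨N, C₁, h₁⟩ := triFormBounded_zero hn
  obtain ⟨C₂, hC₂, h₂⟩ := exists_amplitude_dyadicPiece hρ0 hρ1.le hσ N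
  obtain ⟨K, hK⟩ := sum_kernelEnergy_le (n := n) hρ1
  set c : ℝ≥0 := NNReal.rpow (Real.toNNReal ((2 * Real.pi) ^ n)) (1 / 2)
  have hc : ∀ f : 𝓢(RSpace n, ℂ), eLpNorm (schwartzHat f) 2 volume = c * eLpNorm f 2 volume := by
    intro f
    rw [show (schwartzHat f : RSpace n → ℂ) = fourierHat f from funext (coe_schwartzHat f),
      eLpNorm_fourierHat, ENNReal.ofReal,
      ← ENNReal.coe_rpow_of_nonneg _ (by norm_num)]
    rfl
  refine ⟨C₁ * C₂.toNNReal * K * c, fun s J f g φ hs hs1 => ?_⟩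
  have hsum : triForm 0 0 0 1 f g φ (fun z => σ z * cutoff n (dilation n s (4 ^ J)⁻¹ z)) =
      ∑ j ∈ Finset.range (J + 1), triForm 0 0 0 1 f g φ (dyadicPiece σ s j) := by
    simp only [triForm]
    rw [← integral_finsetSum _ fun j _ => integrable_mul_of_hasCompactSupport
      (h₂ s hs hs1 j).contDiff.continuous (h₂ s hs hs1 j).hasCompactSupport
      (continuous_triKernel 0 0 0 1 f g φ)]
    refine integral_congr_ae (Filter.Eventually.of_forall fun z => ?_)
    simp only [← sum_dyadicPiece, Finset.sum_mul]
  set E : (𝓢(RSpace n, ℂ)) → ℕ → ℝ≥0∞ := fun Φ j =>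
    kernelEnergy (((4 : ℝ) ^ j) ^ ρ) (4 ^ j) Φ
  have hpiece : ∀ j, ‖triForm 0 0 0 1 f g φ (dyadicPiece σ s j)‖ₑ ≤
      C₁ * ENNReal.ofReal C₂ * eLpNorm g ⊤ volume *
        (E (schwartzHat f) j * E φ j) ^ (1 / 2 : ℝ) := by
    intro j
    have hD : (1 : ℝ) ≤ 4 ^ j := one_le_pow₀ (by norm_num)
    have h := h₁ (((4 : ℝ) ^ j) ^ ρ) (4 ^ j) (C₂ * ((4 : ℝ) ^ j) ^ m) f g φ (dyadicPiece σ s j)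
      (Real.one_le_rpow hD hρ0)
      (by simpa using Real.rpow_le_rpow_of_exponent_le hD hρ1.le) (h₂ s hs hs1 j)
    rw [triForm_zero, scaleBound_le, ENNReal.ofReal_mul hC₂] at h
    refine h.trans_eq ?_
    have hone := rpow_scale_eq_one hm (D := 4 ^ j) (by positivity)
    calc _ = C₁ * ENNReal.ofReal C₂ * eLpNorm g ⊤ volume *
        (E (schwartzHat f) j * E φ j) ^ (1 / 2 : ℝ) * (ENNReal.ofReal (((4 : ℝ) ^ j) ^ m) *
          ENNReal.ofReal ((4 ^ j) ^ n * ((((4 : ℝ) ^ j) ^ ρ) ^ n)⁻¹) ^ (1 / 2 : ℝ)) := by ring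
      _ = _ := by rw [hone, mul_one]
  have hhalf : ∀ Φ : 𝓢(RSpace n, ℂ), (∑ j ∈ Finset.range (J + 1), E Φ j) ^ (1 / 2 : ℝ) ≤
      (K : ℝ≥0∞) ^ (1 / 2 : ℝ) * eLpNorm Φ 2 volume := by
    intro Φ
    refine (ENNReal.rpow_le_rpow (hK (J + 1) Φ) (by norm_num)).trans_eq ?_
    rw [ENNReal.mul_rpow_of_nonneg _ _ (by norm_num), ← ENNReal.rpow_natCast _ 2,
      ← ENNReal.rpow_mul]
    norm_num
  rw [hsum]
  calc ‖∑ j ∈ Finset.range (J + 1), triForm 0 0 0 1 f g φ (dyadicPiece σ s j)‖ₑ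
      ≤ ∑ j ∈ Finset.range (J + 1), ‖triForm 0 0 0 1 f g φ (dyadicPiece σ s j)‖ₑ :=
        enorm_sum_le _ _
    _ ≤ ∑ j ∈ Finset.range (J + 1), C₁ * ENNReal.ofReal C₂ * eLpNorm g ⊤ volume *
        (E (schwartzHat f) j * E φ j) ^ (1 / 2 : ℝ) := Finset.sum_le_sum fun j _ => hpiece j
    _ = C₁ * ENNReal.ofReal C₂ * eLpNorm g ⊤ volume * ∑ j ∈ Finset.range (J + 1),
        (E (schwartzHat f) j * E φ j) ^ (1 / 2 : ℝ) := by rw [Finset.mul_sum]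
    _ ≤ C₁ * ENNReal.ofReal C₂ * eLpNorm g ⊤ volume *
        (((K : ℝ≥0∞) ^ (1 / 2 : ℝ) * eLpNorm (schwartzHat f) 2 volume) *
          ((K : ℝ≥0∞) ^ (1 / 2 : ℝ) * eLpNorm φ 2 volume)) :=
        mul_le_mul_right ((sum_rpow_half_mul_le _ _ _).trans
          (mul_le_mul' (hhalf _) (hhalf _))) _
    _ = C₁ * ENNReal.ofReal C₂ * ((K : ℝ≥0∞) ^ (1 / 2 : ℝ)) ^ 2 * c *
        (eLpNorm f 2 volume * eLpNorm g ⊤ volume * eLpNorm φ 2 volume) := by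
        rw [hc]
        ring
    _ = _ := by
        rw [rpow_half_sq, ENNReal.ofReal]
        push_cast
        ring

/-! ### Duality and removal of the cutoffs. -/

theorem exists_fourierHat_eq (h : 𝓢(RSpace n, ℂ)) :
    ∃ φ : 𝓢(RSpace n, ℂ), ∀ x, fourierHat φ x = h x := by
  refine ⟨FourierTransform.fourierInv (SchwartzMap.compCLMOfContinuousLinearEquiv ℂ
    (ContinuousLinearEquiv.smulLeft (R₁ := ℝ) (M₁ := RSpace n)
      (Units.mk0 (2 * Real.pi) (by positivity))) h), fun x => ?_⟩
  rw [fourierHat_eq_fourier, ← SchwartzMap.fourier_coe, FourierTransform.fourier_fourierInv_eq,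
    SchwartzMap.compCLMOfContinuousLinearEquiv_apply]
  change h ((2 * Real.pi) • (2 * Real.pi)⁻¹ • x) = h x
  rw [smul_inv_smul₀ (by positivity)]

/-- A bounded function that is bounded as a functional on Schwartz functions in the `L²` norm
belongs to `L²`. -/
theorem memLp_two_of_forall_integral_mul_le {u : RSpace n → ℂ} (hu : AEStronglyMeasurable u)
    {K : ℝ} (hK : ∀ x, ‖u x‖ ≤ K) (B : ℝ≥0)
    (h : ∀ φ : 𝓢(RSpace n, ℂ), ‖∫ x, u x * φ x‖ₑ ≤ B * eLpNorm φ 2 volume) :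
    MemLp u 2 ∧ eLpNorm u 2 volume ≤ B := by
  have hint : ∀ φ : 𝓢(RSpace n, ℂ), Integrable fun x => u x * φ x := fun φ =>
    φ.integrable.bdd_mul hu (Filter.Eventually.of_forall hK)
  obtain ⟨ℓ, hℓ⟩ : ∃ ℓ : 𝓢(RSpace n, ℂ) →ₗ[ℂ] ℂ, ∀ φ, ℓ φ = ∫ x, u x * φ x :=
    ⟨{
      toFun := fun φ => ∫ x, u x * φ x
      map_add' := fun φ ψ => by
        simp only [_root_.add_apply, mul_add]
        exact integral_add (hint φ) (hint ψ)
      map_smul' := fun c φ => by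
        simp only [_root_.smul_apply, smul_eq_mul, mul_left_comm (u _),
          integral_const_mul, RingHom.id_apply] }, fun φ => rfl⟩
  obtain ⟨e, he, hd⟩ : ∃ e : 𝓢(RSpace n, ℂ) →ₗ[ℂ] Lp ℂ 2 (volume : Measure (RSpace n)),
      (∀ φ, e φ = φ.toLp 2 volume) ∧ DenseRange e :=
    ⟨(SchwartzMap.toLpCLM ℂ ℂ 2 volume).toLinearMap, fun φ => rfl,
      SchwartzMap.denseRange_toLpCLM (by norm_num)⟩
  have hB : ∀ φ, ‖ℓ φ‖ ≤ B * ‖e φ‖ := by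
    intro φ
    have h2 : ‖e φ‖ = (eLpNorm φ 2 volume).toReal := by rw [he, SchwartzMap.norm_toLp]
    have h3 := (φ.memLp 2 volume).eLpNorm_ne_top
    rw [hℓ, h2, ← ENNReal.coe_toReal, ← ENNReal.toReal_mul, ← toReal_enorm]
    exact ENNReal.toReal_mono (ENNReal.mul_ne_top ENNReal.coe_ne_top h3) (h φ)
  have hL : ∀ φ, ℓ.extendOfNorm e (e φ) = ∫ x, u x * φ x := fun φ =>
    (LinearMap.extendOfNorm_eq hd ⟨B, hB⟩ φ).trans (hℓ φ)
  have hLn : ‖ℓ.extendOfNorm e‖ ≤ B := LinearMap.opNorm_extendOfNorm_le hd B.2 hB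
  -- Riesz representation of the extension to L². Then u is the conjugate of w, because both have
  -- the same integrals against compactly supported smooth functions.
  set w := (InnerProductSpace.toDual ℂ (Lp ℂ 2 (volume : Measure (RSpace n)))).symm
    (ℓ.extendOfNorm e) with hw
  have hwn : ‖w‖ ≤ B := by rwa [hw, LinearIsometryEquiv.norm_map]
  have hwm : MemLp (fun x => (starRingEnd ℂ) (w x)) 2 volume := (Lp.memLp w).star
  have hae : ∀ᵐ x, u x = (starRingEnd ℂ) (w x) := by
    refine ae_eq_of_integral_contDiff_smul_eq ?_ (hwm.locallyIntegrable (by norm_num))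
      fun g hg hgs => ?_
    · exact (memLp_top_of_bound hu K (Filter.Eventually.of_forall hK)).locallyIntegrable le_top
    · have hgs' : HasCompactSupport fun x => (g x : ℂ) := hgs.comp_left (g := Complex.ofReal) rfl
      set φ := hgs'.toSchwartzMap (Complex.ofRealCLM.contDiff.comp hg) with hφ
      have h1 := hL φ
      have h2 : ℓ.extendOfNorm e (e φ) = inner ℂ w (e φ) := by
        rw [hw, InnerProductSpace.toDual_symm_apply]
      rw [h2, L2.inner_def] at h1
      have h3 : ∀ x, φ x = (g x : ℂ) := fun x => rfl
      simp only [Complex.real_smul]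
      calc ∫ x, (g x : ℂ) * u x = ∫ x, u x * φ x := by simp only [h3, mul_comm]
        _ = ∫ x, inner ℂ (w x) (e φ x) := h1.symm
        _ = ∫ x, (g x : ℂ) * (starRingEnd ℂ) (w x) := by
          refine integral_congr_ae ?_
          filter_upwards [φ.coeFn_toLp 2 volume] with x hx
          rw [he, hx, h3, RCLike.inner_apply]
  have hmem : MemLp u 2 volume := (memLp_congr_ae hae).2 hwm
  refine ⟨hmem, ?_⟩
  have hnorm : eLpNorm u 2 volume = eLpNorm w 2 volume := by
    rw [eLpNorm_congr_ae hae]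
    exact eLpNorm_congr_norm_ae (Filter.Eventually.of_forall fun x => by simp)
  rw [hnorm, ← Lp.enorm_def, ← ofReal_norm, ← ENNReal.ofReal_coe_nnreal]
  exact ENNReal.ofReal_le_ofReal hwn

theorem exists_norm_symbol_le {m ρ δ : ℝ} (hm : m ≤ 0)
    {σ : RSpace n × RSpace n × RSpace n → ℂ} (hσ : σ ∈ BS n m ρ δ) :
    ∃ C : ℝ, ∀ z, ‖σ z‖ ≤ C := by
  obtain ⟨C, hC, h⟩ := hσ.2 0 0 0
  refine ⟨C, fun z => ?_⟩
  have h1 := h z.1 z.2.1 z.2.2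
  change ‖mixedDeriv 0 0 0 σ z‖ ≤ _ at h1
  rw [mixedDeriv_zero] at h1
  refine h1.trans (mul_le_of_le_one_right hC.le (Real.rpow_le_one_of_one_le_of_nonpos ?_ ?_))
  · have := norm_nonneg z.2.1
    have := norm_nonneg z.2.2
    linarith
  · simpa using hm

/-- The integrand of the trilinear form associated with a bilinear pseudo-differential operator. -/
def phaseIntegrand (σ : RSpace n × RSpace n × RSpace n → ℂ) (f g : 𝓢(RSpace n, ℂ))
    (z : RSpace n × RSpace n × RSpace n) : ℂ :=
  Complex.exp (Complex.I * ((inner ℝ z.1 (z.2.1 + z.2.2) : ℝ) : ℂ)) * σ z *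
    fourierHat f z.2.1 * fourierHat g z.2.2

theorem integrable_fourierHat_prod (f g : 𝓢(RSpace n, ℂ)) :
    Integrable fun p : RSpace n × RSpace n => fourierHat f p.1 * fourierHat g p.2 := by
  simp only [← coe_schwartzHat]
  exact (schwartzHat f).integrable.mul_prod (schwartzHat g).integrable

section

variable {σ : RSpace n × RSpace n × RSpace n → ℂ} {K : ℝ}

theorem norm_phaseIntegrand_le (hK : ∀ z, ‖σ z‖ ≤ K) (f g : 𝓢(RSpace n, ℂ))
    (z : RSpace n × RSpace n × RSpace n) :
    ‖phaseIntegrand σ f g z‖ ≤ K * ‖fourierHat f z.2.1 * fourierHat g z.2.2‖ := by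
  rw [phaseIntegrand, mul_assoc, norm_mul, norm_mul, norm_exp_I_mul_ofReal', one_mul]
  exact mul_le_mul_of_nonneg_right (hK z) (norm_nonneg _)

theorem continuous_phaseIntegrand (hσ : Continuous σ) (f g : 𝓢(RSpace n, ℂ)) :
    Continuous (phaseIntegrand σ f g) := by
  unfold phaseIntegrand
  simp only [← coe_schwartzHat]
  have h1 : Continuous fun z : RSpace n × RSpace n × RSpace n => schwartzHat f z.2.1 :=
    (schwartzHat f).continuous.comp (by fun_prop)
  have h2 : Continuous fun z : RSpace n × RSpace n × RSpace n => schwartzHat g z.2.2 :=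
    (schwartzHat g).continuous.comp (by fun_prop)
  fun_prop

theorem integrable_phaseIntegrand_mul (hσ : Continuous σ) (hK : ∀ z, ‖σ z‖ ≤ K)
    (f g h : 𝓢(RSpace n, ℂ)) : Integrable fun z => phaseIntegrand σ f g z * h z.1 := by
  have h1 := (h.integrable (μ := volume)).norm.mul_prod
    ((integrable_fourierHat_prod f g).norm.const_mul K)
  refine Integrable.mono' h1 ?_ (Filter.Eventually.of_forall fun z => ?_)
  · have h2 : Continuous fun z : RSpace n × RSpace n × RSpace n => h z.1 :=
      h.continuous.comp continuous_fst
    exact ((continuous_phaseIntegrand hσ f g).mul h2).aestronglyMeasurable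
  · rw [norm_mul, mul_comm]
    exact mul_le_mul_of_nonneg_left (norm_phaseIntegrand_le hK f g z) (norm_nonneg _)

theorem bilinearOp_eq (f g : 𝓢(RSpace n, ℂ)) (x : RSpace n) :
    bilinearOp σ f g x =
      1 / ((2 * Real.pi : ℝ) : ℂ) ^ (2 * n) * ∫ p, phaseIntegrand σ f g (x, p) := rfl

theorem aestronglyMeasurable_bilinearOp (hσ : Continuous σ) (f g : 𝓢(RSpace n, ℂ)) :
    AEStronglyMeasurable (bilinearOp σ f g) := by
  have h := (continuous_phaseIntegrand hσ f g).stronglyMeasurable.integral_prod_right'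
    (ν := (volume : Measure (RSpace n × RSpace n)))
  exact (h.const_mul _).aestronglyMeasurable

theorem norm_two_pi_pow_inv_le : ‖1 / ((2 * Real.pi : ℝ) : ℂ) ^ (2 * n)‖ ≤ 1 := by
  rw [norm_div, norm_one, norm_pow, Complex.norm_real, Real.norm_of_nonneg (by positivity)]
  exact div_le_one_of_le₀ (one_le_pow₀ (by linarith [Real.pi_gt_three])) (by positivity)

theorem norm_bilinearOp_le (hK : ∀ z, ‖σ z‖ ≤ K) (f g : 𝓢(RSpace n, ℂ)) (x : RSpace n) :
    ‖bilinearOp σ f g x‖ ≤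
      ∫ p : RSpace n × RSpace n, K * ‖fourierHat f p.1 * fourierHat g p.2‖ := by
  rw [bilinearOp_eq, norm_mul]
  refine (mul_le_of_le_one_left (norm_nonneg _) norm_two_pi_pow_inv_le).trans ?_
  exact norm_integral_le_of_norm_le ((integrable_fourierHat_prod f g).norm.const_mul K)
    (Filter.Eventually.of_forall fun p => norm_phaseIntegrand_le hK f g (x, p))

theorem integral_bilinearOp_mul (hσ : Continuous σ) (hK : ∀ z, ‖σ z‖ ≤ K)
    (f g h : 𝓢(RSpace n, ℂ)) :
    ∫ x, bilinearOp σ f g x * h x =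
      1 / ((2 * Real.pi : ℝ) : ℂ) ^ (2 * n) * ∫ z, phaseIntegrand σ f g z * h z.1 := by
  have hi := integrable_phaseIntegrand_mul hσ hK f g h
  rw [Measure.volume_eq_prod] at hi ⊢
  rw [integral_prod _ hi, ← integral_const_mul]
  refine integral_congr_ae (Filter.Eventually.of_forall fun x => ?_)
  simp only
  rw [bilinearOp_eq, integral_mul_const, mul_assoc]

theorem mul_triKernel_zero (f g φ : 𝓢(RSpace n, ℂ)) (z : RSpace n × RSpace n × RSpace n) :
    σ z * triKernel 0 0 0 1 f g φ z = phaseIntegrand σ f g z * fourierHat φ z.1 := by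
  rw [triKernel, phaseIntegrand, stft_zero, stft_zero, stft_zero, inner_add_right,
    Complex.ofReal_add, mul_add, Complex.exp_add]
  ring

theorem tendsto_cutoff_dilation (z : RSpace n × RSpace n × RSpace n) :
    Filter.Tendsto (fun k : ℕ => cutoff n (dilation n (1 / ((k : ℝ) + 1)) (4 ^ k)⁻¹ z))
      Filter.atTop (nhds 1) := by
  have h0 : cutoff n ((0 : ℝ) • z.1, (0 : ℝ) • z.2) = 1 := by
    simp [cutoff, bump_eq_one]
  rw [← h0]
  simp only [dilation_apply]
  have h1 : Filter.Tendsto (fun k : ℕ => 1 / ((k : ℝ) + 1)) Filter.atTop (nhds 0) :=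
    tendsto_one_div_add_atTop_nhds_zero_nat
  have h2 : Filter.Tendsto (fun k : ℕ => ((4 : ℝ) ^ k)⁻¹) Filter.atTop (nhds 0) := by
    simp only [← inv_pow]
    exact tendsto_pow_atTop_nhds_zero_of_lt_one (by norm_num) (by norm_num)
  exact (contDiff_cutoff.continuous.tendsto _).comp
    ((h1.smul_const z.1).prodMk_nhds (h2.smul_const z.2))

/-- For bounded σ the full integrand is integrable and, as the cutoffs are at most 1, dominates the
truncated ones. -/
theorem tendsto_triForm_cutoff (hσ : Continuous σ) (hK : ∀ z, ‖σ z‖ ≤ K)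
    (f g φ : 𝓢(RSpace n, ℂ)) :
    Filter.Tendsto (fun k : ℕ => triForm 0 0 0 1 f g φ
        (fun z => σ z * cutoff n (dilation n (1 / ((k : ℝ) + 1)) (4 ^ k)⁻¹ z)))
      Filter.atTop (nhds (∫ z, phaseIntegrand σ f g z * fourierHat φ z.1)) := by
  have hi := integrable_phaseIntegrand_mul hσ hK f g (schwartzHat φ)
  simp only [coe_schwartzHat, ← mul_triKernel_zero] at hi
  simp only [← mul_triKernel_zero, triForm, mul_right_comm (σ _)]
  refine tendsto_integral_of_dominated_convergence
    (fun z => ‖σ z * triKernel 0 0 0 1 f g φ z‖) (fun k => ?_) hi.norm (fun k => ?_) ?_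
  · have h1 : Continuous fun z => cutoff n (dilation n (1 / ((k : ℝ) + 1)) (4 ^ k)⁻¹ z) :=
      contDiff_cutoff.continuous.comp (dilation n _ _).continuous
    exact hi.aestronglyMeasurable.mul h1.aestronglyMeasurable
  · refine Filter.Eventually.of_forall fun z => ?_
    rw [norm_mul]
    exact mul_le_of_le_one_right (norm_nonneg _) (norm_cutoff_le _)
  · refine Filter.Eventually.of_forall fun z => ?_
    simpa using (tendsto_cutoff_dilation z).const_mul (σ z * triKernel 0 0 0 1 f g φ z)

end

/-- The normalisation is not unitary, but its factor (2π)^{n/2} is at least 1, the direction needed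
to replace ‖φ‖₂ by ‖φ̂‖₂. -/
theorem eLpNorm_le_eLpNorm_fourierHat (φ : 𝓢(RSpace n, ℂ)) :
    eLpNorm φ 2 volume ≤ eLpNorm (fourierHat φ) 2 volume := by
  rw [eLpNorm_fourierHat]
  refine le_mul_of_one_le_left' ?_
  refine ENNReal.one_le_rpow ?_ (by norm_num)
  rw [ENNReal.one_le_ofReal]
  exact one_le_pow₀ (by linarith [Real.pi_gt_three])

theorem isBoundedLp_bilinearOp (hn : 1 ≤ n) {m ρ : ℝ} (hρ0 : 0 ≤ ρ) (hρ1 : ρ < 1)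
    (hm : m = -(1 - ρ) * (n : ℝ) / 2) {σ : RSpace n × RSpace n × RSpace n → ℂ}
    (hσ : σ ∈ BS n m ρ ρ) : IsBoundedLp (bilinearOp σ) 2 ⊤ 2 := by
  have hm0 : m ≤ 0 := by
    rw [hm]
    have : 0 ≤ (1 - ρ) * n := mul_nonneg (by linarith) (Nat.cast_nonneg n)
    linarith
  obtain ⟨K, hK⟩ := exists_norm_symbol_le hm0 hσ
  obtain ⟨C, hC⟩ := exists_enorm_triForm_cutoff_le hn hρ0 hρ1 hm hσ
  have hc := hσ.1.continuous
  refine ⟨C, fun f g => ?_⟩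
  have hf : eLpNorm f 2 volume ≠ ⊤ := (f.memLp 2 volume).eLpNorm_ne_top
  have hg : eLpNorm g ⊤ volume ≠ ⊤ := (g.memLp ⊤ volume).eLpNorm_ne_top
  have hfin : (C : ℝ≥0∞) * eLpNorm f 2 volume * eLpNorm g ⊤ volume ≠ ⊤ :=
    ENNReal.mul_ne_top (ENNReal.mul_ne_top ENNReal.coe_ne_top hf) hg
  have key := memLp_two_of_forall_integral_mul_le (aestronglyMeasurable_bilinearOp hc f g)
    (norm_bilinearOp_le hK f g)
    ((C : ℝ≥0∞) * eLpNorm f 2 volume * eLpNorm g ⊤ volume).toNNReal fun h => ?_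
  · rwa [ENNReal.coe_toNNReal hfin] at key
  rw [ENNReal.coe_toNNReal hfin, integral_bilinearOp_mul hc hK, enorm_mul]
  -- The test function is represented as φ̂, the third factor of the window-free trilinear form.
  obtain ⟨φ, hφ⟩ := exists_fourierHat_eq h
  have h1 : ‖1 / ((2 * Real.pi : ℝ) : ℂ) ^ (2 * n)‖ₑ ≤ 1 := by
    rw [← ofReal_norm, ← ENNReal.ofReal_one]
    exact ENNReal.ofReal_le_ofReal norm_two_pi_pow_inv_le
  refine (mul_le_of_le_one_left' h1).trans ?_
  simp only [← hφ]
  rw [mul_assoc, mul_assoc, ← mul_assoc (eLpNorm f 2 volume)]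
  refine le_of_tendsto (tendsto_triForm_cutoff hc hK f g φ).enorm
    (Filter.Eventually.of_forall fun k => ?_)
  have hk : (0 : ℝ) < (k : ℝ) + 1 := by positivity
  refine (hC (1 / ((k : ℝ) + 1)) k f g φ (by positivity) ?_).trans ?_
  · rw [div_le_one hk]
    linarith [Nat.cast_nonneg (α := ℝ) k]
  · have hle := eLpNorm_le_eLpNorm_fourierHat φ
    rw [show fourierHat φ = h from funext hφ] at hle
    gcongr

end BilinearPDO

end

theorem mainTheorem1 (n : ℕ) (hn : 1 ≤ n) (ρ : ℝ) (hρ0 : 0 ≤ ρ) (hρ1 : ρ < 1)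
    (m : ℝ) (hm : m = -(1 - ρ) * (n : ℝ) / 2)
    (σ : BilinearPDO.RSpace n × BilinearPDO.RSpace n × BilinearPDO.RSpace n → ℂ)
    (hσ : σ ∈ BilinearPDO.BS n m ρ ρ) :
    BilinearPDO.IsBoundedLp (BilinearPDO.bilinearOp σ) 2 ⊤ 2 :=
  BilinearPDO.isBoundedLp_bilinearOp hn hρ0 hρ1 hm hσ
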